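/- Let $M$ be a compact connected smooth 3-manifold without boundary with a Riemannian metric $g$, and let $(\xi,\eta,\phi)$ be a Sasakian structure on $(M,g)$. This means that $\eta$ is a contact form ($\eta\wedge d\eta\neq 0$ everywhere) with Reeb field $\xi$ ($\eta(\xi)=1$, $d\eta(\xi,\cdot)=0$); that $g$ is adapted to $\eta$, i.e. $|\xi|=1$ and $\tfrac12\,\eta\wedge d\eta$ is the Riemannian volume form $\upsilon_g$ of $g$ for the orientation it defines; that $\phi$ is the $(1,1)$-tensor field with $\phi^2=-I+\eta\otimes\xi$ and $\tfrac12 d\eta=g(\cdot,\phi\,\cdot)$; and that $\xi$ is a Killing field of $g$. Let $\ast$ be the Hodge star of $(g,\upsilon_g)$, put $\operatorname{curl}X=(\ast\,dX^\flat)^\sharp$, $\delta = (-1)^p\ast d\,\ast$ on $p$-forms and $\Delta=d\delta+\delta d$, and let $\mathrm{Scal}$ be the scalar curvature of $g$. An eigenfield of curl with eigenvalue $\mu\in\mathbb R$ is a smooth vector field $X\not\equiv0$ with $\operatorname{curl}X=\mu X$. (1) If $\mathrm{Scal}>-2$ everywhere on $M$, then every positive eigenvalue $\mu$ of curl which has an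 eigenfield $X$ tangent to the contact distribution $\ker\eta$ satisfies $$\mu\ \ge\ \tfrac14\min_M\mathrm{Scal}+\tfrac12 .$$ For every such pair $(\mu,X)$, equality holds if and only if both $|X|$ and $\mathrm{Scal}$ are constant on $M$. (2) If $\mathrm{Scal}\ge 6$ everywhere on $M$, then the smallest positive eigenvalue of curl is $2$, and the smallest non-zero eigenvalue of the Hodge Laplacian $\Delta$ restricted to smooth co-closed $1$-forms ($\delta\alpha=0$) is $4$. -/

import Mathlib

open Set Bundle Manifold
open scoped Manifold ContDiff Topology

noncomputable section

/-- The model space of a 3-manifold without boundary. -/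
abbrev E3 : Type := EuclideanSpace ℝ (Fin 3)

namespace SasakianThree

section Calculus

variable {M : Type*} [TopologicalSpace M] [ChartedSpace E3 M]

variable (M) in
/-- Vector fields (not necessarily smooth) on the 3-manifold `M`. -/
abbrev Field : Type _ := Π x : M, TangentSpace (𝓡 3) x

variable (M) in
/-- Differential `k`-forms (not necessarily smooth) on the 3-manifold `M`. -/
abbrev DiffForm (k : ℕ) : Type _ := Π x : M, TangentSpace (𝓡 3) x [⋀^Fin k]→L[ℝ] ℝ

/-- Smooth vector fields. -/
def SmoothField [IsManifold (𝓡 3) ∞ M] (X : Field M) : Prop :=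
  ContMDiff (𝓡 3) (𝓡 3).tangent ∞ (fun x ↦ (⟨x, X x⟩ : TangentBundle (𝓡 3) M))

/-- The expression of a form in the preferred chart `φ` at `x₀`, i.e. its pullback under the
inverse chart `φ⁻¹`. -/
def DiffForm.inChart {k : ℕ} (β : DiffForm M k) (x₀ : M) (y : E3) : E3 [⋀^Fin k]→L[ℝ] ℝ :=
  (β ((extChartAt (𝓡 3) x₀).symm y)).compContinuousLinearMap
    (mfderiv 𝓘(ℝ, E3) (𝓡 3) (extChartAt (𝓡 3) x₀).symm y)

/-- A form is smooth if its expression in every preferred chart is smooth. -/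
def DiffForm.Smooth {k : ℕ} (β : DiffForm M k) : Prop :=
  ∀ x₀ : M, ContDiffOn ℝ ∞ (β.inChart x₀) (extChartAt (𝓡 3) x₀).target

/-- The exterior derivative, computed at `x` in the preferred chart at `x`, with the normalization
`dα(X, Y) = X (α Y) - Y (α X) - α [X, Y]` for 1-forms. -/
def extd {k : ℕ} (β : DiffForm M k) : DiffForm M (k + 1) := fun x ↦
  (extDeriv (β.inChart x) (extChartAt (𝓡 3) x x)).compContinuousLinearMap
    (mfderiv (𝓡 3) 𝓘(ℝ, E3) (extChartAt (𝓡 3) x) x)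

/-- The derivative `X f` of a function along a vector field. -/
def dirDeriv (X : Field M) (f : M → ℝ) (x : M) : ℝ :=
  mvfderiv (𝓡 3) f x (X x)

/-- The Lie bracket of vector fields. -/
abbrev bracket (X Y : Field M) : Field M := VectorField.mlieBracket (𝓡 3) X Y

variable (M) in
lemma finrank_tangentSpace (x : M) : Module.finrank ℝ (TangentSpace (𝓡 3) x) = 3 := by
  change Module.finrank ℝ E3 = 3
  simp

instance (x : M) : FiniteDimensional ℝ (TangentSpace (𝓡 3) x) :=
  inferInstanceAs (FiniteDimensional ℝ E3)

end Calculus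

section HodgeStar

lemma append_update {V : Type*} {k m : ℕ} (u : Fin k → V) (v : Fin m → V) (i : Fin m) (w : V) :
    Fin.append u (Function.update v i w) =
      Function.update (Fin.append u v) (Fin.natAdd k i) w := by
  ext j
  refine Fin.addCases (fun j ↦ ?_) (fun j ↦ ?_) j
  · have hne : Fin.castAdd m j ≠ Fin.natAdd k i := by
      intro h
      have := congrArg Fin.val h
      simp at this
      omega
    simp [Function.update_of_ne hne]
  · by_cases hj : j = i
    · subst hj; simp
    · have hne : Fin.natAdd k j ≠ Fin.natAdd k i := by simpa using hj
      simp [Function.update_of_ne hne, Function.update_of_ne hj]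

variable {V : Type*} [AddCommGroup V] [Module ℝ V] [TopologicalSpace V]

/-- The `m`-form `v ↦ υ (u₁, …, u_k, v₁, …, v_m)` obtained by contracting an `n`-form `υ`
with `u₁, …, u_k`, where `k + m = n`. -/
def contractLeft {k m n : ℕ} (h : k + m = n) (υ : V [⋀^Fin n]→L[ℝ] ℝ) (u : Fin k → V) :
    V [⋀^Fin m]→L[ℝ] ℝ where
  toFun v := υ (Fin.append u v ∘ Fin.cast h.symm)
  map_update_add' := by
    intro hdec v i a b
    subst h
    have := Subsingleton.elim hdec (instDecidableEqFin m)
    subst this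
    simp [append_update]
  map_update_smul' := by
    intro hdec v i c a
    subst h
    have := Subsingleton.elim hdec (instDecidableEqFin m)
    subst this
    simp [append_update]
  map_eq_zero_of_eq' := by
    intro v i j hij hne
    subst h
    refine υ.map_eq_zero_of_eq _ (i := Fin.natAdd k i) (j := Fin.natAdd k j) ?_ ?_
    · simpa using hij
    · simpa using hne
  cont := by
    subst h
    refine υ.cont.comp (continuous_pi fun j ↦ ?_)
    refine Fin.addCases (fun j ↦ ?_) (fun j ↦ ?_) j
    · simpa using continuous_const
    · simpa using continuous_apply j

end HodgeStar

section Riemannian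

variable {M : Type*} [TopologicalSpace M] [ChartedSpace E3 M] [IsManifold (𝓡 3) ∞ M]
  [RiemannianBundle (fun x : M ↦ TangentSpace (𝓡 3) x)]

/-- The metric `g`. -/
def metric (X Y : Field M) (x : M) : ℝ := inner ℝ (X x) (Y x)

/-- A chosen orthonormal basis of the tangent space at `x`. -/
def onb (x : M) : OrthonormalBasis (Fin 3) ℝ (TangentSpace (𝓡 3) x) :=
  (stdOrthonormalBasis ℝ (TangentSpace (𝓡 3) x)).reindex (finCongr (finrank_tangentSpace M x))

/-- A vector field that is smooth near `x` and takes the value `e i` at `x`, where `e` is the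
chosen orthonormal basis at `x`. -/
def frameAt (x : M) (i : Fin 3) : Field M := FiberBundle.extend E3 (onb x i)

/-- The right-hand side of the Koszul formula for `g (∇_X Y, Z)`. -/
def koszul (X Y Z : Field M) (x : M) : ℝ :=
  (dirDeriv X (metric Y Z) x + dirDeriv Y (metric Z X) x - dirDeriv Z (metric X Y) x
    + metric (bracket X Y) Z x - metric (bracket Y Z) X x + metric (bracket Z X) Y x) / 2

/-- The Levi-Civita connection: `∇_X Y` at `x` is the vector `∑ i, g (∇_X Y, e i) e i` with
coefficients given by the Koszul formula. -/
def leviCivita (X Y : Field M) : Field M := fun x ↦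
  ∑ i, koszul X Y (frameAt x i) x • onb x i

/-- The Riemann curvature `R(X, Y)Z = ∇_X ∇_Y Z - ∇_Y ∇_X Z - ∇_[X, Y] Z`. -/
def curvature (X Y Z : Field M) : Field M :=
  leviCivita X (leviCivita Y Z) - leviCivita Y (leviCivita X Z) - leviCivita (bracket X Y) Z

/-- The scalar curvature `∑ i j, g (R(e i, e j) e j, e i)`; it is `6` on the unit 3-sphere. -/
def scalarCurvature (x : M) : ℝ :=
  ∑ i, ∑ j, metric (curvature (frameAt x i) (frameAt x j) (frameAt x j)) (frameAt x i) x

/-- The 1-form `X♭ = g (X, ·)`. -/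
def flat (X : Field M) : DiffForm M 1 := fun x ↦
  ContinuousAlternatingMap.ofSubsingleton ℝ (TangentSpace (𝓡 3) x) ℝ (0 : Fin 1)
    (innerSL ℝ (X x))

/-- The vector field `α♯` dual to the 1-form `α`. -/
def sharp (α : DiffForm M 1) : Field M := fun x ↦
  ∑ i, α x (fun _ ↦ onb x i) • onb x i

/-- The Hodge star of a 3-manifold with Riemannian volume form `υ`, on `k`-forms, `k + m = 3`:
`(⋆β)(v) = (1 / k!) ∑ β(e_{i 1}, …, e_{i k}) υ(e_{i 1}, …, e_{i k}, v)`. -/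
def hodgeStar (υ : DiffForm M 3) {k m : ℕ} (h : k + m = 3) (β : DiffForm M k) : DiffForm M m :=
  fun x ↦ ((k.factorial : ℝ)⁻¹) • ∑ i : Fin k → Fin 3,
    β x (fun a ↦ onb x (i a)) • contractLeft h (υ x) (fun a ↦ onb x (i a))

/-- `curl X = (⋆ d X♭)♯`. -/
def curl (υ : DiffForm M 3) (X : Field M) : Field M :=
  sharp (hodgeStar υ (show 2 + 1 = 3 by norm_num) (extd (flat X)))

/-- The codifferential `δ = (-1)^p ⋆ d ⋆` on `p`-forms of a 3-manifold, `p = k + 1`. -/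
def codiff (υ : DiffForm M 3) {k m : ℕ} (h : (k + 1) + m = 3) (β : DiffForm M (k + 1)) :
    DiffForm M k :=
  (-1 : ℝ) ^ (k + 1) • hodgeStar υ (show (m + 1) + k = 3 by omega) (extd (hodgeStar υ h β))

/-- A 1-form is co-closed if `δ α = 0`. -/
def CoClosed (υ : DiffForm M 3) (α : DiffForm M 1) : Prop :=
  codiff υ (show (0 + 1) + 2 = 3 by norm_num) α = 0

/-- The Hodge Laplacian `Δ = d δ + δ d` on 1-forms. -/
def hodgeLaplacian (υ : DiffForm M 3) (α : DiffForm M 1) : DiffForm M 1 :=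
  extd (codiff υ (show (0 + 1) + 2 = 3 by norm_num) α)
    + codiff υ (show (1 + 1) + 1 = 3 by norm_num) (extd α)

/-- `X` is an eigenfield of the curl operator with eigenvalue `μ`: a smooth vector field, not
identically zero, with `curl X = μ X`. -/
structure IsCurlEigenfield (υ : DiffForm M 3) (μ : ℝ) (X : Field M) : Prop where
  smooth : SmoothField X
  ne_zero : X ≠ 0
  eigen : curl υ X = μ • X

/-- `l` is an eigenvalue of the Hodge Laplacian restricted to co-closed 1-forms. -/
def IsCoClosedEigenvalue (υ : DiffForm M 3) (l : ℝ) : Prop :=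
  ∃ α : DiffForm M 1, α.Smooth ∧ α ≠ 0 ∧ CoClosed υ α ∧ hodgeLaplacian υ α = l • α

/-- The wedge product `α ∧ β` of a 1-form and a 2-form:
`(α ∧ β)(u, v, w) = α(u) β(v, w) - α(v) β(u, w) + α(w) β(u, v)`. -/
def wedge (α : DiffForm M 1) (β : DiffForm M 2) : DiffForm M 3 := fun x ↦
  ContinuousAlternatingMap.alternatizeUncurryFin
    (((ContinuousAlternatingMap.ofSubsingleton ℝ (TangentSpace (𝓡 3) x) ℝ (0 : Fin 1)).symm
      (α x)).smulRight (β x))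

/-- `ξ` is a Killing field: `L_ξ g = 0`. -/
def IsKilling (ξ : Field M) : Prop :=
  ∀ X Y : Field M, SmoothField X → SmoothField Y → ∀ x,
    dirDeriv ξ (metric X Y) x = metric (bracket ξ X) Y x + metric X (bracket ξ Y) x

variable (M) in
/-- A Sasakian structure `(ξ, η, φ)` on the Riemannian 3-manifold `(M, g)`: `η` is a contact form
with Reeb field `ξ`, the metric `g` is adapted to `η`, and `ξ` is Killing. -/
structure SasakianStructure where
  /-- the Reeb field -/
  ξ : Field M
  /-- the contact form -/
  η : DiffForm M 1
  /-- the structure tensor -/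
  φ : Π x : M, TangentSpace (𝓡 3) x →L[ℝ] TangentSpace (𝓡 3) x
  smooth_ξ : SmoothField ξ
  smooth_η : η.Smooth
  smooth_φ : ∀ X : Field M, SmoothField X → SmoothField (fun x ↦ φ x (X x))
  contact : ∀ x, wedge η (extd η) x ≠ 0
  η_reeb : ∀ x, η x ![ξ x] = 1
  dη_reeb : ∀ x (v : TangentSpace (𝓡 3) x), extd η x ![ξ x, v] = 0
  norm_reeb : ∀ x, ‖ξ x‖ = 1
  /-- `½ η ∧ dη` is the Riemannian volume form of the orientation it defines. -/
  adapted : ∀ x (b : OrthonormalBasis (Fin 3) ℝ (TangentSpace (𝓡 3) x)),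
    |(1 / 2 : ℝ) * wedge η (extd η) x b| = 1
  /-- `φ² = -I + η ⊗ ξ` -/
  φ_sq : ∀ x (v : TangentSpace (𝓡 3) x), φ x (φ x v) = -v + η x ![v] • ξ x
  /-- `½ dη = g (·, φ ·)` -/
  dη_eq : ∀ x (v w : TangentSpace (𝓡 3) x), (1 / 2 : ℝ) * extd η x ![v, w] = inner ℝ v (φ x w)
  killing : IsKilling ξ

/-- The Riemannian volume form `υ = ½ η ∧ dη`. -/
def SasakianStructure.vol (S : SasakianStructure M) : DiffForm M 3 :=
  (1 / 2 : ℝ) • wedge S.η (extd S.η)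

/-- `X` is tangent to the contact distribution `D = ker η`. -/
def SasakianStructure.TangentToContact (S : SasakianStructure M) (X : Field M) : Prop :=
  ∀ x, S.η x ![X x] = 0

end Riemannian

end SasakianThree

end

/-!
# Horizontal curl eigenfields and the first curl eigenvalue of a Sasakian 3-manifold

**Reduction to algebra.** Near every point the horizontal distribution has a smooth unit section
`e₁`, and `ξ, e₁, e₂ = -φ e₁` is an orthonormal frame (`SasakianStructure.exists_adaptedFrame`).
Cartan's formula for `dη` and the Killing equation leave only three unknown structure functions:
`[e₁, e₂] = -2 ξ + a e₁ + b e₂`, `[ξ, e₁] = c e₂`, `[ξ, e₂] = -c e₁`, related by the Jacobi identity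
(`AdaptedFrame.structureEquations`). With `Dᵢ` the derivations of the ring of smooth functions given
by the frame, the curl, the divergence, the Levi-Civita connection and the curvature of a field are
polynomial expressions in its components, in `a, b, c` and in their derivatives. The sectional
curvature is `1` for the planes containing `ξ`; if `K` denotes that of the contact planes, then
`Scal = 2 K + 4` (`AdaptedFrame.scalarCurvature_eq`) and `Ric = diag (2, K + 1, K + 1)`. A formal
computation gives, for divergence-free `X`, the Bochner formula (`StructureEquations.bochner`)

  `½ Δ |X|² = |∇ X|² + Ric (X, X) - ⟨X, curl (curl X)⟩`, where `Δ = div grad`.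

Everything below is pointwise and uses maximum principles; no integration is needed.

**Horizontal eigenfields.** If `curl X = μ X` with `μ ≠ 0` and `X` is horizontal, then the
components of `∇ X` that involve `ξ` are determined by `X`, and the formula becomes

  `½ Δ |X|² = |A|² + (Scal / 2 + 1 - 2 μ) |X|²`

with `A` the horizontal part of `∇ X` (`AdaptedFrame.exists_bochner_horizontal`). At a maximum of
`|X|²` the left side is nonpositive, so `Scal ≤ 4 μ - 2` there, which is the inequality
(`IsCurlEigenfield.scalarCurvature_le`). In the case of equality `Scal ≥ 4 μ - 2` everywhere, `|X|²`
is subharmonic, and by the strong maximum principle (`SasakianStructure.eq_of_laplacian_nonneg`,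
proved by Hopf's argument) it is constant. The matrix `A` is symmetric and trace-free and satisfies
`A X = ½ grad |X|²` on the contact planes; if `|X|` is constant, then `A = 0` and `Scal = 4 μ - 2`
(`IsCurlEigenfield.scalarCurvature_eq`). This also gives the converse.

**The first eigenvalues.** Let `Scal ≥ 6`, that is, `Ric ≥ 2`, and let `curl (curl X) = l X` with
`l ≠ 0` and `Y = curl X`. Since `curl X` is the antisymmetric part of `∇ X`, one has
`|∇ X|² ≥ ½ |curl X|²`, and the Bochner formulas for `X` and `Y` add up, at a maximum of
`N = |X|² + |Y|² / |l|`, to `0 ≥ ½ Δ N ≥ (|l| / 2 + 2 - l) N`. Hence `l ≥ 4`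
(`SasakianStructure.four_le_of_curl_curl`). For curl eigenfields `l = μ²`, and on co-closed forms
the Hodge Laplacian is `curl ∘ curl` (`hodgeLaplacian_of_coClosed`). Equality holds for the Reeb
field, as `curl ξ = 2 ξ` and `Δ η = 4 η` for the co-closed form `η`
(`SasakianStructure.curl_reeb`, `SasakianStructure.hodgeLaplacian_eta`).
-/

noncomputable section

namespace SasakianThree

/-! ### Calculus with vector fields on open sets -/

section LocalCalculus

variable {M : Type*} [TopologicalSpace M] [ChartedSpace E3 M]

/-- Real functions on `M` that are smooth on the set `U`. -/
abbrev SmoothFnOn (U : Set M) (f : M → ℝ) : Prop := ContMDiffOn (𝓡 3) 𝓘(ℝ, ℝ) ∞ f U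

lemma SmoothFnOn.contMDiffAt {U : Set M} (hU : IsOpen U) {f : M → ℝ} (hf : SmoothFnOn U f) {x : M}
    (hx : x ∈ U) : ContMDiffAt (𝓡 3) 𝓘(ℝ, ℝ) ∞ f x :=
  ContMDiffOn.contMDiffAt hf (hU.mem_nhds hx)

lemma SmoothFnOn.mdifferentiableAt {U : Set M} (hU : IsOpen U) {f : M → ℝ} (hf : SmoothFnOn U f)
    {x : M} (hx : x ∈ U) : MDifferentiableAt (𝓡 3) 𝓘(ℝ, ℝ) f x :=
  (hf.contMDiffAt hU hx).mdifferentiableAt (by simp)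

lemma dirDeriv_congr {X : Field M} {f g : M → ℝ} {x : M} (h : f =ᶠ[𝓝 x] g) :
    dirDeriv X f x = dirDeriv X g x := by
  unfold dirDeriv mvfderiv
  rw [h.mfderiv_eq]
  simp only [ContinuousLinearMap.comp_apply]
  rfl

lemma dirDeriv_congr_on {U : Set M} (hU : IsOpen U) {X Y : Field M} {f g : M → ℝ}
    (hX : ∀ x ∈ U, X x = Y x) (h : ∀ x ∈ U, f x = g x) {x : M} (hx : x ∈ U) :
    dirDeriv X f x = dirDeriv Y g x := by
  rw [dirDeriv_congr (Filter.eventuallyEq_of_mem (hU.mem_nhds hx) h)]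
  simp [dirDeriv, hX x hx]

lemma dirDeriv_add {X : Field M} {f g : M → ℝ} {x : M}
    (hf : MDifferentiableAt (𝓡 3) 𝓘(ℝ, ℝ) f x) (hg : MDifferentiableAt (𝓡 3) 𝓘(ℝ, ℝ) g x) :
    dirDeriv X (fun y ↦ f y + g y) x = dirDeriv X f x + dirDeriv X g x := by
  simp [dirDeriv, mvfderiv_fun_add hf hg]

lemma dirDeriv_mul {X : Field M} {f g : M → ℝ} {x : M}
    (hf : MDifferentiableAt (𝓡 3) 𝓘(ℝ, ℝ) f x) (hg : MDifferentiableAt (𝓡 3) 𝓘(ℝ, ℝ) g x) :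
    dirDeriv X (fun y ↦ f y * g y) x = f x * dirDeriv X g x + g x * dirDeriv X f x := by
  simp [dirDeriv, mvfderiv_fun_mul hf hg]

lemma dirDeriv_const (X : Field M) (c : ℝ) (x : M) : dirDeriv X (fun _ ↦ c) x = 0 := by
  simp [dirDeriv, mvfderiv_const]

lemma bracket_congr_on {U : Set M} (hU : IsOpen U) {X X' Y Y' : Field M}
    (hX : ∀ x ∈ U, X x = X' x) (hY : ∀ x ∈ U, Y x = Y' x) {x : M} (hx : x ∈ U) :
    bracket X Y x = bracket X' Y' x :=
  Filter.EventuallyEq.mlieBracket_vectorField_eq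
    (Filter.eventuallyEq_of_mem (hU.mem_nhds hx) hX)
    (Filter.eventuallyEq_of_mem (hU.mem_nhds hx) hY)

lemma bracket_swap (X Y : Field M) : bracket X Y = - bracket Y X :=
  VectorField.mlieBracket_swap

variable [IsManifold (𝓡 3) ∞ M]

variable (M) in
lemma isManifold_minSmoothness_two : IsManifold (𝓡 3) (minSmoothness ℝ 2) M := by
  rw [minSmoothness_of_isRCLikeNormedField]; infer_instance

variable (M) in
lemma isManifold_minSmoothness_three : IsManifold (𝓡 3) (minSmoothness ℝ 3) M := by
  rw [minSmoothness_of_isRCLikeNormedField]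
  infer_instance

/-- Vector fields that are smooth on the set `U`. -/
def SmoothFieldOn (U : Set M) (X : Field M) : Prop :=
  ContMDiffOn (𝓡 3) (𝓡 3).tangent ∞ (fun x ↦ (⟨x, X x⟩ : TangentBundle (𝓡 3) M)) U

lemma SmoothField.smoothFieldOn {X : Field M} (hX : SmoothField X) (U : Set M) :
    SmoothFieldOn U X := ContMDiff.contMDiffOn hX

lemma SmoothFieldOn.mono {U V : Set M} {X : Field M} (hX : SmoothFieldOn U X) (h : V ⊆ U) :
    SmoothFieldOn V X := ContMDiffOn.mono hX h

lemma SmoothFieldOn.contMDiffAt {U : Set M} (hU : IsOpen U) {X : Field M}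
    (hX : SmoothFieldOn U X) {x : M} (hx : x ∈ U) :
    ContMDiffAt (𝓡 3) (𝓡 3).tangent ∞ (fun x ↦ (⟨x, X x⟩ : TangentBundle (𝓡 3) M)) x :=
  ContMDiffOn.contMDiffAt hX (hU.mem_nhds hx)

lemma SmoothFieldOn.mdifferentiableAt {U : Set M} (hU : IsOpen U) {X : Field M}
    (hX : SmoothFieldOn U X) {x : M} (hx : x ∈ U) :
    MDifferentiableAt (𝓡 3) (𝓡 3).tangent (fun x ↦ (⟨x, X x⟩ : TangentBundle (𝓡 3) M)) x :=
  (hX.contMDiffAt hU hx).mdifferentiableAt (by simp)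

lemma SmoothFieldOn.congr {U : Set M} {X Y : Field M} (hX : SmoothFieldOn U X)
    (h : ∀ x ∈ U, Y x = X x) : SmoothFieldOn U Y :=
  ContMDiffOn.congr hX fun x hx ↦ by rw [h x hx]

lemma SmoothFieldOn.add {U : Set M} {X Y : Field M} (hX : SmoothFieldOn U X)
    (hY : SmoothFieldOn U Y) : SmoothFieldOn U (X + Y) :=
  ContMDiffOn.add_section hX hY

lemma SmoothFieldOn.smul {U : Set M} {f : M → ℝ} {X : Field M} (hf : SmoothFnOn U f)
    (hX : SmoothFieldOn U X) : SmoothFieldOn U (f • X) :=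
  ContMDiffOn.smul_section hf hX

lemma SmoothFieldOn.bracket {U : Set M} (hU : IsOpen U) {X Y : Field M} (hX : SmoothFieldOn U X)
    (hY : SmoothFieldOn U Y) : SmoothFieldOn U (bracket X Y) := by
  intro x hx
  have : IsManifold (𝓡 3) ((⊤ : ℕ∞) + 1) M := by
    have h : (((⊤ : ℕ∞) : ℕ∞ω) + 1) = ∞ := rfl
    rw [h]; infer_instance
  have := isManifold_minSmoothness_two M
  have h1 := hX.contMDiffAt hU hx
  have h2 := hY.contMDiffAt hU hx
  exact (ContMDiffAt.mlieBracket_vectorField (m := ⊤) (n := ⊤) h1 h2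
    (by simp)).contMDiffWithinAt

lemma SmoothFnOn.dirDeriv {U : Set M} (hU : IsOpen U) {X : Field M} {f : M → ℝ}
    (hX : SmoothFieldOn U X) (hf : SmoothFnOn U f) : SmoothFnOn U (dirDeriv X f) := by
  have h1 := ContMDiffOn.contMDiffOn_tangentMapWithin (m := ∞) hf (by simp) hU.uniqueMDiffOn
  have h2 : ContMDiffOn (𝓡 3) 𝓘(ℝ, ℝ).tangent ∞
      (fun x ↦ tangentMapWithin (𝓡 3) 𝓘(ℝ, ℝ) f U ⟨x, X x⟩) U :=
    h1.comp hX (fun x hx ↦ hx)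
  have h3 := (contMDiff_snd_tangentBundle_modelSpace ℝ 𝓘(ℝ, ℝ) (n := ∞)).comp_contMDiffOn h2
  refine h3.congr fun x hx ↦ ?_
  change _ = mfderivWithin (𝓡 3) 𝓘(ℝ, ℝ) f U x (X x)
  rw [mfderivWithin_of_isOpen hU hx]
  rfl

lemma bracket_smul_right {U : Set M} (hU : IsOpen U) (X : Field M) {Y : Field M} {f : M → ℝ}
    (hf : SmoothFnOn U f) (hY : SmoothFieldOn U Y) {x : M} (hx : x ∈ U) :
    bracket X (f • Y) x = dirDeriv X f x • Y x + f x • bracket X Y x :=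
  VectorField.mlieBracket_smul_right (hf.mdifferentiableAt hU hx) (hY.mdifferentiableAt hU hx)

lemma bracket_add_right {U : Set M} (hU : IsOpen U) (X : Field M) {Y Z : Field M}
    (hY : SmoothFieldOn U Y) (hZ : SmoothFieldOn U Z) {x : M} (hx : x ∈ U) :
    bracket X (Y + Z) x = bracket X Y x + bracket X Z x :=
  VectorField.mlieBracket_add_right (hY.mdifferentiableAt hU hx) (hZ.mdifferentiableAt hU hx)

lemma bracket_jacobi {U : Set M} (hU : IsOpen U) {X Y Z : Field M} (hX : SmoothFieldOn U X)
    (hY : SmoothFieldOn U Y) (hZ : SmoothFieldOn U Z) {x : M} (hx : x ∈ U) :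
    bracket X (bracket Y Z) x = bracket (bracket X Y) Z x + bracket Y (bracket X Z) x := by
  have := isManifold_minSmoothness_three M
  have h : minSmoothness ℝ 2 ≤ ∞ := by
    rw [minSmoothness_of_isRCLikeNormedField]; exact ENat.LEInfty.out
  exact VectorField.leibniz_identity_mlieBracket_apply ((hX.contMDiffAt hU hx).of_le h)
    ((hY.contMDiffAt hU hx).of_le h) ((hZ.contMDiffAt hU hx).of_le h)

lemma exists_smoothFieldOn_extend (x : M) (v : TangentSpace (𝓡 3) x) :
    ∃ V : Set M, IsOpen V ∧ x ∈ V ∧ SmoothFieldOn V (FiberBundle.extend E3 v : Field M) := by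
  obtain ⟨s, hs, h⟩ := FiberBundle.exists_contMDiffOn_extend (k := ∞) (𝓡 3) E3 v
  obtain ⟨V, hVs, hV, hxV⟩ := mem_nhds_iff.1 hs
  exact ⟨V, hV, hxV, ContMDiffOn.mono h hVs⟩

/-- Every smooth field near a point agrees near that point with a globally smooth field. -/
lemma exists_smoothField_eqOn [T2Space M] {U : Set M} (hU : IsOpen U) {X : Field M}
    (hX : SmoothFieldOn U X) {x : M} (hx : x ∈ U) :
    ∃ (Y : Field M) (V : Set M), SmoothField Y ∧ IsOpen V ∧ x ∈ V ∧ V ⊆ U ∧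
      ∀ y ∈ V, Y y = X y := by
  obtain ⟨f, -, hf⟩ := (SmoothBumpFunction.nhds_basis_tsupport (I := 𝓡 3) x).mem_iff.1
    (hU.mem_nhds hx)
  obtain ⟨V, hVs, hV, hxV⟩ := mem_nhds_iff.1 (Filter.inter_mem f.eventuallyEq_one (hU.mem_nhds hx))
  refine ⟨(f : M → ℝ) • X, V, ?_, hV, hxV, fun y hy ↦ (hVs hy).2, fun y hy ↦ ?_⟩
  · exact ContMDiffOn.smul_section_of_tsupport f.contMDiff.contMDiffOn hU hf hX
  · have : f y = 1 := (hVs hy).1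
    simp [this]

/-- The second derivative test along a smooth field, by restriction to an integral curve. For a
function of one variable it is reduced to the sufficient condition for a local minimum. -/
lemma dirDeriv_dirDeriv_nonpos_of_isLocalMax {U : Set M} (hU : IsOpen U) {X : Field M}
    (hX : SmoothFieldOn U X) {f : M → ℝ} (hf : SmoothFnOn U f) {x : M} (hx : x ∈ U)
    (hmax : IsLocalMax f x) : dirDeriv X f x = 0 ∧ dirDeriv X (dirDeriv X f) x ≤ 0 := by
  have : IsManifold (𝓡 3) 1 M := inferInstance
  obtain ⟨γ, hγ0, hγ⟩ := exists_isMIntegralCurveAt_of_contMDiffAt_boundaryless 0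
    ((hX.contMDiffAt hU hx).of_le (by simp : (1 : ℕ∞ω) ≤ ∞))
  have hcont : ContinuousAt γ 0 := hγ.continuousAt
  have hderiv : ∀ {g : M → ℝ}, SmoothFnOn U g →
      ∀ᶠ t in 𝓝 (0 : ℝ), HasDerivAt (g ∘ γ) (dirDeriv X g (γ t)) t := by
    intro g hg
    have hmem : ∀ᶠ t in 𝓝 (0 : ℝ), γ t ∈ U := hcont (by rw [hγ0]; exact hU.mem_nhds hx)
    filter_upwards [hmem, hγ] with t ht hγt
    have h := HasMFDerivAt.comp t (hg.mdifferentiableAt hU ht).hasMFDerivAt hγt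
    have h2 : HasFDerivAt (g ∘ γ) (show ℝ →L[ℝ] ℝ from
        (mfderiv (𝓡 3) 𝓘(ℝ, ℝ) g (γ t)).comp ((1 : ℝ →L[ℝ] ℝ).smulRight (X (γ t)))) t :=
      hasMFDerivAt_iff_hasFDerivAt.1 h
    convert! h2.hasDerivAt using 1
    change _ = mfderiv (𝓡 3) 𝓘(ℝ, ℝ) g (γ t) ((1 : ℝ) • X (γ t))
    rw [one_smul]
    rfl
  have h1 := hderiv hf
  have h2 := hderiv (hf.dirDeriv hU hX)
  have hmax' : IsLocalMax (f ∘ γ) 0 := by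
    have h : IsLocalMax f (γ 0) := hγ0.symm ▸ hmax
    have := hcont.eventually h
    exact this
  have e1 : deriv (f ∘ γ) =ᶠ[𝓝 0] dirDeriv X f ∘ γ := h1.mono fun t ht ↦ ht.deriv
  have e2 : deriv (deriv (f ∘ γ)) 0 = dirDeriv X (dirDeriv X f) x := by
    rw [e1.deriv_eq, h2.self_of_nhds.deriv, hγ0]
  have h0 : deriv (f ∘ γ) 0 = 0 := hmax'.deriv_eq_zero
  refine ⟨by rw [← h0, h1.self_of_nhds.deriv, hγ0], ?_⟩
  by_contra! hpos
  have hmin : IsLocalMin (f ∘ γ) 0 := isLocalMin_of_deriv_deriv_pos (by rwa [e2]) h0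
    h1.self_of_nhds.continuousAt
  -- a point that is both a local maximum and a local minimum has a neighbourhood of constancy
  have hc : f ∘ γ =ᶠ[𝓝 0] fun _ ↦ (f ∘ γ) 0 := by
    filter_upwards [hmax', hmin] with t h h' using le_antisymm h h'
  have hc' : deriv (f ∘ γ) =ᶠ[𝓝 0] fun _ ↦ 0 := by
    filter_upwards [hc.eventuallyEq_nhds] with t ht
    rw [ht.deriv_eq, deriv_const]
  rw [← e2, hc'.deriv_eq, deriv_const] at hpos
  exact lt_irrefl _ hpos

/-- The bracket acts on functions as the commutator of derivations. This follows from the Jacobi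
identity for `X`, `Y`, `f • Z`, where `Z` is any field that does not vanish at the given point. -/
lemma dirDeriv_bracket {U : Set M} (hU : IsOpen U) {X Y : Field M} {f : M → ℝ}
    (hX : SmoothFieldOn U X) (hY : SmoothFieldOn U Y) (hf : SmoothFnOn U f) {x : M} (hx : x ∈ U) :
    dirDeriv (bracket X Y) f x
      = dirDeriv X (dirDeriv Y f) x - dirDeriv Y (dirDeriv X f) x := by
  obtain ⟨v, hv⟩ : ∃ v : E3, v ≠ 0 := exists_ne 0
  obtain ⟨V, hV, hxV, hZ⟩ := exists_smoothFieldOn_extend x (v : TangentSpace (𝓡 3) x)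
  have hUV : IsOpen (U ∩ V) := hU.inter hV
  set Z : Field M := FiberBundle.extend E3 (v : TangentSpace (𝓡 3) x) with hZdef
  have hZx : Z x = v := FiberBundle.extend_apply_self ..
  replace hZ := hZ.mono (V := U ∩ V) inter_subset_right
  replace hX := hX.mono (V := U ∩ V) inter_subset_left
  replace hY := hY.mono (V := U ∩ V) inter_subset_left
  replace hf : SmoothFnOn (U ∩ V) f := hf.mono inter_subset_left
  replace hx : x ∈ U ∩ V := ⟨hx, hxV⟩
  have key : ∀ {A B : Field M}, SmoothFieldOn (U ∩ V) A → SmoothFieldOn (U ∩ V) B →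
      bracket A (bracket B (f • Z)) x = dirDeriv A (dirDeriv B f) x • Z x
        + dirDeriv B f x • bracket A Z x + (dirDeriv A f x • bracket B Z x
          + f x • bracket A (bracket B Z) x) := by
    intro A B hA hB
    rw [bracket_congr_on (X' := A) hUV (fun _ _ ↦ rfl)
      (fun y hy ↦ bracket_smul_right (U := U ∩ V) hUV B hf hZ hy) hx]
    change bracket A (dirDeriv B f • Z + f • bracket B Z) x = _
    rw [bracket_add_right hUV _ (SmoothFieldOn.smul (hf.dirDeriv hUV hB) hZ)
      (SmoothFieldOn.smul hf (hB.bracket hUV hZ)) hx,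
      bracket_smul_right hUV _ (hf.dirDeriv hUV hB) hZ hx,
      bracket_smul_right hUV _ hf (hB.bracket hUV hZ) hx]
  have hJ := bracket_jacobi hUV hX hY (SmoothFieldOn.smul hf hZ) hx
  rw [key hX hY, key hY hX, bracket_smul_right hUV _ hf hZ hx,
    bracket_jacobi hUV hX hY hZ hx] at hJ
  have h0 : (dirDeriv X (dirDeriv Y f) x - dirDeriv Y (dirDeriv X f) x
      - dirDeriv (bracket X Y) f x) • Z x = 0 := by
    rw [← sub_eq_zero.2 hJ]
    module
  rcases smul_eq_zero.1 h0 with h | h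
  · linarith
  · exact absurd (hZx ▸ h) hv

end LocalCalculus

/-! ### The structure equations of an adapted frame -/

section StructureEquations

variable {R : Type*} [CommRing R] [Algebra ℝ R]

/-- The structure equations of an adapted orthonormal frame `e₀ = ξ, e₁, e₂` of a Sasakian
3-manifold, for the derivations `Dᵢ` given by `eᵢ` on a ring of functions:
`[e₁, e₂] = -2 e₀ + a e₁ + b e₂`, `[e₀, e₁] = c e₂`, `[e₀, e₂] = -c e₁`. The last two
equations are the Jacobi identity. -/
structure StructureEquations (D : Fin 3 → Derivation ℝ R R) (a b c : R) : Prop where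
  comm01 : ∀ f, D 0 (D 1 f) - D 1 (D 0 f) = c * D 2 f
  comm02 : ∀ f, D 0 (D 2 f) - D 2 (D 0 f) = -c * D 1 f
  comm12 : ∀ f, D 1 (D 2 f) - D 2 (D 1 f) = -2 * D 0 f + a * D 1 f + b * D 2 f
  jacobi1 : D 0 a - b * c + D 1 c = 0
  jacobi2 : D 0 b + a * c + D 2 c = 0

variable (D : Fin 3 → Derivation ℝ R R) (a b c : R)

/-- The components of the curl of the field with components `f` in an adapted frame. -/
def frameCurl (f : Fin 3 → R) : Fin 3 → R :=
  ![D 1 (f 2) - D 2 (f 1) + 2 * f 0 - a * f 1 - b * f 2,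
    D 2 (f 0) - D 0 (f 2) - c * f 1,
    D 0 (f 1) - D 1 (f 0) - c * f 2]

/-- The divergence of the field with components `f` in an adapted frame. -/
def frameDiv (f : Fin 3 → R) : R :=
  D 0 (f 0) + D 1 (f 1) + D 2 (f 2) - b * f 1 + a * f 2

/-- The derivative of a function along the field with components `X`. -/
def frameAct (X : Fin 3 → R) (f : R) : R := X 0 * D 0 f + X 1 * D 1 f + X 2 * D 2 f

/-- The components of the Levi-Civita derivative `∇_X Y` in an adapted frame. -/
def frameNabla (X Y : Fin 3 → R) : Fin 3 → R :=
  ![frameAct D X (Y 0) - X 1 * Y 2 + X 2 * Y 1,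
    frameAct D X (Y 1) - ((c + 1) * X 0 - a * X 1 - b * X 2) * Y 2 - X 2 * Y 0,
    frameAct D X (Y 2) + ((c + 1) * X 0 - a * X 1 - b * X 2) * Y 1 + X 1 * Y 0]

/-- The components of the Lie bracket `[X, Y]` in an adapted frame. -/
def frameBracket (X Y : Fin 3 → R) : Fin 3 → R :=
  ![frameAct D X (Y 0) - frameAct D Y (X 0) - 2 * (X 1 * Y 2 - X 2 * Y 1),
    frameAct D X (Y 1) - frameAct D Y (X 1) + a * (X 1 * Y 2 - X 2 * Y 1)
      - c * (X 0 * Y 2 - X 2 * Y 0),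
    frameAct D X (Y 2) - frameAct D Y (X 2) + b * (X 1 * Y 2 - X 2 * Y 1)
      + c * (X 0 * Y 1 - X 1 * Y 0)]

/-- The sectional curvature of the contact planes in an adapted frame. -/
def contactCurvature : R := D 1 b - D 2 a - a ^ 2 - b ^ 2 - 2 * c - 3

/-- The Laplacian of a function in an adapted frame. -/
def frameLaplacian (u : R) : R :=
  D 0 (D 0 u) + D 1 (D 1 u) + D 2 (D 2 u) - b * D 1 u + a * D 2 u

/-- The matrix `(∇_{eᵢ} f)ⱼ` of the covariant derivative of the field with components `f`. -/
def covMatrix (f : Fin 3 → R) : Matrix (Fin 3) (Fin 3) R :=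
  !![D 0 (f 0), D 0 (f 1) - (c + 1) * f 2, D 0 (f 2) + (c + 1) * f 1;
    D 1 (f 0) - f 2, D 1 (f 1) + a * f 2, D 1 (f 2) - a * f 1 + f 0;
    D 2 (f 0) + f 1, D 2 (f 1) + b * f 2 - f 0, D 2 (f 2) - b * f 1]

variable {D a b c}

/-- The curl is divergence-free; the zeroth-order terms cancel by the Jacobi identity. -/
theorem StructureEquations.div_curl (h : StructureEquations D a b c) (f : Fin 3 → R) :
    frameDiv D a b (frameCurl D a b c f) = 0 := by
  have t2 (i : Fin 3) : D i (2 : R) = 0 := by simpa using (D i).map_natCast 2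
  simp only [frameDiv, frameCurl, Matrix.cons_val, map_add, map_sub, Derivation.leibniz,
    smul_eq_mul, t2]
  linear_combination h.comm01 (f 2) - h.comm02 (f 1) + h.comm12 (f 0) - f 1 * h.jacobi1
    - f 2 * h.jacobi2

/-- The Bochner formula for divergence-free fields, with the Ricci tensor
`diag (2, K + 1, K + 1)` of a Sasakian 3-manifold. -/
theorem StructureEquations.bochner (h : StructureEquations D a b c) (f : Fin 3 → R)
    (hf : frameDiv D a b f = 0) :
    frameLaplacian D a b (f 0 ^ 2 + f 1 ^ 2 + f 2 ^ 2) =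
      2 * (∑ i, ∑ j, covMatrix D a b c f i j ^ 2 + 2 * f 0 ^ 2
        + (contactCurvature D a b c + 1) * (f 1 ^ 2 + f 2 ^ 2)
        - ∑ j, f j * frameCurl D a b c (frameCurl D a b c f) j) := by
  have t2 (i : Fin 3) : D i (2 : R) = 0 := by simpa using (D i).map_natCast 2
  have hd (i : Fin 3) : D i (frameDiv D a b f) = 0 := by rw [hf, map_zero]
  have h0 := hd 0
  have h1 := hd 1
  have h2 := hd 2
  simp only [frameDiv, map_add, map_sub, Derivation.leibniz, smul_eq_mul] at h0 h1 h2 hf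
  -- the second-order terms reduce to `⟨f, grad (div f)⟩`, and commutators of the derivations
  simp only [frameLaplacian, frameCurl, contactCurvature, covMatrix, Fin.sum_univ_three,
    Matrix.cons_val, Matrix.of_apply, pow_two, map_add, map_sub, Derivation.leibniz,
    smul_eq_mul, t2]
  linear_combination 2 * (f 0 * h0 + f 1 * h1 + f 2 * h2
    - f 0 * h.comm01 (f 1) - f 0 * h.comm02 (f 2) + f 1 * h.comm01 (f 0) - f 1 * h.comm12 (f 2)
    + f 2 * h.comm02 (f 0) + f 2 * h.comm12 (f 1)
    + f 0 * f 1 * h.jacobi2 - f 0 * f 2 * h.jacobi1)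

/-- The curvature tensor: the sectional curvature is `1` for planes containing `ξ`, and `K` for
the contact planes. -/
theorem StructureEquations.curvature (h : StructureEquations D a b c) (X Y Z : Fin 3 → R) :
    frameNabla D a b c X (frameNabla D a b c Y Z) - frameNabla D a b c Y (frameNabla D a b c X Z)
      - frameNabla D a b c (frameBracket D a b c X Y) Z =
    ![(X 0 * Y 1 - X 1 * Y 0) * Z 1 + (X 0 * Y 2 - X 2 * Y 0) * Z 2,
      - (X 0 * Y 1 - X 1 * Y 0) * Z 0
        + contactCurvature D a b c * (X 1 * Y 2 - X 2 * Y 1) * Z 2,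
      - (X 0 * Y 2 - X 2 * Y 0) * Z 0
        - contactCurvature D a b c * (X 1 * Y 2 - X 2 * Y 1) * Z 1] := by
  ext k
  fin_cases k
  · simp only [frameNabla, frameBracket, contactCurvature, frameAct, Pi.sub_apply, Fin.zero_eta,
      Matrix.cons_val, map_add, map_sub, Derivation.leibniz, smul_eq_mul,
      Derivation.map_one_eq_zero]
    linear_combination (X 0 * Y 1 - X 1 * Y 0) * h.comm01 (Z 0)
      + (X 0 * Y 2 - X 2 * Y 0) * h.comm02 (Z 0) + (X 1 * Y 2 - X 2 * Y 1) * h.comm12 (Z 0)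
  · simp only [frameNabla, frameBracket, contactCurvature, frameAct, Pi.sub_apply, Fin.mk_one,
      Matrix.cons_val, map_add, map_sub, Derivation.leibniz, smul_eq_mul,
      Derivation.map_one_eq_zero]
    linear_combination (X 0 * Y 1 - X 1 * Y 0) * h.comm01 (Z 1)
      + (X 0 * Y 2 - X 2 * Y 0) * h.comm02 (Z 1) + (X 1 * Y 2 - X 2 * Y 1) * h.comm12 (Z 1)
      + (X 0 * Y 1 - X 1 * Y 0) * Z 2 * h.jacobi1 + (X 0 * Y 2 - X 2 * Y 0) * Z 2 * h.jacobi2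
  · simp only [frameNabla, frameBracket, contactCurvature, frameAct, Pi.sub_apply, Fin.reduceFinMk,
      Matrix.cons_val, map_add, map_sub, Derivation.leibniz, smul_eq_mul,
      Derivation.map_one_eq_zero]
    linear_combination (X 0 * Y 1 - X 1 * Y 0) * h.comm01 (Z 2)
      + (X 0 * Y 2 - X 2 * Y 0) * h.comm02 (Z 2) + (X 1 * Y 2 - X 2 * Y 1) * h.comm12 (Z 2)
      - (X 0 * Y 1 - X 1 * Y 0) * Z 1 * h.jacobi1 - (X 0 * Y 2 - X 2 * Y 0) * Z 1 * h.jacobi2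

end StructureEquations

/-! ### The exterior derivative -/

section ExteriorDerivative

variable {M : Type*} [TopologicalSpace M] [ChartedSpace E3 M]

/-- The derivative at `z` of the preferred chart at `x`. -/
def chartDeriv (x z : M) : TangentSpace (𝓡 3) z →L[ℝ] E3 :=
  mfderiv (𝓡 3) 𝓘(ℝ, E3) (extChartAt (𝓡 3) x) z

/-- The derivative at `y` of the inverse of the preferred chart at `x`. -/
def chartSymmDeriv (x : M) (y : E3) :
    E3 →L[ℝ] TangentSpace (𝓡 3) ((extChartAt (𝓡 3) x).symm y) :=
  mfderiv 𝓘(ℝ, E3) (𝓡 3) (extChartAt (𝓡 3) x).symm y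

lemma DiffForm.inChart_apply {k : ℕ} (β : DiffForm M k) (x : M) (y : E3) (v : Fin k → E3) :
    β.inChart x y v = β ((extChartAt (𝓡 3) x).symm y) (fun i ↦ chartSymmDeriv x y (v i)) := rfl

lemma extd_eq {k : ℕ} (β : DiffForm M k) (x : M) (v : Fin (k + 1) → TangentSpace (𝓡 3) x) :
    extd β x v = extDeriv (β.inChart x) (extChartAt (𝓡 3) x x) (fun i ↦ chartDeriv x x (v i)) :=
  rfl

/-- The expression of a vector field in the preferred chart at `x`. -/
def fieldInChart (X : Field M) (x : M) (y : E3) : E3 :=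
  chartDeriv x ((extChartAt (𝓡 3) x).symm y) (X ((extChartAt (𝓡 3) x).symm y))

lemma fieldInChart_of_eq (X : Field M) (x : M) {z : M} {y : E3}
    (h : (extChartAt (𝓡 3) x).symm y = z) : fieldInChart X x y = chartDeriv x z (X z) := by
  subst h; rfl

lemma fieldInChart_self (X : Field M) (x : M) :
    fieldInChart X x (extChartAt (𝓡 3) x x) = chartDeriv x x (X x) :=
  fieldInChart_of_eq X x (extChartAt_to_inv x)

theorem extd_smul {k : ℕ} (c : ℝ) (α : DiffForm M k) : extd (c • α) = c • extd α := by
  ext x v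
  change extd (c • α) x v = c • extd α x v
  rw [extd_eq, extd_eq]
  have : (c • α).inChart x = c • α.inChart x := by
    ext y v
    rfl
  rw [this, extDeriv_smul]
  rfl

theorem extd_zero {k : ℕ} : extd (0 : DiffForm M k) = 0 := by
  have := extd_smul 0 (0 : DiffForm M k)
  rwa [zero_smul, zero_smul] at this

variable [IsManifold (𝓡 3) ∞ M]

lemma chartDeriv_chartSymmDeriv {x : M} {y : E3} (hy : y ∈ (extChartAt (𝓡 3) x).target) (v : E3) :
    chartDeriv x ((extChartAt (𝓡 3) x).symm y) (chartSymmDeriv x y v) = v := by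
  have := mfderiv_extChartAt_comp_mfderivWithin_extChartAt_symm (I := 𝓡 3) hy
  rw [ModelWithCorners.range_eq_univ, mfderivWithin_univ] at this
  exact DFunLike.congr_fun this v

lemma chartSymmDeriv_chartDeriv {x : M} {y : E3} (hy : y ∈ (extChartAt (𝓡 3) x).target)
    (v : TangentSpace (𝓡 3) ((extChartAt (𝓡 3) x).symm y)) :
    chartSymmDeriv x y (chartDeriv x ((extChartAt (𝓡 3) x).symm y) v) = v := by
  have := mfderivWithin_extChartAt_symm_comp_mfderiv_extChartAt (I := 𝓡 3) hy
  rw [ModelWithCorners.range_eq_univ, mfderivWithin_univ] at this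
  exact DFunLike.congr_fun this v

lemma mpullback_eq_fieldInChart (X : Field M) {x : M} {y : E3}
    (hy : y ∈ (extChartAt (𝓡 3) x).target) :
    VectorField.mpullback 𝓘(ℝ, E3) (𝓡 3) (extChartAt (𝓡 3) x).symm X y = fieldInChart X x y := by
  have h : (chartSymmDeriv x y).inverse
      = chartDeriv x ((extChartAt (𝓡 3) x).symm y) :=
    ContinuousLinearMap.inverse_eq
      (ContinuousLinearMap.ext fun v ↦ chartSymmDeriv_chartDeriv hy v)
      (ContinuousLinearMap.ext fun v ↦ chartDeriv_chartSymmDeriv hy v)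
  change (chartSymmDeriv x y).inverse _ = _
  rw [h]
  rfl

lemma mpullback_eventuallyEq_fieldInChart (X : Field M) (x : M) :
    VectorField.mpullback 𝓘(ℝ, E3) (𝓡 3) (extChartAt (𝓡 3) x).symm X
      =ᶠ[𝓝 (extChartAt (𝓡 3) x x)] fieldInChart X x :=
  Filter.eventuallyEq_of_mem (extChartAt_target_mem_nhds x)
    fun _ hy ↦ mpullback_eq_fieldInChart X hy

lemma differentiableAt_fieldInChart {U : Set M} (hU : IsOpen U) {X : Field M}
    (hX : SmoothFieldOn U X) {x : M} (hx : x ∈ U) :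
    DifferentiableAt ℝ (fieldInChart X x) (extChartAt (𝓡 3) x x) := by
  have h := MDifferentiableWithinAt.differentiableWithinAt_mpullbackWithin_vectorField
    (hX.mdifferentiableAt hU hx).mdifferentiableWithinAt (s := univ)
  simp only [ModelWithCorners.range_eq_univ, VectorField.mpullbackWithin_univ, preimage_univ,
    inter_univ] at h
  exact (differentiableWithinAt_univ.1 h).congr_of_eventuallyEq
    (mpullback_eventuallyEq_fieldInChart X x).symm

lemma chartDeriv_bracket (X Y : Field M) (x : M) :
    chartDeriv x x (bracket X Y x) =
      VectorField.lieBracket ℝ (fieldInChart X x) (fieldInChart Y x) (extChartAt (𝓡 3) x x) := by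
  have h := VectorField.mlieBracketWithin_apply (I := 𝓡 3) (V := X) (W := Y) (s := univ) (x₀ := x)
  simp only [ModelWithCorners.range_eq_univ, VectorField.mpullbackWithin_univ, preimage_univ,
    inter_univ] at h
  obtain ⟨V, hV⟩ : ∃ V : E3 → E3,
      V = VectorField.mpullback 𝓘(ℝ, E3) (𝓡 3) (extChartAt (𝓡 3) x).symm X := ⟨_, rfl⟩
  obtain ⟨W, hW⟩ : ∃ W : E3 → E3,
      W = VectorField.mpullback 𝓘(ℝ, E3) (𝓡 3) (extChartAt (𝓡 3) x).symm Y := ⟨_, rfl⟩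
  have h2 : bracket X Y x = (chartDeriv x x).inverse
      (VectorField.lieBracketWithin ℝ V W univ (extChartAt (𝓡 3) x x)) := by
    rw [hV, hW]; exact h
  have hinv : (chartDeriv x x).IsInvertible :=
    isInvertible_mfderiv_extChartAt (mem_extChartAt_source x)
  rw [h2, hinv.self_apply_inverse, VectorField.lieBracketWithin_univ]
  exact Filter.EventuallyEq.lieBracket_vectorField_eq
    (hV ▸ mpullback_eventuallyEq_fieldInChart X x) (hW ▸ mpullback_eventuallyEq_fieldInChart Y x)

/-- The derivative along a field, computed in the preferred chart. -/
lemma dirDeriv_eq_fderiv (X : Field M) {x : M} {f : M → ℝ} {F : E3 → ℝ}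
    (hF : DifferentiableAt ℝ F (extChartAt (𝓡 3) x x))
    (h : ∀ᶠ y in 𝓝 (extChartAt (𝓡 3) x x), F y = f ((extChartAt (𝓡 3) x).symm y)) :
    dirDeriv X f x
      = fderiv ℝ F (extChartAt (𝓡 3) x x) (fieldInChart X x (extChartAt (𝓡 3) x x)) := by
  rw [fieldInChart_self]
  have hf : f =ᶠ[𝓝 x] F ∘ extChartAt (𝓡 3) x := by
    filter_upwards [(continuousAt_extChartAt (I := 𝓡 3) x).eventually h,
      extChartAt_source_mem_nhds (I := 𝓡 3) x] with z hz hz'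
    rw [Function.comp_apply, hz, (extChartAt (𝓡 3) x).left_inv hz']
  rw [dirDeriv_congr hf]
  have := mvfderiv_comp_apply x hF.mdifferentiableAt
    (mdifferentiableAt_extChartAt (I := 𝓡 3) (mem_chart_source _ x)) (X x)
  refine this.trans ?_
  change mfderiv 𝓘(ℝ, E3) 𝓘(ℝ, ℝ) F (extChartAt (𝓡 3) x x) _ = _
  rw [mfderiv_eq_fderiv]
  rfl

lemma inChart_apply_fieldInChart {k : ℕ} (α : DiffForm M k) (X : Fin k → Field M) {x : M} {y : E3}
    (hy : y ∈ (extChartAt (𝓡 3) x).target) :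
    α.inChart x y (fun i ↦ fieldInChart (X i) x y)
      = α ((extChartAt (𝓡 3) x).symm y) (fun i ↦ X i ((extChartAt (𝓡 3) x).symm y)) := by
  rw [DiffForm.inChart_apply]
  congr 1
  ext1 i
  exact chartSymmDeriv_chartDeriv hy _

lemma inChart_apply_one (α : DiffForm M 1) (X : Field M) {x : M} {y : E3}
    (hy : y ∈ (extChartAt (𝓡 3) x).target) :
    α.inChart x y ![fieldInChart X x y]
      = α ((extChartAt (𝓡 3) x).symm y) ![X ((extChartAt (𝓡 3) x).symm y)] := by
  have := inChart_apply_fieldInChart α (fun _ ↦ X) hy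
  convert this using 2 <;> ext i <;> fin_cases i <;> rfl

lemma inChart_apply_self (α : DiffForm M 1) (x : M) (v : TangentSpace (𝓡 3) x) :
    α.inChart x (extChartAt (𝓡 3) x x) ![chartDeriv x x v] = α x ![v] := by
  have key : ∀ z (v : TangentSpace (𝓡 3) z), (extChartAt (𝓡 3) x).symm (extChartAt (𝓡 3) x x) = z →
      α.inChart x (extChartAt (𝓡 3) x x) ![chartDeriv x z v] = α z ![v] := by
    rintro z v rfl
    rw [DiffForm.inChart_apply]
    congr 1
    ext1 i
    fin_cases i
    exact chartSymmDeriv_chartDeriv (mem_extChartAt_target x) _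
  exact key x v (extChartAt_to_inv x)

/-- Cartan's formula for the exterior derivative of a 1-form. -/
theorem extd_apply {U : Set M} (hU : IsOpen U) {α : DiffForm M 1} {X Y : Field M}
    (hX : SmoothFieldOn U X) (hY : SmoothFieldOn U Y) {x : M} (hx : x ∈ U)
    (hα : DifferentiableAt ℝ (α.inChart x) (extChartAt (𝓡 3) x x)) :
    extd α x ![X x, Y x] = dirDeriv X (fun y ↦ α y ![Y y]) x - dirDeriv Y (fun y ↦ α y ![X y]) x
      - α x ![bracket X Y x] := by
  set p := extChartAt (𝓡 3) x x with hp
  have hXd := differentiableAt_fieldInChart hU hX hx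
  have hYd := differentiableAt_fieldInChart hU hY hx
  have hpt := extChartAt_target_mem_nhds (I := 𝓡 3) x
  have hF : ∀ {Z : Field M}, SmoothFieldOn U Z → ∀ W : Field M,
      dirDeriv W (fun y ↦ α y ![Z y]) x
        = fderiv ℝ (fun y ↦ α.inChart x y ![fieldInChart Z x y]) p (fieldInChart W x p) := by
    intro Z hZ W
    refine dirDeriv_eq_fderiv W ?_ ?_
    · have hZd := differentiableAt_fieldInChart hU hZ hx
      exact hα.continuousAlternatingMap_apply
        (fun i ↦ by fin_cases i; exact hZd)
    · filter_upwards [hpt] with y hy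
      exact inChart_apply_one α Z hy
  have key := extDeriv_apply_vectorField (V := ![fieldInChart X x, fieldInChart Y x]) hα
    (fun i ↦ by fin_cases i <;> assumption)
  rw [hF hX, hF hY, ← inChart_apply_self, chartDeriv_bracket, extd_eq]
  have hv : (fun i ↦ chartDeriv x x (![X x, Y x] i))
      = fun i ↦ (![fieldInChart X x, fieldInChart Y x] : Fin 2 → E3 → E3) i p := by
    ext1 i
    fin_cases i
    · exact (fieldInChart_self X x).symm
    · exact (fieldInChart_self Y x).symm
  rw [hv, key]
  have hs : ∀ g : Fin 1 → Fin 1 → ℝ, ∑ i, ∑ j ≥ i, g i j = g 0 0 := fun g ↦ by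
    rw [Fintype.sum_unique]
    exact Finset.sum_singleton _ _
  have e0 : ∀ y, Fin.removeNth (0 : Fin 2)
      (fun j ↦ (![fieldInChart X x, fieldInChart Y x] : Fin 2 → E3 → E3) j y)
      = ![fieldInChart Y x y] := fun y ↦ by
    ext1 j; fin_cases j; rfl
  have e1 : ∀ y, Fin.removeNth (1 : Fin 2)
      (fun j ↦ (![fieldInChart X x, fieldInChart Y x] : Fin 2 → E3 → E3) j y)
      = ![fieldInChart X x y] := fun y ↦ by
    ext1 j; fin_cases j; rfl
  rw [Fin.sum_univ_two, hs]
  simp only [e0, e1]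
  have e2 : ∀ (v : E3) (k : Fin 0 → E3), (Matrix.vecCons v k : Fin 1 → E3) = ![v] := by
    intro v k
    ext1 j
    fin_cases j
    rfl
  rw [e2]
  simp only [Fin.val_zero, Fin.val_one, pow_zero, pow_one, add_zero, one_smul, neg_smul,
    ← sub_eq_add_neg]
  rfl

/-- The exterior derivative does not depend on the chart in which it is computed: the expressions
of `α` in the charts at `x` and at `q` are related by pullback under the transition map `ψ`, and
`extDeriv` commutes with pullbacks. -/
lemma inChart_extd {k : ℕ} {α : DiffForm M k} (hα : α.Smooth) {x : M} {y : E3}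
    (hy : y ∈ (extChartAt (𝓡 3) x).target) :
    (extd α).inChart x y = extDeriv (α.inChart x) y := by
  set q := (extChartAt (𝓡 3) x).symm y with hq
  set ψ : E3 → E3 := fun z ↦ extChartAt (𝓡 3) q ((extChartAt (𝓡 3) x).symm z) with hψ
  have hnear : ∀ᶠ z in 𝓝 y, z ∈ (extChartAt (𝓡 3) x).target ∧
      (extChartAt (𝓡 3) x).symm z ∈ (extChartAt (𝓡 3) q).source := by
    refine ((isOpen_extChartAt_target (I := 𝓡 3) x).mem_nhds hy |> Filter.eventually_of_mem <|
      fun _ h ↦ h).and ?_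
    exact (continuousAt_extChartAt_symm'' hy).eventually
      ((isOpen_extChartAt_source (I := 𝓡 3) q).mem_nhds (mem_extChartAt_source q))
  have hψd : ∀ z, z ∈ (extChartAt (𝓡 3) x).target →
      (extChartAt (𝓡 3) x).symm z ∈ (extChartAt (𝓡 3) q).source →
      ContDiffAt ℝ ∞ ψ z ∧ ∀ v, fderiv ℝ ψ z v
        = chartDeriv q ((extChartAt (𝓡 3) x).symm z) (chartSymmDeriv x z v) := by
    intro z hz hzq
    rw [extChartAt_source] at hzq
    have h1 : ContMDiffAt (𝓡 3) 𝓘(ℝ, E3) ∞ (extChartAt (𝓡 3) q) ((extChartAt (𝓡 3) x).symm z) :=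
      contMDiffAt_extChartAt' hzq
    have h2 : ContMDiffAt 𝓘(ℝ, E3) (𝓡 3) ∞ (extChartAt (𝓡 3) x).symm z :=
      (contMDiffOn_extChartAt_symm x).contMDiffAt
        ((isOpen_extChartAt_target (I := 𝓡 3) x).mem_nhds hz)
    refine ⟨(h1.comp z h2).contDiffAt, fun v ↦ ?_⟩
    have h3 := mfderiv_comp_apply z (h1.mdifferentiableAt (by simp))
      (h2.mdifferentiableAt (by simp)) v
    rw [mfderiv_eq_fderiv] at h3
    exact h3
  have hpull : α.inChart x =ᶠ[𝓝 y]
      fun z ↦ (α.inChart q (ψ z)).compContinuousLinearMap (fderiv ℝ ψ z) := by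
    filter_upwards [hnear] with z hz
    ext v
    rw [DiffForm.inChart_apply, ContinuousAlternatingMap.compContinuousLinearMap_apply,
      DiffForm.inChart_apply]
    have key : ∀ (u : E3) (w : M), u ∈ (extChartAt (𝓡 3) q).target →
        (extChartAt (𝓡 3) q).symm u = w → ∀ v : Fin k → TangentSpace (𝓡 3) w,
        α w v = α ((extChartAt (𝓡 3) q).symm u)
          (fun i ↦ chartSymmDeriv q u (chartDeriv q w (v i))) := by
      rintro u w hu rfl v
      congr 1
      ext1 i
      exact (chartSymmDeriv_chartDeriv hu _).symm
    rw [key (ψ z) _ ((extChartAt (𝓡 3) q).map_source hz.2) ((extChartAt (𝓡 3) q).left_inv hz.2)]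
    congr 1
    ext1 i
    exact congrArg _ ((hψd z hz.1 hz.2).2 (v i)).symm
  have hαd : DifferentiableAt ℝ (α.inChart q) (ψ y) :=
    ((hα q).contDiffAt (extChartAt_target_mem_nhds q)).differentiableAt (by simp)
  rw [hpull.extDeriv_eq, extDeriv_pullback hαd (hψd y hy (mem_extChartAt_source q)).1
    (by rw [minSmoothness_of_isRCLikeNormedField]; exact ENat.LEInfty.out)]
  ext v
  rw [DiffForm.inChart_apply, extd_eq, ContinuousAlternatingMap.compContinuousLinearMap_apply]
  congr 1
  ext1 i
  exact ((hψd y hy (mem_extChartAt_source q)).2 (v i)).symm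

theorem extd_extd {k : ℕ} {α : DiffForm M k} (hα : α.Smooth) : extd (extd α) = 0 := by
  ext x v
  have h : (extd α).inChart x =ᶠ[𝓝 (extChartAt (𝓡 3) x x)] extDeriv (α.inChart x) := by
    filter_upwards [extChartAt_target_mem_nhds (I := 𝓡 3) x] with y hy using inChart_extd hα hy
  rw [extd_eq, h.extDeriv_eq, extDeriv_extDeriv_apply
    ((hα x).contDiffAt (extChartAt_target_mem_nhds x))
    (by rw [minSmoothness_of_isRCLikeNormedField]; exact ENat.LEInfty.out)]
  rfl

end ExteriorDerivative

/-! ### Smooth forms and the musical isomorphism -/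

section SmoothForms

lemma ofSubsingletonLIE_symm_apply (g : E3 [⋀^Fin 1]→L[ℝ] ℝ) (v : E3) :
    (ContinuousAlternatingMap.ofSubsingletonLIE (𝕜 := ℝ) (E := E3) (F := ℝ) (0 : Fin 1)).symm g v
      = g ![v] := by
  obtain ⟨L, rfl⟩ := (ContinuousAlternatingMap.ofSubsingletonLIE (𝕜 := ℝ) (E := E3) (F := ℝ)
    (0 : Fin 1)).surjective g
  rw [LinearIsometryEquiv.symm_apply_apply]
  rfl

variable {M : Type*} [TopologicalSpace M] [ChartedSpace E3 M]

lemma flat_apply [RiemannianBundle (fun x : M ↦ TangentSpace (𝓡 3) x)] (X : Field M) (x : M)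
    (v : TangentSpace (𝓡 3) x) :
    flat X x ![v] = inner ℝ (X x) v := rfl

variable [IsManifold (𝓡 3) ∞ M]

lemma contDiffAt_fieldInChart {U : Set M} (hU : IsOpen U) {X : Field M}
    (hX : SmoothFieldOn U X) {x : M} (hx : x ∈ U) :
    ContDiffAt ℝ ∞ (fieldInChart X x) (extChartAt (𝓡 3) x x) := by
  have h := VectorField.contMDiffWithinAt_mpullbackWithin_extChartAt_symm (m := ∞) (n := ∞)
    (hX.contMDiffAt hU hx).contMDiffWithinAt uniqueMDiffOn_univ (mem_univ x) le_rfl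
  rw [ModelWithCorners.range_eq_univ, VectorField.mpullbackWithin_univ, preimage_univ,
    inter_univ] at h
  have h2 := (h.contMDiffAt (extChartAt_target_mem_nhds x))
  have h3 := contMDiffAt_vectorSpace_iff_contDiffAt.1 h2
  exact h3.congr_of_eventuallyEq (mpullback_eventuallyEq_fieldInChart X x).symm

lemma DiffForm.Smooth.smoothFnOn_apply {α : DiffForm M 1} (hα : α.Smooth) {U : Set M}
    (hU : IsOpen U) {X : Field M} (hX : SmoothFieldOn U X) :
    SmoothFnOn U (fun y ↦ α y ![X y]) := by
  intro x hx
  refine ContMDiffAt.contMDiffWithinAt ?_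
  have hαx : ContDiffAt ℝ ∞ (α.inChart x) (extChartAt (𝓡 3) x x) :=
    (hα x).contDiffAt (extChartAt_target_mem_nhds x)
  have hXx := contDiffAt_fieldInChart hU hX hx
  have hF : ContDiffAt ℝ ∞ (fun y ↦ α.inChart x y ![fieldInChart X x y])
      (extChartAt (𝓡 3) x x) := by
    have h := ((ContinuousAlternatingMap.ofSubsingletonLIE (𝕜 := ℝ) (E := E3) (F := ℝ)
      (0 : Fin 1)).symm.contDiff.contDiffAt.comp _ hαx).clm_apply hXx
    refine h.congr_of_eventuallyEq (Filter.Eventually.of_forall fun y ↦ ?_)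
    exact (ofSubsingletonLIE_symm_apply _ _).symm
  have h := hF.contMDiffAt.comp x (contMDiffAt_extChartAt (I := 𝓡 3) (n := ∞) (x := x))
  refine h.congr_of_eventuallyEq ?_
  filter_upwards [extChartAt_source_mem_nhds (I := 𝓡 3) x] with z hz
  rw [Function.comp_apply, inChart_apply_one α X ((extChartAt (𝓡 3) x).map_source hz),
    (extChartAt (𝓡 3) x).left_inv hz]

variable [RiemannianBundle (fun x : M ↦ TangentSpace (𝓡 3) x)]
  [IsContMDiffRiemannianBundle (𝓡 3) ∞ E3 (fun x : M ↦ TangentSpace (𝓡 3) x)]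

lemma SmoothFieldOn.metric {U : Set M} {X Y : Field M} (hX : SmoothFieldOn U X)
    (hY : SmoothFieldOn U Y) : SmoothFnOn U (metric X Y) :=
  ContMDiffOn.inner_bundle hX hY

lemma differentiableAt_inChart_flat {U : Set M} (hU : IsOpen U) {X : Field M}
    (hX : SmoothFieldOn U X) {x : M} (hx : x ∈ U) :
    DifferentiableAt ℝ ((flat X).inChart x) (extChartAt (𝓡 3) x x) := by
  -- the coefficients of `X♭` in the chart are the inner products of `X` with the coordinate fields
  have hV : ∀ v : E3, ContMDiffAt (𝓡 3) (𝓡 3).tangent ∞ (fun z ↦ (⟨z, VectorField.mpullback (𝓡 3)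
      𝓘(ℝ, E3) (extChartAt (𝓡 3) x) (fun _ ↦ v) z⟩ : TangentBundle (𝓡 3) M)) x := by
    intro v
    refine ContMDiffAt.mpullback_vectorField_preimage (m := ∞) (n := ∞) ?_
      contMDiffAt_extChartAt (isInvertible_mfderiv_extChartAt (mem_extChartAt_source x)) le_rfl
    exact contMDiffAt_vectorSpace_iff_contDiffAt.2 contDiffAt_const
  have hcoef : ∀ v : E3, DifferentiableAt ℝ
      (fun y ↦ (flat X).inChart x y ![v]) (extChartAt (𝓡 3) x x) := by
    intro v
    have h1 := ContMDiffAt.inner_bundle (hX.contMDiffAt hU hx) (hV v)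
    have h2 : ContMDiffAt 𝓘(ℝ, E3) (𝓡 3) ∞ (extChartAt (𝓡 3) x).symm (extChartAt (𝓡 3) x x) :=
      (contMDiffOn_extChartAt_symm x).contMDiffAt (extChartAt_target_mem_nhds x)
    have h3 := (ContMDiffAt.comp_of_eq h1 h2 (extChartAt_to_inv x)).contDiffAt
    refine (h3.differentiableAt (by simp)).congr_of_eventuallyEq ?_
    filter_upwards [extChartAt_target_mem_nhds (I := 𝓡 3) x] with y hy
    have hinv : (chartDeriv x ((extChartAt (𝓡 3) x).symm y)).inverse = chartSymmDeriv x y :=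
      ContinuousLinearMap.inverse_eq
        (ContinuousLinearMap.ext fun v ↦ chartDeriv_chartSymmDeriv hy v)
        (ContinuousLinearMap.ext fun v ↦ chartSymmDeriv_chartDeriv hy v)
    change inner ℝ (X _) (chartSymmDeriv x y v)
      = inner ℝ (X _) ((chartDeriv x ((extChartAt (𝓡 3) x).symm y)).inverse v)
    rw [hinv]
  have hsum : (flat X).inChart x = fun y ↦
      ContinuousAlternatingMap.ofSubsingletonLIE (𝕜 := ℝ) (E := E3) (F := ℝ) (0 : Fin 1)
        (∑ i, (flat X).inChart x y ![EuclideanSpace.single i 1]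
          • (EuclideanSpace.proj i : E3 →L[ℝ] ℝ)) := by
    ext y v
    set L := (ContinuousAlternatingMap.ofSubsingletonLIE (𝕜 := ℝ) (E := E3) (F := ℝ)
      (0 : Fin 1)).symm ((flat X).inChart x y) with hL
    have hLa : ∀ w : E3, (flat X).inChart x y ![w] = L w := fun w ↦
      (ofSubsingletonLIE_symm_apply _ _).symm
    have hv : v = ![v 0] := by ext1 i; fin_cases i; rfl
    simp only [hLa]
    rw [hv, hLa]
    change _ = (∑ i, L (EuclideanSpace.single i 1) • (EuclideanSpace.proj i : E3 →L[ℝ] ℝ)) (v 0)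
    have hb := (EuclideanSpace.basisFun (Fin 3) ℝ).sum_repr (v 0)
    conv_lhs => rw [← hb, map_sum]
    simp [mul_comm]
  rw [hsum]
  refine (ContinuousAlternatingMap.ofSubsingletonLIE (𝕜 := ℝ) (E := E3) (F := ℝ)
      (0 : Fin 1)).differentiableAt.comp _ ?_
  exact DifferentiableAt.fun_sum fun i _ ↦ (hcoef _).smul_const _

end SmoothForms

/-! ### Rings of smooth functions and pointwise identities -/

section SmoothRing

variable {M : Type*} [TopologicalSpace M] [ChartedSpace E3 M]

/-- The ring of smooth functions on `U`. Its elements are functions on the subtype `U`, so that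
two functions that agree on `U` are equal. -/
def smoothRing (U : Set M) : Subalgebra ℝ (U → ℝ) where
  carrier := {f | ∃ F : M → ℝ, SmoothFnOn U F ∧ ∀ x : U, f x = F x}
  mul_mem' := by
    rintro f g ⟨F, hF, hf⟩ ⟨G, hG, hg⟩
    exact ⟨F * G, ContMDiffOn.mul hF hG, fun x ↦ by simp [hf, hg]⟩
  add_mem' := by
    rintro f g ⟨F, hF, hf⟩ ⟨G, hG, hg⟩
    exact ⟨F + G, ContMDiffOn.add hF hG, fun x ↦ by simp [hf, hg]⟩
  algebraMap_mem' := fun r ↦ ⟨fun _ ↦ r, contMDiffOn_const, fun _ ↦ rfl⟩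

namespace smoothRing

variable {U : Set M}

/-- The restriction to `U` of a function that is smooth on `U`. -/
def mk (F : M → ℝ) (hF : SmoothFnOn U F) : smoothRing U := ⟨fun x ↦ F x, F, hF, fun _ ↦ rfl⟩

/-- Extension by zero of a function on `U`. -/
def ext (f : smoothRing U) : M → ℝ := Function.extend Subtype.val f.1 0

lemma ext_apply (f : smoothRing U) (x : U) : ext f x = f.1 x :=
  Subtype.val_injective.extend_apply _ _ _

lemma ext_apply_of_mem (f : smoothRing U) {x : M} (hx : x ∈ U) : ext f x = f.1 ⟨x, hx⟩ :=
  ext_apply f ⟨x, hx⟩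

lemma smoothFnOn_ext (f : smoothRing U) : SmoothFnOn U (ext f) := by
  obtain ⟨F, hF, hf⟩ := f.2
  exact ContMDiffOn.congr hF fun x hx ↦ by rw [← hf ⟨x, hx⟩, ext_apply_of_mem f hx]

end smoothRing

variable [IsManifold (𝓡 3) ∞ M]

/-- The derivation of the ring of smooth functions on `U` given by a field smooth on `U`. -/
def fieldDerivation {U : Set M} (hU : IsOpen U) (X : Field M) (hX : SmoothFieldOn U X) :
    Derivation ℝ (smoothRing U) (smoothRing U) :=
  Derivation.mk'
    { toFun := fun f ↦ smoothRing.mk (dirDeriv X (smoothRing.ext f))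
        (SmoothFnOn.dirDeriv hU hX (smoothRing.smoothFnOn_ext f))
      map_add' := fun f g ↦ by
        refine Subtype.ext (funext fun x ↦ ?_)
        change dirDeriv X (smoothRing.ext (f + g)) x =
          dirDeriv X (smoothRing.ext f) x + dirDeriv X (smoothRing.ext g) x
        rw [← dirDeriv_add ((smoothRing.smoothFnOn_ext f).mdifferentiableAt hU x.2)
          ((smoothRing.smoothFnOn_ext g).mdifferentiableAt hU x.2)]
        refine dirDeriv_congr_on hU (fun _ _ ↦ rfl) (fun y hy ↦ ?_) x.2
        simp [smoothRing.ext_apply_of_mem _ hy]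
      map_smul' := fun r f ↦ by
        refine Subtype.ext (funext fun x ↦ ?_)
        change dirDeriv X (smoothRing.ext (r • f)) x = r * dirDeriv X (smoothRing.ext f) x
        have h := dirDeriv_mul (X := X) (f := fun _ ↦ r) mdifferentiableAt_const
          ((smoothRing.smoothFnOn_ext f).mdifferentiableAt hU x.2)
        rw [dirDeriv_const, mul_zero, add_zero] at h
        rw [← h]
        refine dirDeriv_congr_on hU (fun _ _ ↦ rfl) (fun y hy ↦ ?_) x.2
        simp [smoothRing.ext_apply_of_mem _ hy] }
    (fun f g ↦ by
      refine Subtype.ext (funext fun x ↦ ?_)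
      change dirDeriv X (smoothRing.ext (f * g)) x =
        f.1 x * dirDeriv X (smoothRing.ext g) x + g.1 x * dirDeriv X (smoothRing.ext f) x
      rw [← smoothRing.ext_apply f, ← smoothRing.ext_apply g,
        ← dirDeriv_mul ((smoothRing.smoothFnOn_ext f).mdifferentiableAt hU x.2)
          ((smoothRing.smoothFnOn_ext g).mdifferentiableAt hU x.2)]
      refine dirDeriv_congr_on hU (fun _ _ ↦ rfl) (fun y hy ↦ ?_) x.2
      simp [smoothRing.ext_apply_of_mem _ hy])

lemma fieldDerivation_mk {U : Set M} (hU : IsOpen U) (X : Field M) (hX : SmoothFieldOn U X)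
    (F : M → ℝ) (hF : SmoothFnOn U F) :
    fieldDerivation hU X hX (smoothRing.mk F hF) = smoothRing.mk (dirDeriv X F)
      (SmoothFnOn.dirDeriv hU hX hF) := by
  refine Subtype.ext (funext fun x ↦ ?_)
  change dirDeriv X (smoothRing.ext (smoothRing.mk F hF)) x = dirDeriv X F x
  exact dirDeriv_congr_on hU (fun _ _ ↦ rfl)
    (fun y hy ↦ by rw [smoothRing.ext_apply_of_mem _ hy]; rfl) x.2

end SmoothRing

lemma extd_swap {M : Type*} [TopologicalSpace M] [ChartedSpace E3 M] (α : DiffForm M 1)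
    (x : M) (v w : TangentSpace (𝓡 3) x) : extd α x ![v, w] = - extd α x ![w, v] := by
  have h := (extd α x).toAlternatingMap.map_swap (v := ![w, v]) (i := 0) (j := 1) (by simp)
  have h2 : (![w, v] ∘ Equiv.swap (0 : Fin 2) 1) = ![v, w] := by
    ext1 i
    fin_cases i <;> rfl
  rw [h2] at h
  exact h

section Pointwise

variable {M : Type*} [TopologicalSpace M] [ChartedSpace E3 M] [IsManifold (𝓡 3) ∞ M]
  [RiemannianBundle (fun x : M ↦ TangentSpace (𝓡 3) x)]

namespace SasakianStructure

variable (S : SasakianStructure M)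

lemma inner_phi (x : M) (v w : TangentSpace (𝓡 3) x) :
    inner ℝ v (S.φ x w) = (1 / 2 : ℝ) * extd S.η x ![v, w] := (S.dη_eq x v w).symm

lemma phi_skew (x : M) (v w : TangentSpace (𝓡 3) x) :
    inner ℝ v (S.φ x w) = - inner ℝ (S.φ x v) w := by
  rw [inner_phi, extd_swap, real_inner_comm, inner_phi]
  ring

lemma phi_reeb (x : M) : S.φ x (S.ξ x) = 0 := by
  have h : inner ℝ (S.φ x (S.ξ x)) (S.φ x (S.ξ x)) = (0 : ℝ) := by
    rw [inner_phi, extd_swap, S.dη_reeb]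
    simp
  exact inner_self_eq_zero.1 h

/-- Pairing `φ² v = -v + η(v) ξ` with `ξ` shows that `η` is dual to `ξ`. -/
lemma eta_apply (x : M) (v : TangentSpace (𝓡 3) x) : S.η x ![v] = inner ℝ v (S.ξ x) := by
  have h := congrArg (fun u ↦ inner ℝ u (S.ξ x)) (S.φ_sq x v)
  simp only [inner_add_left, inner_neg_left, inner_smul_left, real_inner_self_eq_norm_sq,
    S.norm_reeb] at h
  rw [real_inner_comm, phi_skew, phi_reeb, inner_zero_left] at h
  simp only [neg_zero, conj_trivial, one_pow, mul_one] at h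
  linarith

lemma eta_eq_flat : S.η = flat S.ξ := by
  funext x
  ext v
  have hv : v = ![v 0] := by ext1 i; fin_cases i; rfl
  rw [hv, eta_apply, real_inner_comm]
  rfl

lemma inner_phi_phi (x : M) (v w : TangentSpace (𝓡 3) x) :
    inner ℝ (S.φ x v) (S.φ x w) = inner ℝ v w - inner ℝ v (S.ξ x) * inner ℝ w (S.ξ x) := by
  have h := S.phi_skew x v (S.φ x w)
  rw [S.φ_sq, inner_add_right, inner_neg_right, inner_smul_right, S.eta_apply] at h
  linarith

end SasakianStructure

end Pointwise

/-! ### Adapted frames -/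

section AdaptedFrame

variable {M : Type*} [TopologicalSpace M] [ChartedSpace E3 M] [IsManifold (𝓡 3) ∞ M]
  [RiemannianBundle (fun x : M ↦ TangentSpace (𝓡 3) x)]

/-- A horizontal field `e₁` that is smooth on `M` and has length `1` on the open set `U`. It
determines the orthonormal frame `ξ, e₁, e₂ = -φ e₁` on `U`. -/
structure AdaptedFrame (S : SasakianStructure M) (U : Set M) where
  /-- the horizontal unit field -/
  e₁ : Field M
  isOpen : IsOpen U
  smooth : SmoothField e₁
  unit : ∀ x ∈ U, inner ℝ (e₁ x) (e₁ x) = (1 : ℝ)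
  horizontal : ∀ x ∈ U, inner ℝ (e₁ x) (S.ξ x) = (0 : ℝ)

namespace AdaptedFrame

variable {S : SasakianStructure M} {U : Set M} (F : AdaptedFrame S U)

/-- The frame `ξ, e₁, e₂ = -φ e₁`. -/
def e : Fin 3 → Field M := ![S.ξ, F.e₁, fun x ↦ -S.φ x (F.e₁ x)]

lemma smooth_e (i : Fin 3) : SmoothField (F.e i) := by
  fin_cases i
  · exact S.smooth_ξ
  · exact F.smooth
  · exact ContMDiff.neg_section (S.smooth_φ F.e₁ F.smooth)

lemma phi_e_two {x : M} (hx : x ∈ U) : S.φ x (F.e 2 x) = F.e 1 x := by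
  change S.φ x (-S.φ x (F.e₁ x)) = F.e₁ x
  rw [map_neg, S.φ_sq, S.eta_apply, F.horizontal x hx]
  simp

lemma inner_e {x : M} (hx : x ∈ U) (i j : Fin 3) :
    inner ℝ (F.e i x) (F.e j x) = if i = j then (1 : ℝ) else 0 := by
  have h00 : inner ℝ (S.ξ x) (S.ξ x) = (1 : ℝ) := by
    rw [real_inner_self_eq_norm_sq, S.norm_reeb, one_pow]
  have h12 : inner ℝ (F.e₁ x) (S.φ x (F.e₁ x)) = (0 : ℝ) := by
    have h := S.phi_skew x (F.e₁ x) (F.e₁ x)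
    rw [real_inner_comm (F.e₁ x)] at h
    have h' := real_inner_comm (F.e₁ x) (S.φ x (F.e₁ x))
    linarith
  have h02 : inner ℝ (S.ξ x) (S.φ x (F.e₁ x)) = (0 : ℝ) := by
    rw [S.phi_skew, S.phi_reeb, inner_zero_left, neg_zero]
  have h22 : inner ℝ (S.φ x (F.e₁ x)) (S.φ x (F.e₁ x)) = (1 : ℝ) := by
    rw [S.inner_phi_phi, F.unit x hx, F.horizontal x hx]
    norm_num
  have h10 := F.horizontal x hx
  have h11 := F.unit x hx
  have sym : ∀ v w : TangentSpace (𝓡 3) x, inner ℝ v w = (inner ℝ w v : ℝ) :=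
    fun v w ↦ real_inner_comm w v
  have neg : ∀ v w : TangentSpace (𝓡 3) x, inner ℝ v w = (0 : ℝ) → inner ℝ v (-w) = (0 : ℝ) :=
    fun v w h ↦ by rw [inner_neg_right, h, neg_zero]
  fin_cases i <;> fin_cases j
  · exact h00
  · exact (sym _ _).trans h10
  · exact neg _ _ h02
  · exact h10
  · exact h11
  · exact neg _ _ h12
  · exact (sym _ _).trans (neg _ _ h02)
  · exact (sym _ _).trans (neg _ _ h12)
  · exact (inner_neg_neg _ _).trans h22

lemma orthonormal_e {x : M} (hx : x ∈ U) : Orthonormal ℝ (fun i ↦ F.e i x) :=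
  orthonormal_iff_ite.2 (F.inner_e hx)

/-- The adapted frame at a point of `U`. -/
def basis {x : M} (hx : x ∈ U) : OrthonormalBasis (Fin 3) ℝ (TangentSpace (𝓡 3) x) :=
  (basisOfOrthonormalOfCardEqFinrank (F.orthonormal_e hx)
    (by rw [finrank_tangentSpace M x]; rfl)).toOrthonormalBasis
    (by rw [coe_basisOfOrthonormalOfCardEqFinrank]; exact F.orthonormal_e hx)

lemma basis_apply {x : M} (hx : x ∈ U) (i : Fin 3) : F.basis hx i = F.e i x := by
  simp [basis]

lemma ext_inner {x : M} (hx : x ∈ U) {v w : TangentSpace (𝓡 3) x}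
    (h : ∀ i, inner ℝ v (F.e i x) = (inner ℝ w (F.e i x) : ℝ)) : v = w := by
  rw [← (F.basis hx).sum_repr' v, ← (F.basis hx).sum_repr' w]
  refine Finset.sum_congr rfl fun i _ ↦ ?_
  rw [basis_apply, real_inner_comm, h, real_inner_comm]

end AdaptedFrame

/-- Every tangent space contains a unit vector orthogonal to `ξ`; extend it, project it to
`ker η` and normalize. -/
lemma SasakianStructure.exists_adaptedFrame [T2Space M]
    [IsContMDiffRiemannianBundle (𝓡 3) ∞ E3 (fun x : M ↦ TangentSpace (𝓡 3) x)]
    (S : SasakianStructure M) (x : M) : ∃ U : Set M, x ∈ U ∧ Nonempty (AdaptedFrame S U) := by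
  obtain ⟨v, hv, hv1⟩ : ∃ v : TangentSpace (𝓡 3) x, inner ℝ v (S.ξ x) = (0 : ℝ) ∧ v ≠ 0 := by
    have : ∃ v ∈ (ℝ ∙ S.ξ x)ᗮ, v ≠ 0 := by
      refine Submodule.exists_mem_ne_zero_of_ne_bot fun h ↦ ?_
      have h1 := Submodule.finrank_add_finrank_orthogonal (ℝ ∙ S.ξ x)
      have h2 := finrank_span_le_card (R := ℝ) ({S.ξ x} : Set (TangentSpace (𝓡 3) x))
      rw [h, finrank_bot, finrank_tangentSpace M x] at h1
      simp at h2
      omega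
    obtain ⟨v, hv, hv0⟩ := this
    exact ⟨v, by rw [real_inner_comm]; exact hv _ (Submodule.mem_span_singleton_self _), hv0⟩
  obtain ⟨V, hV, hxV, hs⟩ := exists_smoothFieldOn_extend x v
  set X : Field M := FiberBundle.extend E3 v with hX
  have hξ := S.smooth_ξ.smoothFieldOn V
  set W : Field M := X + (fun y ↦ - metric X S.ξ y) • S.ξ with hW
  have hWs : SmoothFieldOn V W := hs.add (SmoothFieldOn.smul (ContMDiffOn.neg (hs.metric hξ)) hξ)
  have hWξ : ∀ y, inner ℝ (W y) (S.ξ y) = (0 : ℝ) := by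
    intro y
    simp only [hW, Pi.add_apply, Pi.smul_apply', inner_add_left, inner_smul_left, metric,
      real_inner_self_eq_norm_sq, S.norm_reeb]
    simp
  have hWx : W x = v := by
    have : X x = v := FiberBundle.extend_apply_self E3 v
    simp [hW, metric, this, hv]
  have hN := hWs.metric hWs
  have hpos : ∀ y, W y ≠ 0 → 0 < metric W W y := fun y hy ↦ real_inner_self_pos.2 hy
  obtain ⟨V', hV'V, hV', hxV'⟩ : ∃ V' ⊆ V, IsOpen V' ∧ x ∈ V' ∧ ∀ y ∈ V', 0 < metric W W y := by
    have hc : ContinuousAt (metric W W) x := (hN.contMDiffAt hV hxV).continuousAt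
    have := hc.eventually (lt_mem_nhds (hpos x (by rw [hWx]; exact hv1)))
    obtain ⟨V', h1, h2, h3⟩ := mem_nhds_iff.1 (Filter.inter_mem this (hV.mem_nhds hxV))
    exact ⟨V', fun y hy ↦ (h1 hy).2, h2, h3, fun y hy ↦ (h1 hy).1⟩
  obtain ⟨hxV', hp⟩ := hxV'
  have hsq : SmoothFnOn V' (fun y ↦ (Real.sqrt (metric W W y))⁻¹) := by
    intro y hy
    have h1 : ContDiffAt ℝ ∞ (fun t : ℝ ↦ (Real.sqrt t)⁻¹) (metric W W y) :=
      (Real.contDiffAt_sqrt (hp y hy).ne').inv (Real.sqrt_ne_zero'.2 (hp y hy))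
    exact (h1.contMDiffAt.comp y (hN.contMDiffAt hV (hV'V hy))).contMDiffWithinAt
  obtain ⟨Y, U, hYs, hU, hxU, hUV, hY⟩ := exists_smoothField_eqOn hV'
    (SmoothFieldOn.smul hsq (hWs.mono hV'V)) hxV'
  refine ⟨U, hxU, ⟨⟨Y, hU, hYs, fun y hy ↦ ?_, fun y hy ↦ ?_⟩⟩⟩
  · rw [hY y hy, Pi.smul_apply', inner_smul_left, inner_smul_right]
    change (Real.sqrt (metric W W y))⁻¹ * ((Real.sqrt (metric W W y))⁻¹ * metric W W y) = 1
    have := Real.mul_self_sqrt (hp y (hUV hy)).le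
    have h0 := Real.sqrt_ne_zero'.2 (hp y (hUV hy))
    field_simp
    rw [pow_two, this]
  · rw [hY y hy, Pi.smul_apply', inner_smul_left, hWξ, mul_zero]

end AdaptedFrame

/-! ### Structure equations from the Sasakian structure -/

/-- Evaluation of smooth functions at a point of `U`. -/
def smoothRing.eval {M : Type*} [TopologicalSpace M] [ChartedSpace E3 M] {U : Set M} (x : U) :
    smoothRing U →ₐ[ℝ] ℝ :=
  (Pi.evalAlgHom ℝ (fun _ : U ↦ ℝ) x).comp (smoothRing U).val

lemma smoothRing.ext_eq_eval {M : Type*} [TopologicalSpace M] [ChartedSpace E3 M] {U : Set M}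
    (f : smoothRing U) {x : M} (hx : x ∈ U) : smoothRing.ext f x = smoothRing.eval ⟨x, hx⟩ f :=
  smoothRing.ext_apply_of_mem f hx

lemma smoothRing.eval_injective {M : Type*} [TopologicalSpace M] [ChartedSpace E3 M] {U : Set M}
    {f g : smoothRing U} (h : ∀ x, smoothRing.eval x f = smoothRing.eval x g) : f = g :=
  Subtype.ext (funext h)

namespace AdaptedFrame

variable {M : Type*} [TopologicalSpace M] [ChartedSpace E3 M] [IsManifold (𝓡 3) ∞ M]
  [RiemannianBundle (fun x : M ↦ TangentSpace (𝓡 3) x)]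
  {S : SasakianStructure M} {U : Set M} (F : AdaptedFrame S U)

/-- The derivation of the smooth functions on `U` given by `eᵢ`. -/
def D (i : Fin 3) : Derivation ℝ (smoothRing U) (smoothRing U) :=
  fieldDerivation F.isOpen (F.e i) ((F.smooth_e i).smoothFieldOn U)

lemma eval_D (i : Fin 3) (f : smoothRing U) (x : U) :
    smoothRing.eval x (F.D i f) = dirDeriv (F.e i) (smoothRing.ext f) x := rfl

/-- The field with the components `f` in the frame. -/
def field (f : Fin 3 → smoothRing U) : Field M := fun x ↦ ∑ i, smoothRing.ext (f i) x • F.e i x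

lemma field_eq_sum (f : Fin 3 → smoothRing U) :
    F.field f = smoothRing.ext (f 0) • F.e 0 + smoothRing.ext (f 1) • F.e 1
      + smoothRing.ext (f 2) • F.e 2 :=
  funext fun _ ↦ Fin.sum_univ_three _

lemma smoothFieldOn_field (f : Fin 3 → smoothRing U) : SmoothFieldOn U (F.field f) := by
  rw [field_eq_sum]
  have h (i : Fin 3) : SmoothFieldOn U (smoothRing.ext (f i) • F.e i) :=
    SmoothFieldOn.smul (smoothRing.smoothFnOn_ext (f i)) ((F.smooth_e i).smoothFieldOn U)
  exact ((h 0).add (h 1)).add (h 2)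

lemma field_apply (f : Fin 3 → smoothRing U) (x : U) :
    F.field f x = smoothRing.eval x (f 0) • F.e 0 x + smoothRing.eval x (f 1) • F.e 1 x
      + smoothRing.eval x (f 2) • F.e 2 x := by
  simp only [field, Fin.sum_univ_three, smoothRing.ext_eq_eval _ x.2]

lemma inner_field_e (f : Fin 3 → smoothRing U) (x : U) (i : Fin 3) :
    inner ℝ (F.field f x) (F.e i x) = smoothRing.eval x (f i) := by
  simp only [field, sum_inner, inner_smul_left, F.inner_e x.2, smoothRing.ext_eq_eval _ x.2]
  simp

lemma field_injective {f g : Fin 3 → smoothRing U} (h : ∀ x ∈ U, F.field f x = F.field g x) :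
    f = g := by
  funext i
  refine smoothRing.eval_injective fun x ↦ ?_
  rw [← F.inner_field_e, h x x.2, F.inner_field_e]

lemma inner_field_field (f g : Fin 3 → smoothRing U) (x : U) :
    inner ℝ (F.field f x) (F.field g x) =
      smoothRing.eval x (f 0 * g 0 + f 1 * g 1 + f 2 * g 2) := by
  conv_lhs => rw [F.field_apply g]
  simp only [inner_add_right, inner_smul_right, F.inner_field_e, map_add, map_mul]
  ring

lemma dirDeriv_field (f : Fin 3 → smoothRing U) (u : smoothRing U) (x : U) :
    dirDeriv (F.field f) (smoothRing.ext u) x = smoothRing.eval x (frameAct F.D f u) := by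
  simp only [dirDeriv, F.field_apply, map_add, map_smul, frameAct, map_mul, eval_D, smul_eq_mul]

/-- The components of the frame fields are the coordinate vectors. -/
lemma field_single (i : Fin 3) (x : U) : F.field (Pi.single i 1) x = F.e i x := by
  simp only [field, smoothRing.ext_eq_eval _ x.2]
  rw [Finset.sum_eq_single i]
  · simp
  · intro j _ hj
    simp [Pi.single_eq_of_ne hj]
  · simp

section Structure

lemma bracket_field_right (W : Field M) (g : Fin 3 → smoothRing U) (x : U) :
    bracket W (F.field g) x =
      (dirDeriv W (smoothRing.ext (g 0)) x • F.e 0 x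
          + smoothRing.eval x (g 0) • bracket W (F.e 0) x)
        + (dirDeriv W (smoothRing.ext (g 1)) x • F.e 1 x
          + smoothRing.eval x (g 1) • bracket W (F.e 1) x)
        + (dirDeriv W (smoothRing.ext (g 2)) x • F.e 2 x
          + smoothRing.eval x (g 2) • bracket W (F.e 2) x) := by
  have h (i : Fin 3) : SmoothFieldOn U (smoothRing.ext (g i) • F.e i) :=
    SmoothFieldOn.smul (smoothRing.smoothFnOn_ext (g i)) ((F.smooth_e i).smoothFieldOn U)
  have h' (i : Fin 3) := bracket_smul_right F.isOpen W (smoothRing.smoothFnOn_ext (g i))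
    ((F.smooth_e i).smoothFieldOn U) x.2
  rw [field_eq_sum, bracket_add_right F.isOpen W ((h 0).add (h 1)) (h 2) x.2,
    bracket_add_right F.isOpen W (h 0) (h 1) x.2, h', h', h']
  simp only [smoothRing.ext_eq_eval _ x.2]

lemma metric_e_const (i j : Fin 3) : ∀ x ∈ U, metric (F.e i) (F.e j) x = if i = j then 1 else 0 :=
  fun _ hx ↦ F.inner_e hx i j

/-- The Killing equation for the frame fields, whose inner products are constant. -/
lemma killing_e (i j : Fin 3) {x : M} (hx : x ∈ U) :
    inner ℝ (bracket S.ξ (F.e i) x) (F.e j x)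
      + inner ℝ (F.e i x) (bracket S.ξ (F.e j) x) = (0 : ℝ) := by
  have h := S.killing (F.e i) (F.e j) (F.smooth_e i) (F.smooth_e j) x
  rw [dirDeriv_congr_on F.isOpen (fun _ _ ↦ rfl) (F.metric_e_const i j) hx, dirDeriv_const] at h
  exact h.symm

lemma inner_bracket_reeb_e (i : Fin 3) {x : M} (hx : x ∈ U) :
    inner ℝ (bracket S.ξ (F.e i) x) (F.e i x) = (0 : ℝ) := by
  have h := F.killing_e i i hx
  have h' : inner ℝ (F.e i x) (bracket S.ξ (F.e i) x) =
      (inner ℝ (bracket S.ξ (F.e i) x) (F.e i x) : ℝ) := real_inner_comm _ _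
  linarith

/-- The normalization `½ dη = g(·, φ ·)` on the contact plane, where `φ e₂ = e₁`. -/
lemma deta_one_two (x : U) : extd S.η x ![F.e 1 x, F.e 2 x] = 2 := by
  have h := S.dη_eq x (F.e 1 x) (F.e 2 x)
  rw [F.phi_e_two x.2, F.inner_e x.2, if_pos rfl] at h
  linarith

lemma eta_e (i : Fin 3) : ∀ x ∈ U, S.η x ![F.e i x] = if i = 0 then 1 else 0 := by
  intro x hx
  rw [S.eta_apply]
  exact F.inner_e hx i 0

/-- Cartan's formula for `dη` and the frame fields, on which `η` is constant. -/
lemma inner_bracket_reeb [IsContMDiffRiemannianBundle (𝓡 3) ∞ E3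
      (fun x : M ↦ TangentSpace (𝓡 3) x)] (i j : Fin 3) {x : M} (hx : x ∈ U) :
    inner ℝ (bracket (F.e i) (F.e j) x) (S.ξ x) = - extd S.η x ![F.e i x, F.e j x] := by
  have hd : DifferentiableAt ℝ (S.η.inChart x) (extChartAt (𝓡 3) x x) := by
    rw [S.eta_eq_flat]
    exact differentiableAt_inChart_flat F.isOpen (S.smooth_ξ.smoothFieldOn U) hx
  rw [extd_apply F.isOpen ((F.smooth_e i).smoothFieldOn U) ((F.smooth_e j).smoothFieldOn U) hx hd,
    dirDeriv_congr_on F.isOpen (fun _ _ ↦ rfl) (F.eta_e j) hx,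
    dirDeriv_congr_on F.isOpen (fun _ _ ↦ rfl) (F.eta_e i) hx, dirDeriv_const, dirDeriv_const,
    S.eta_apply]
  ring

variable [IsContMDiffRiemannianBundle (𝓡 3) ∞ E3 (fun x : M ↦ TangentSpace (𝓡 3) x)]

/-- The components in the frame of a field that is smooth on `U`. -/
def comp (X : Field M) (hX : SmoothFieldOn U X) (i : Fin 3) : smoothRing U :=
  smoothRing.mk (metric X (F.e i)) (hX.metric ((F.smooth_e i).smoothFieldOn U))

lemma eval_comp (X : Field M) (hX : SmoothFieldOn U X) (i : Fin 3) (x : U) :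
    smoothRing.eval x (F.comp X hX i) = inner ℝ (X x) (F.e i x) := rfl

lemma field_comp (X : Field M) (hX : SmoothFieldOn U X) {x : M} (hx : x ∈ U) :
    F.field (F.comp X hX) x = X x :=
  F.ext_inner hx fun i ↦ by rw [F.inner_field_e _ ⟨x, hx⟩, eval_comp]

/-- The components of `[eᵢ, eⱼ]`. -/
def bracketComp (i j : Fin 3) : Fin 3 → smoothRing U :=
  F.comp (bracket (F.e i) (F.e j)) (((F.smooth_e i).smoothFieldOn U).bracket F.isOpen
    ((F.smooth_e j).smoothFieldOn U))

/-- The function `a` in `[e₁, e₂] = -2 ξ + a e₁ + b e₂`. -/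
def a : smoothRing U := F.bracketComp 1 2 1

/-- The function `b` in `[e₁, e₂] = -2 ξ + a e₁ + b e₂`. -/
def b : smoothRing U := F.bracketComp 1 2 2

/-- The function `c` in `[ξ, e₁] = c e₂`. -/
def c : smoothRing U := F.bracketComp 0 1 2

lemma bracketComp_zero_one : F.bracketComp 0 1 = ![0, 0, F.c] := by
  funext k
  refine smoothRing.eval_injective fun x ↦ ?_
  fin_cases k
  · refine (F.inner_bracket_reeb 0 1 x.2).trans ?_
    rw [show F.e 0 x = S.ξ x from rfl, S.dη_reeb]
    simp
  · exact (F.inner_bracket_reeb_e 1 x.2).trans (map_zero _).symm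
  · rfl

lemma bracketComp_zero_two : F.bracketComp 0 2 = ![0, - F.c, 0] := by
  funext k
  refine smoothRing.eval_injective fun x ↦ ?_
  fin_cases k
  · refine (F.inner_bracket_reeb 0 2 x.2).trans ?_
    rw [show F.e 0 x = S.ξ x from rfl, S.dη_reeb]
    simp
  · have h := F.killing_e 1 2 x.2
    have h' : inner ℝ (F.e 1 x) (bracket S.ξ (F.e 2) x) =
        (inner ℝ (bracket S.ξ (F.e 2) x) (F.e 1 x) : ℝ) := real_inner_comm _ _
    have h1 : smoothRing.eval x F.c = inner ℝ (bracket S.ξ (F.e 1) x) (F.e 2 x) := rfl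
    have h2 : inner ℝ (bracket S.ξ (F.e 2) x) (F.e 1 x) = - smoothRing.eval x F.c := by
      rw [h1]; linarith
    exact h2.trans (map_neg _ _).symm
  · exact (F.inner_bracket_reeb_e 2 x.2).trans (map_zero _).symm

lemma bracketComp_one_two : F.bracketComp 1 2 = ![-2, F.a, F.b] := by
  funext k
  refine smoothRing.eval_injective fun x ↦ ?_
  fin_cases k
  · refine (F.inner_bracket_reeb 1 2 x.2).trans ?_
    have h2 : smoothRing.eval x (-2 : smoothRing U) = -2 := by
      rw [map_neg, map_ofNat]
    rw [F.deta_one_two x]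
    exact h2.symm
  · rfl
  · rfl

lemma bracket_e (i j : Fin 3) (x : U) :
    bracket (F.e i) (F.e j) x = F.field (F.bracketComp i j) x :=
  (F.field_comp _ _ x.2).symm

/-- The Lie bracket in components. -/
lemma bracket_field (f g : Fin 3 → smoothRing U) (x : U) :
    bracket (F.field f) (F.field g) x = F.field (frameBracket F.D F.a F.b F.c f g) x := by
  have hs (X Y : Field M) : bracket X Y x = - bracket Y X x := by
    rw [bracket_swap]; rfl
  have h01 := F.bracket_e 0 1 x
  have h02 := F.bracket_e 0 2 x
  have h12 := F.bracket_e 1 2 x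
  rw [bracketComp_zero_one, field_apply] at h01
  rw [bracketComp_zero_two, field_apply] at h02
  rw [bracketComp_one_two, field_apply] at h12
  have h10 := hs (F.e 1) (F.e 0)
  have h20 := hs (F.e 2) (F.e 0)
  have h21 := hs (F.e 2) (F.e 1)
  have h00 (i : Fin 3) : bracket (F.e i) (F.e i) x = 0 := by
    rw [bracket, VectorField.mlieBracket_self]; rfl
  have h2 : smoothRing.eval x (2 : smoothRing U) = 2 := map_ofNat _ 2
  rw [F.bracket_field_right, hs _ (F.e 0), hs _ (F.e 1), hs _ (F.e 2)]
  simp only [F.bracket_field_right, h10, h20, h21, h00, h01, h02, h12, F.dirDeriv_field,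
    F.field_apply, ← F.eval_D, frameBracket, frameAct, Matrix.cons_val, map_add, map_sub, map_mul,
    map_neg, map_zero, h2]
  module

/-- The structure equations hold in every adapted frame: the commutation relations say that
derivations form a Lie algebra, and the two identities are the Jacobi identity. -/
theorem structureEquations : StructureEquations F.D F.a F.b F.c := by
  have hs (i : Fin 3) := (F.smooth_e i).smoothFieldOn U
  have comm (i j : Fin 3) (f : smoothRing U) :
      F.D i (F.D j f) - F.D j (F.D i f) = frameAct F.D (F.bracketComp i j) f := by
    refine smoothRing.eval_injective fun x ↦ ?_
    rw [← F.dirDeriv_field]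
    have h := dirDeriv_bracket F.isOpen (hs i) (hs j) (smoothRing.smoothFnOn_ext f) x.2
    rw [dirDeriv_congr_on F.isOpen (fun y hy ↦ F.bracket_e i j ⟨y, hy⟩) (fun _ _ ↦ rfl) x.2] at h
    rw [h, map_sub, eval_D, eval_D]
    congr 1
    · exact dirDeriv_congr_on F.isOpen (fun _ _ ↦ rfl)
        (fun y hy ↦ smoothRing.ext_eq_eval _ hy) x.2
    · exact dirDeriv_congr_on F.isOpen (fun _ _ ↦ rfl)
        (fun y hy ↦ smoothRing.ext_eq_eval _ hy) x.2
  have jac : frameBracket F.D F.a F.b F.c (Pi.single 0 1) (F.bracketComp 1 2)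
      = frameBracket F.D F.a F.b F.c (F.bracketComp 0 1) (Pi.single 2 1)
        + frameBracket F.D F.a F.b F.c (Pi.single 1 1) (F.bracketComp 0 2) := by
    funext k
    refine smoothRing.eval_injective fun x ↦ ?_
    have h := bracket_jacobi F.isOpen (hs 0) (hs 1) (hs 2) x.2
    have hb (i j : Fin 3) : ∀ y ∈ U, bracket (F.e i) (F.e j) y = F.field (F.bracketComp i j) y :=
      fun y hy ↦ F.bracket_e i j ⟨y, hy⟩
    have he (i : Fin 3) : ∀ y ∈ U, F.e i y = F.field (Pi.single i 1) y :=
      fun y hy ↦ (F.field_single i ⟨y, hy⟩).symm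
    rw [bracket_congr_on F.isOpen (he 0) (hb 1 2) x.2,
      bracket_congr_on F.isOpen (hb 0 1) (he 2) x.2,
      bracket_congr_on F.isOpen (he 1) (hb 0 2) x.2, bracket_field, bracket_field,
      bracket_field] at h
    rw [← F.inner_field_e, h, inner_add_left, F.inner_field_e, F.inner_field_e, Pi.add_apply,
      map_add]
  rw [bracketComp_zero_one, bracketComp_zero_two, bracketComp_one_two] at jac
  have j1 := congrFun jac 1
  have j2 := congrFun jac 2
  simp [frameBracket, frameAct] at j1 j2
  refine ⟨fun f ↦ ?_, fun f ↦ ?_, fun f ↦ ?_, ?_, ?_⟩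
  · rw [comm, bracketComp_zero_one]; simp [frameAct]
  · rw [comm, bracketComp_zero_two]; simp [frameAct]
  · rw [comm, bracketComp_one_two]; simp [frameAct]
  · linear_combination j1
  · linear_combination j2

end Structure

end AdaptedFrame

/-! ### The Levi-Civita connection and the scalar curvature -/

/-- The sum of the squares of the `2 × 2` minors of two columns of an orthogonal matrix, each
minor counted twice. -/
lemma sum_sq_minors {p : Fin 3 → Fin 3 → ℝ}
    (h : ∀ k l, ∑ i, p i k * p i l = if k = l then 1 else 0) {k l : Fin 3} (hkl : k ≠ l) :
    ∑ i, ∑ j, (p i k * p j l - p i l * p j k) ^ 2 = 2 := by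
  have hk := h k k
  have hl := h l l
  have hk_l := h k l
  rw [if_pos rfl] at hk hl
  rw [if_neg hkl] at hk_l
  simp only [Fin.sum_univ_three] at *
  linear_combination 2 * (p 0 l * p 0 l + p 1 l * p 1 l + p 2 l * p 2 l) * hk + 2 * hl
    - 2 * (p 0 k * p 0 l + p 1 k * p 1 l + p 2 k * p 2 l) * hk_l

section Locality

variable {M : Type*} [TopologicalSpace M] [ChartedSpace E3 M]
  [RiemannianBundle (fun x : M ↦ TangentSpace (𝓡 3) x)]

lemma koszul_congr_on {U : Set M} (hU : IsOpen U) {X X' Y Y' Z Z' : Field M}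
    (hX : ∀ x ∈ U, X x = X' x) (hY : ∀ x ∈ U, Y x = Y' x) (hZ : ∀ x ∈ U, Z x = Z' x) {x : M}
    (hx : x ∈ U) : koszul X Y Z x = koszul X' Y' Z' x := by
  have hm {V V' W W' : Field M} (hV : ∀ x ∈ U, V x = V' x) (hW : ∀ x ∈ U, W x = W' x) :
      ∀ y ∈ U, metric V W y = metric V' W' y := fun y hy ↦ by
    simp only [metric, hV y hy, hW y hy]
  have hb {V V' W W' : Field M} (hV : ∀ x ∈ U, V x = V' x) (hW : ∀ x ∈ U, W x = W' x) :
      ∀ y ∈ U, bracket V W y = bracket V' W' y := fun y hy ↦ bracket_congr_on hU hV hW hy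
  unfold koszul
  rw [dirDeriv_congr_on hU hX (hm hY hZ) hx, dirDeriv_congr_on hU hY (hm hZ hX) hx,
    dirDeriv_congr_on hU hZ (hm hX hY) hx, hm (hb hX hY) hZ x hx, hm (hb hY hZ) hX x hx,
    hm (hb hZ hX) hY x hx]

variable [IsManifold (𝓡 3) ∞ M]

lemma leviCivita_congr_on {U : Set M} (hU : IsOpen U) {X X' Y Y' : Field M}
    (hX : ∀ x ∈ U, X x = X' x) (hY : ∀ x ∈ U, Y x = Y' x) {x : M} (hx : x ∈ U) :
    leviCivita X Y x = leviCivita X' Y' x :=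
  Finset.sum_congr rfl fun i _ ↦ by rw [koszul_congr_on hU hX hY (fun _ _ ↦ rfl) hx]

lemma curvature_congr_on {U : Set M} (hU : IsOpen U) {X X' Y Y' Z Z' : Field M}
    (hX : ∀ x ∈ U, X x = X' x) (hY : ∀ x ∈ U, Y x = Y' x) (hZ : ∀ x ∈ U, Z x = Z' x) {x : M}
    (hx : x ∈ U) : curvature X Y Z x = curvature X' Y' Z' x := by
  have hl {V V' W W' : Field M} (hV : ∀ x ∈ U, V x = V' x) (hW : ∀ x ∈ U, W x = W' x) :
      ∀ y ∈ U, leviCivita V W y = leviCivita V' W' y :=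
    fun y hy ↦ leviCivita_congr_on hU hV hW hy
  simp only [curvature, Pi.sub_apply]
  rw [hl hX (hl hY hZ) x hx, hl hY (hl hX hZ) x hx,
    hl (fun y hy ↦ bracket_congr_on hU hX hY hy) hZ x hx]

lemma frameAt_self (x : M) (i : Fin 3) : frameAt x i x = onb x i :=
  FiberBundle.extend_apply_self E3 _

/-- Near `x` the field `frameAt x i` agrees with a globally smooth field. -/
lemma exists_smoothField_eq_frameAt [T2Space M] (x : M) (i : Fin 3) :
    ∃ (Y : Field M) (V : Set M), SmoothField Y ∧ IsOpen V ∧ x ∈ V ∧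
      ∀ y ∈ V, frameAt x i y = Y y := by
  obtain ⟨V, hV, hxV, hs⟩ := exists_smoothFieldOn_extend x (onb x i)
  obtain ⟨Y, W, hY, hW, hxW, -, h⟩ := exists_smoothField_eqOn hV hs hxV
  exact ⟨Y, W, hY, hW, hxW, fun y hy ↦ (h y hy).symm⟩

end Locality

namespace AdaptedFrame

variable {M : Type*} [TopologicalSpace M] [ChartedSpace E3 M] [IsManifold (𝓡 3) ∞ M]
  [RiemannianBundle (fun x : M ↦ TangentSpace (𝓡 3) x)]
  [IsContMDiffRiemannianBundle (𝓡 3) ∞ E3 (fun x : M ↦ TangentSpace (𝓡 3) x)]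
  {S : SasakianStructure M} {U : Set M} (F : AdaptedFrame S U)

/-- The Koszul formula in components. -/
lemma koszul_field (f g h : Fin 3 → smoothRing U) (x : U) :
    koszul (F.field f) (F.field g) (F.field h) x =
      inner ℝ (F.field (frameNabla F.D F.a F.b F.c f g) x) (F.field h x) := by
  have hd (u v w : Fin 3 → smoothRing U) :
      dirDeriv (F.field u) (metric (F.field v) (F.field w)) x =
        smoothRing.eval x (frameAct F.D u (v 0 * w 0 + v 1 * w 1 + v 2 * w 2)) := by
    rw [← F.dirDeriv_field]
    exact dirDeriv_congr_on F.isOpen (fun _ _ ↦ rfl) (fun y hy ↦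
      (F.inner_field_field v w ⟨y, hy⟩).trans (smoothRing.ext_eq_eval _ hy).symm) x.2
  have hb (u v w : Fin 3 → smoothRing U) : metric (bracket (F.field u) (F.field v)) (F.field w) x =
      inner ℝ (F.field (frameBracket F.D F.a F.b F.c u v) x) (F.field w x) := by
    rw [← F.bracket_field]; rfl
  have key : frameAct F.D f (g 0 * h 0 + g 1 * h 1 + g 2 * h 2)
      + frameAct F.D g (h 0 * f 0 + h 1 * f 1 + h 2 * f 2)
      - frameAct F.D h (f 0 * g 0 + f 1 * g 1 + f 2 * g 2)
      + (frameBracket F.D F.a F.b F.c f g 0 * h 0 + frameBracket F.D F.a F.b F.c f g 1 * h 1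
        + frameBracket F.D F.a F.b F.c f g 2 * h 2)
      - (frameBracket F.D F.a F.b F.c g h 0 * f 0 + frameBracket F.D F.a F.b F.c g h 1 * f 1
        + frameBracket F.D F.a F.b F.c g h 2 * f 2)
      + (frameBracket F.D F.a F.b F.c h f 0 * g 0 + frameBracket F.D F.a F.b F.c h f 1 * g 1
        + frameBracket F.D F.a F.b F.c h f 2 * g 2)
      = (frameNabla F.D F.a F.b F.c f g 0 * h 0 + frameNabla F.D F.a F.b F.c f g 1 * h 1
        + frameNabla F.D F.a F.b F.c f g 2 * h 2) * 2 := by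
    simp only [frameAct, frameBracket, frameNabla, Matrix.cons_val, map_add, Derivation.leibniz,
      smul_eq_mul]
    ring
  unfold koszul
  rw [hd, hd, hd, hb, hb, hb]
  simp only [F.inner_field_field, ← map_add, ← map_sub]
  rw [key, map_mul, map_ofNat]
  ring

variable [T2Space M]

/-- The Levi-Civita connection in components. -/
lemma leviCivita_field (f g : Fin 3 → smoothRing U) (x : U) :
    leviCivita (F.field f) (F.field g) x = F.field (frameNabla F.D F.a F.b F.c f g) x := by
  rw [← (onb (x : M)).sum_repr' (F.field (frameNabla F.D F.a F.b F.c f g) x)]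
  refine Finset.sum_congr rfl fun i _ ↦ ?_
  obtain ⟨Y, V, hY, hV, hxV, h⟩ := exists_smoothField_eq_frameAt (x : M) i
  have h' : ∀ y ∈ V ∩ U, frameAt (x : M) i y = F.field (F.comp Y (hY.smoothFieldOn U)) y :=
    fun y hy ↦ (h y hy.1).trans (F.field_comp _ _ hy.2).symm
  rw [koszul_congr_on (hV.inter F.isOpen) (fun _ _ ↦ rfl) (fun _ _ ↦ rfl) h' ⟨hxV, x.2⟩,
    F.koszul_field, ← h' x ⟨hxV, x.2⟩, frameAt_self, real_inner_comm]

/-- The curvature in components. -/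
lemma curvature_field (f g h : Fin 3 → smoothRing U) (x : U) :
    curvature (F.field f) (F.field g) (F.field h) x =
      F.field ![(f 0 * g 1 - f 1 * g 0) * h 1 + (f 0 * g 2 - f 2 * g 0) * h 2,
      - (f 0 * g 1 - f 1 * g 0) * h 0
        + contactCurvature F.D F.a F.b F.c * (f 1 * g 2 - f 2 * g 1) * h 2,
      - (f 0 * g 2 - f 2 * g 0) * h 0
        - contactCurvature F.D F.a F.b F.c * (f 1 * g 2 - f 2 * g 1) * h 1] x := by
  have hl (u v : Fin 3 → smoothRing U) : ∀ y ∈ U, leviCivita (F.field u) (F.field v) y =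
      F.field (frameNabla F.D F.a F.b F.c u v) y := fun y hy ↦ F.leviCivita_field u v ⟨y, hy⟩
  rw [← F.structureEquations.curvature f g h]
  simp only [curvature, Pi.sub_apply]
  rw [leviCivita_congr_on F.isOpen (fun _ _ ↦ rfl) (hl g h) x.2,
    leviCivita_congr_on F.isOpen (fun _ _ ↦ rfl) (hl f h) x.2,
    leviCivita_congr_on F.isOpen (fun y hy ↦ F.bracket_field f g ⟨y, hy⟩) (fun _ _ ↦ rfl) x.2,
    F.leviCivita_field, F.leviCivita_field, F.leviCivita_field]
  simp only [F.field_apply, Pi.sub_apply, map_sub]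
  module

/-- The sectional curvature is `1` for the planes containing `ξ` and `K` for the contact planes,
so `Scal = 2 K + 4`. The orthonormal basis in the definition of `Scal` need not be the adapted
one; the change of basis enters through `sum_sq_minors`. -/
theorem scalarCurvature_eq (x : U) :
    scalarCurvature (x : M) = 2 * smoothRing.eval x (contactCurvature F.D F.a F.b F.c) + 4 := by
  choose Y V hY hV hxV h using fun i ↦ exists_smoothField_eq_frameAt (x : M) i
  set f : Fin 3 → Fin 3 → smoothRing U := fun i ↦ F.comp (Y i) ((hY i).smoothFieldOn U)
  set W : Set M := V 0 ∩ V 1 ∩ V 2 ∩ U with hW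
  have hWo : IsOpen W := (((hV 0).inter (hV 1)).inter (hV 2)).inter F.isOpen
  have hxW : (x : M) ∈ W := ⟨⟨⟨hxV 0, hxV 1⟩, hxV 2⟩, x.2⟩
  have hWV (i : Fin 3) : W ⊆ V i := by
    intro y hy
    fin_cases i
    · exact hy.1.1.1
    · exact hy.1.1.2
    · exact hy.1.2
  have h' (i : Fin 3) : ∀ y ∈ W, frameAt (x : M) i y = F.field (f i) y :=
    fun y hy ↦ (h i y (hWV i hy)).trans (F.field_comp _ _ hy.2).symm
  -- the orthogonal matrix that relates the chosen basis to the adapted frame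
  set p : Fin 3 → Fin 3 → ℝ := fun i k ↦ smoothRing.eval x (f i k) with hp
  have hpe (i k : Fin 3) : p i k = inner ℝ (onb (x : M) i) (F.e k x) := by
    rw [hp]
    simp only
    rw [← F.inner_field_e, ← h' i x hxW, frameAt_self]
  have horth (k l : Fin 3) : ∑ i, p i k * p i l = if k = l then 1 else 0 := by
    rw [← F.inner_e x.2 k l, ← (onb (x : M)).sum_inner_mul_inner]
    refine Finset.sum_congr rfl fun i _ ↦ ?_
    rw [hpe, hpe, real_inner_comm]
  have hterm (i j : Fin 3) :
      metric (curvature (frameAt (x : M) i) (frameAt x j) (frameAt x j)) (frameAt x i) x =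
        (p i 0 * p j 1 - p i 1 * p j 0) ^ 2 + (p i 0 * p j 2 - p i 2 * p j 0) ^ 2
          + smoothRing.eval x (contactCurvature F.D F.a F.b F.c)
            * (p i 1 * p j 2 - p i 2 * p j 1) ^ 2 := by
    unfold metric
    rw [curvature_congr_on hWo (h' i) (h' j) (h' j) hxW, h' i x hxW, F.curvature_field,
      F.inner_field_field]
    simp only [Matrix.cons_val, map_add, map_sub, map_mul, map_neg, hp]
    ring
  unfold scalarCurvature
  simp only [hterm, Finset.sum_add_distrib, ← Finset.mul_sum]
  rw [sum_sq_minors horth (by decide), sum_sq_minors horth (by decide),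
    sum_sq_minors horth (by decide)]
  ring

end AdaptedFrame

section Continuity

variable {M : Type*} [TopologicalSpace M] [ChartedSpace E3 M] [IsManifold (𝓡 3) ∞ M] [T2Space M]
  [RiemannianBundle (fun x : M ↦ TangentSpace (𝓡 3) x)]
  [IsContMDiffRiemannianBundle (𝓡 3) ∞ E3 (fun x : M ↦ TangentSpace (𝓡 3) x)]

lemma SasakianStructure.continuous_scalarCurvature (S : SasakianStructure M) :
    Continuous (scalarCurvature (M := M)) := by
  refine continuous_iff_continuousAt.2 fun x ↦ ?_
  obtain ⟨U, hxU, ⟨F⟩⟩ := S.exists_adaptedFrame x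
  have h := (SmoothFnOn.contMDiffAt F.isOpen (smoothRing.smoothFnOn_ext
    (2 * contactCurvature F.D F.a F.b F.c + 4)) hxU).continuousAt
  refine h.congr (Filter.eventuallyEq_of_mem (F.isOpen.mem_nhds hxU) fun y hy ↦ ?_)
  rw [F.scalarCurvature_eq ⟨y, hy⟩, smoothRing.ext_eq_eval _ hy, map_add, map_mul, map_ofNat,
    map_ofNat]

end Continuity

/-! ### The Hodge star -/

section BasisIndependence

variable {V : Type*} [NormedAddCommGroup V] [InnerProductSpace ℝ V]

/-- The full contraction of two multilinear forms does not depend on the orthonormal basis. -/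
lemma sum_multilinear_mul_eq {k : ℕ} (B C : MultilinearMap ℝ (fun _ : Fin k ↦ V) ℝ)
    (b b' : OrthonormalBasis (Fin 3) ℝ V) :
    ∑ i : Fin k → Fin 3, B (fun a ↦ b (i a)) * C (fun a ↦ b (i a)) =
      ∑ i : Fin k → Fin 3, B (fun a ↦ b' (i a)) * C (fun a ↦ b' (i a)) := by
  have hB (A : MultilinearMap ℝ (fun _ : Fin k ↦ V) ℝ) (i : Fin k → Fin 3) :
      A (fun a ↦ b (i a)) =
        ∑ j : Fin k → Fin 3, (∏ a, inner ℝ (b' (j a)) (b (i a))) * A (fun a ↦ b' (j a)) := by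
    have h : (fun a ↦ b (i a)) = fun a ↦ ∑ j, (inner ℝ (b' j) (b (i a)) : ℝ) • b' j :=
      funext fun a ↦ (b'.sum_repr' _).symm
    rw [h, A.map_sum]
    refine Finset.sum_congr rfl fun j _ ↦ ?_
    rw [A.map_smul_univ (fun a ↦ (inner ℝ (b' (j a)) (b (i a)) : ℝ)) fun a ↦ b' (j a), smul_eq_mul]
  have hδ (j l : Fin k → Fin 3) : ∑ i : Fin k → Fin 3,
      (∏ a, (inner ℝ (b' (j a)) (b (i a)) : ℝ)) * ∏ a, (inner ℝ (b' (l a)) (b (i a)) : ℝ) =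
        if j = l then 1 else 0 := by
    simp only [← Finset.prod_mul_distrib]
    rw [← Fintype.piFinset_univ, ← Finset.prod_univ_sum (fun _ ↦ Finset.univ)
      (fun a m ↦ (inner ℝ (b' (j a)) (b m) : ℝ) * inner ℝ (b' (l a)) (b m))]
    have h (a : Fin k) : ∑ m, (inner ℝ (b' (j a)) (b m) : ℝ) * inner ℝ (b' (l a)) (b m) =
        if j a = l a then 1 else 0 := by
      rw [← orthonormal_iff_ite.1 b'.orthonormal, ← b.sum_inner_mul_inner]
      exact Finset.sum_congr rfl fun m _ ↦ by rw [real_inner_comm (b' (l a))]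
    simp only [h]
    split_ifs with hjl
    · subst hjl; simp
    · obtain ⟨a, ha⟩ := Function.ne_iff.1 hjl
      exact Finset.prod_eq_zero (Finset.mem_univ a) (if_neg ha)
  simp only [hB B, hB C, Finset.sum_mul_sum]
  rw [Finset.sum_comm]
  refine Finset.sum_congr rfl fun j _ ↦ ?_
  rw [Finset.sum_comm]
  have h (l : Fin k → Fin 3) : ∑ i : Fin k → Fin 3,
      ((∏ a, (inner ℝ (b' (j a)) (b (i a)) : ℝ)) * B (fun a ↦ b' (j a)))
        * ((∏ a, (inner ℝ (b' (l a)) (b (i a)) : ℝ)) * C (fun a ↦ b' (l a))) =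
      (if j = l then 1 else 0) * (B (fun a ↦ b' (j a)) * C (fun a ↦ b' (l a))) := by
    rw [← hδ, Finset.sum_mul]
    exact Finset.sum_congr rfl fun i _ ↦ by ring
  simp only [h, ite_mul, one_mul, zero_mul, Finset.sum_ite_eq, Finset.mem_univ, if_true]

end BasisIndependence

section Hodge

lemma append_update_left {V : Type*} {k m : ℕ} (u : Fin k → V) (v : Fin m → V) (i : Fin k) (w : V) :
    Fin.append (Function.update u i w) v =
      Function.update (Fin.append u v) (Fin.castAdd m i) w := by
  ext j
  refine Fin.addCases (fun j ↦ ?_) (fun j ↦ ?_) j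
  · by_cases hj : j = i
    · subst hj; simp
    · have hne : Fin.castAdd m j ≠ Fin.castAdd m i := by simpa using hj
      simp [Function.update_of_ne hne, Function.update_of_ne hj]
  · have hne : Fin.natAdd k j ≠ Fin.castAdd m i := by
      intro h
      have := congrArg Fin.val h
      simp at this
      omega
    simp [Function.update_of_ne hne]

variable {M : Type*} [TopologicalSpace M] [ChartedSpace E3 M]

lemma extd_self (α : DiffForm M 1) (x : M) (v : TangentSpace (𝓡 3) x) :
    extd α x ![v, v] = 0 := by
  have h := extd_swap α x v v
  linarith

lemma form_one_ext {α β : DiffForm M 1} (h : ∀ x v, α x ![v] = β x ![v]) : α = β := by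
  funext x
  ext v
  have hv : v = ![v 0] := by ext1 i; fin_cases i; rfl
  rw [hv, h]

variable [RiemannianBundle (fun x : M ↦ TangentSpace (𝓡 3) x)]

lemma wedge_apply (α : DiffForm M 1) (β : DiffForm M 2) (x : M) (u v w : TangentSpace (𝓡 3) x) :
    wedge α β x ![u, v, w] =
      α x ![u] * β x ![v, w] - α x ![v] * β x ![u, w] + α x ![w] * β x ![u, v] := by
  have h1 (z : TangentSpace (𝓡 3) x) : (ContinuousAlternatingMap.ofSubsingleton ℝ
      (TangentSpace (𝓡 3) x) ℝ (0 : Fin 1)).symm (α x) z = α x ![z] :=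
    congrArg (α x) (by ext1 i; fin_cases i; rfl)
  have r0 : Fin.removeNth 0 ![u, v, w] = ![v, w] := by ext1 i; fin_cases i <;> rfl
  have r1 : Fin.removeNth 1 ![u, v, w] = ![u, w] := by ext1 i; fin_cases i <;> rfl
  have r2 : Fin.removeNth 2 ![u, v, w] = ![u, v] := by ext1 i; fin_cases i <;> rfl
  unfold wedge
  rw [ContinuousAlternatingMap.alternatizeUncurryFin_apply]
  refine (Fin.sum_univ_three _).trans ?_
  simp only [ContinuousLinearMap.smulRight_apply, ContinuousAlternatingMap.smul_apply, smul_eq_mul,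
    Matrix.cons_val, h1]
  rw [r0, r1, r2]
  simp
  ring

lemma inner_sharp (α : DiffForm M 1) (x : M) (v : TangentSpace (𝓡 3) x) :
    inner ℝ (sharp α x) v = α x ![v] := by
  have h1 (z : TangentSpace (𝓡 3) x) : (ContinuousAlternatingMap.ofSubsingleton ℝ
      (TangentSpace (𝓡 3) x) ℝ (0 : Fin 1)).symm (α x) z = α x ![z] :=
    congrArg (α x) (by ext1 i; fin_cases i; rfl)
  have h2 (z : TangentSpace (𝓡 3) x) : α x (fun _ ↦ z) = α x ![z] :=
    congrArg (α x) (by ext1 i; fin_cases i; rfl)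
  simp only [sharp, sum_inner, inner_smul_left, h2]
  rw [← h1 v, ← (onb x).sum_repr' v, map_sum]
  refine Finset.sum_congr rfl fun i _ ↦ ?_
  rw [map_smul, h1, (onb x).sum_repr']
  simp [mul_comm]

lemma hodgeStar_smul (υ : DiffForm M 3) {k m : ℕ} (h : k + m = 3) (r : ℝ) (β : DiffForm M k) :
    hodgeStar υ h (r • β) = r • hodgeStar υ h β := by
  funext x
  simp only [hodgeStar, Pi.smul_apply, ContinuousAlternatingMap.smul_apply, smul_eq_mul, mul_smul,
    ← Finset.smul_sum]
  rw [smul_comm]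

/-- The multilinear form `u ↦ υ (u₁, …, u_k, v₁, …, v_m)`. -/
def contractRight {V : Type*} [AddCommGroup V] [Module ℝ V] [TopologicalSpace V] {k m n : ℕ}
    (h : k + m = n) (υ : V [⋀^Fin n]→L[ℝ] ℝ) (v : Fin m → V) :
    MultilinearMap ℝ (fun _ : Fin k ↦ V) ℝ where
  toFun u := υ (Fin.append u v ∘ Fin.cast h.symm)
  map_update_add' := by
    intro hdec u i a b
    subst h
    have := Subsingleton.elim hdec (instDecidableEqFin k)
    subst this
    simp [append_update_left]
  map_update_smul' := by
    intro hdec u i c a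
    subst h
    have := Subsingleton.elim hdec (instDecidableEqFin k)
    subst this
    simp [append_update_left]

/-- The Hodge star may be computed in any orthonormal basis. -/
lemma hodgeStar_apply_basis (υ : DiffForm M 3) {k m : ℕ} (h : k + m = 3) (β : DiffForm M k) {x : M}
    (b : OrthonormalBasis (Fin 3) ℝ (TangentSpace (𝓡 3) x)) (v : Fin m → TangentSpace (𝓡 3) x) :
    hodgeStar υ h β x v = (k.factorial : ℝ)⁻¹ * ∑ i : Fin k → Fin 3,
      β x (fun a ↦ b (i a)) * υ x (Fin.append (fun a ↦ b (i a)) v ∘ Fin.cast h.symm) := by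
  simp only [hodgeStar, ContinuousAlternatingMap.smul_apply, ContinuousAlternatingMap.sum_apply,
    smul_eq_mul]
  congr 1
  exact sum_multilinear_mul_eq (β x).toMultilinearMap (contractRight h (υ x) v) (onb x) b

lemma hodgeStar_two_apply (υ : DiffForm M 3) (β : DiffForm M 2) {x : M}
    (b : OrthonormalBasis (Fin 3) ℝ (TangentSpace (𝓡 3) x)) (v : TangentSpace (𝓡 3) x) :
    hodgeStar υ (show 2 + 1 = 3 by norm_num) β x ![v] =
      1 / 2 * ∑ i, ∑ j, β x ![b i, b j] * υ x ![b i, b j, v] := by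
  rw [hodgeStar_apply_basis υ _ β b, ← (finTwoArrowEquiv (Fin 3)).symm.sum_comp,
    Fintype.sum_prod_type]
  simp only [Nat.factorial, one_div]
  norm_num
  refine Finset.sum_congr rfl fun i _ ↦ Finset.sum_congr rfl fun j _ ↦ ?_
  congr 1
  · congr 1
    ext1 a
    fin_cases a <;> rfl
  · congr 1
    ext1 a
    fin_cases a <;> rfl

lemma hodgeStar_one_apply (υ : DiffForm M 3) (β : DiffForm M 1) {x : M}
    (b : OrthonormalBasis (Fin 3) ℝ (TangentSpace (𝓡 3) x)) (v w : TangentSpace (𝓡 3) x) :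
    hodgeStar υ (show (0 + 1) + 2 = 3 by norm_num) β x ![v, w] =
      ∑ i, β x ![b i] * υ x ![b i, v, w] := by
  rw [hodgeStar_apply_basis υ _ β b, ← (Equiv.funUnique (Fin 1) (Fin 3)).symm.sum_comp]
  simp only [Nat.factorial]
  norm_num
  refine Finset.sum_congr rfl fun i _ ↦ ?_
  congr 1
  · congr 1
    ext1 a
    fin_cases a; rfl
  · congr 1
    ext1 a
    fin_cases a <;> rfl

lemma flat_sharp (α : DiffForm M 1) : flat (sharp α) = α :=
  form_one_ext fun x v ↦ by rw [flat_apply, inner_sharp]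

lemma sharp_flat (X : Field M) : sharp (flat X) = X := by
  funext x
  exact ext_inner_right ℝ fun v ↦ by rw [inner_sharp, flat_apply]

lemma flat_smul (r : ℝ) (X : Field M) : flat (r • X) = r • flat X :=
  form_one_ext fun x v ↦ by
    change inner ℝ (r • X x) v = r * inner ℝ (X x) v
    rw [real_inner_smul_left]

lemma sharp_smul (r : ℝ) (α : DiffForm M 1) : sharp (r • α) = r • sharp α := by
  funext x
  refine ext_inner_right ℝ fun v ↦ ?_
  rw [inner_sharp]
  change r * α x ![v] = inner ℝ (r • sharp α x) v
  rw [real_inner_smul_left, inner_sharp]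

lemma curl_smul (υ : DiffForm M 3) (r : ℝ) (X : Field M) : curl υ (r • X) = r • curl υ X := by
  rw [curl, flat_smul, extd_smul, hodgeStar_smul, sharp_smul, curl]

/-- `δ d X♭ = (curl curl X)♭`. -/
lemma codiff_extd_flat (υ : DiffForm M 3) (X : Field M) :
    codiff υ (show (1 + 1) + 1 = 3 by norm_num) (extd (flat X)) = flat (curl υ (curl υ X)) := by
  rw [curl, flat_sharp, curl, flat_sharp, codiff]
  norm_num

end Hodge

/-! ### The curl in an adapted frame -/

section CurlInFrame

lemma extd_congr_on {M : Type*} [TopologicalSpace M] [ChartedSpace E3 M] {k : ℕ} {U : Set M}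
    (hU : IsOpen U) {α β : DiffForm M k} (h : ∀ x ∈ U, α x = β x) {x : M} (hx : x ∈ U) :
    extd α x = extd β x := by
  have hev : α.inChart x =ᶠ[𝓝 (extChartAt (𝓡 3) x x)] β.inChart x := by
    have hU' : U ∈ 𝓝 ((extChartAt (𝓡 3) x).symm (extChartAt (𝓡 3) x x)) := by
      rw [extChartAt_to_inv]
      exact hU.mem_nhds hx
    filter_upwards [(continuousAt_extChartAt_symm (I := 𝓡 3) x).preimage_mem_nhds hU'] with y hy
    unfold DiffForm.inChart
    rw [h _ hy]
  unfold extd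
  rw [hev.extDeriv_eq]

lemma curl_congr_on {M : Type*} [TopologicalSpace M] [ChartedSpace E3 M]
    [RiemannianBundle (fun x : M ↦ TangentSpace (𝓡 3) x)] (υ : DiffForm M 3) {U : Set M}
    (hU : IsOpen U) {X Y : Field M} (h : ∀ x ∈ U, X x = Y x) {x : M} (hx : x ∈ U) :
    curl υ X x = curl υ Y x := by
  have hf : extd (flat X) x = extd (flat Y) x :=
    extd_congr_on hU (fun y hy ↦ by unfold flat; rw [h y hy]) hx
  simp only [curl, sharp, hodgeStar, hf]

lemma hodgeLaplacian_of_coClosed {M : Type*} [TopologicalSpace M] [ChartedSpace E3 M]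
    [RiemannianBundle (fun x : M ↦ TangentSpace (𝓡 3) x)] (υ : DiffForm M 3) {α : DiffForm M 1}
    (hα : CoClosed υ α) :
    hodgeLaplacian υ α = flat (curl υ (curl υ (sharp α))) := by
  unfold CoClosed at hα
  unfold hodgeLaplacian
  rw [hα, extd_zero, zero_add, ← codiff_extd_flat, flat_sharp]

variable {M : Type*} [TopologicalSpace M] [ChartedSpace E3 M] [IsManifold (𝓡 3) ∞ M]
  [RiemannianBundle (fun x : M ↦ TangentSpace (𝓡 3) x)]

lemma SasakianStructure.vol_apply (S : SasakianStructure M) (x : M)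
    (u v w : TangentSpace (𝓡 3) x) :
    S.vol x ![u, v, w] = (1 / 2 : ℝ) * (S.η x ![u] * extd S.η x ![v, w]
      - S.η x ![v] * extd S.η x ![u, w] + S.η x ![w] * extd S.η x ![u, v]) := by
  rw [← wedge_apply]; rfl

namespace AdaptedFrame

variable {S : SasakianStructure M} {U : Set M} (F : AdaptedFrame S U)

/-- The frame `ξ, e₁, e₂` is orthonormal and positive for `υ = ½ η ∧ dη`, so that
`⋆ β (eᵢ) = β (eⱼ, eₖ)` for cyclic `(i, j, k)`. -/
lemma hodgeStar_two_e (β : DiffForm M 2) (hβ : ∀ (x : M) v w, β x ![v, w] = - β x ![w, v]) (x : U) :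
    (hodgeStar S.vol (show 2 + 1 = 3 by norm_num) β x ![F.e 0 x] = β x ![F.e 1 x, F.e 2 x]) ∧
    (hodgeStar S.vol (show 2 + 1 = 3 by norm_num) β x ![F.e 1 x] = β x ![F.e 2 x, F.e 0 x]) ∧
    (hodgeStar S.vol (show 2 + 1 = 3 by norm_num) β x ![F.e 2 x] = β x ![F.e 0 x, F.e 1 x]) := by
  have h0 : S.η x ![F.e 0 x] = 1 := F.eta_e 0 x x.2
  have h1 : S.η x ![F.e 1 x] = 0 := F.eta_e 1 x x.2
  have h2 : S.η x ![F.e 2 x] = 0 := F.eta_e 2 x x.2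
  have d0 (v : TangentSpace (𝓡 3) (x : M)) : extd S.η x ![F.e 0 x, v] = 0 := S.dη_reeb x v
  have d0' (v : TangentSpace (𝓡 3) (x : M)) : extd S.η x ![v, F.e 0 x] = 0 := by
    rw [extd_swap, d0, neg_zero]
  have d12 := F.deta_one_two x
  have d21 : extd S.η x ![F.e 2 x, F.e 1 x] = -2 := by rw [extd_swap, d12]
  have b10 := hβ x (F.e 1 x) (F.e 0 x)
  have b20 := hβ x (F.e 2 x) (F.e 0 x)
  have b21 := hβ x (F.e 2 x) (F.e 1 x)
  refine ⟨?_, ?_, ?_⟩ <;>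
  · rw [hodgeStar_two_apply S.vol β (F.basis x.2)]
    simp only [F.basis_apply, Fin.sum_univ_three, S.vol_apply, h0, h1, h2, d0, d0', d12, d21,
      extd_self, b10, b20, b21]
    ring

variable [IsContMDiffRiemannianBundle (𝓡 3) ∞ E3 (fun x : M ↦ TangentSpace (𝓡 3) x)]

/-- The exterior derivative of `X♭` on the frame fields. -/
lemma extd_flat_e (f : Fin 3 → smoothRing U) (i j : Fin 3) (x : U) :
    extd (flat (F.field f)) x ![F.e i x, F.e j x] = smoothRing.eval x (F.D i (f j) - F.D j (f i)
      - (f 0 * F.bracketComp i j 0 + f 1 * F.bracketComp i j 1 + f 2 * F.bracketComp i j 2)) := by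
  have hs (i : Fin 3) := (F.smooth_e i).smoothFieldOn U
  have he (k : Fin 3) : ∀ y ∈ U, flat (F.field f) y ![F.e k y] = smoothRing.ext (f k) y := by
    intro y hy
    rw [flat_apply, F.inner_field_e f ⟨y, hy⟩, smoothRing.ext_eq_eval _ hy]
  rw [extd_apply F.isOpen (hs i) (hs j) x.2
    (differentiableAt_inChart_flat F.isOpen (F.smoothFieldOn_field f) x.2),
    dirDeriv_congr_on F.isOpen (fun _ _ ↦ rfl) (he j) x.2,
    dirDeriv_congr_on F.isOpen (fun _ _ ↦ rfl) (he i) x.2, flat_apply, F.bracket_e,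
    F.inner_field_field, map_sub, map_sub, eval_D, eval_D]

/-- The curl in components. -/
lemma curl_field (f : Fin 3 → smoothRing U) (x : U) :
    curl S.vol (F.field f) x = F.field (frameCurl F.D F.a F.b F.c f) x := by
  obtain ⟨h0, h1, h2⟩ := F.hodgeStar_two_e _ (extd_swap (flat (F.field f))) x
  refine F.ext_inner x.2 fun i ↦ ?_
  rw [curl, inner_sharp, F.inner_field_e]
  fin_cases i
  · refine h0.trans ?_
    rw [F.extd_flat_e, bracketComp_one_two]
    congr 1
    simp [frameCurl]
    ring
  · refine h1.trans ?_
    rw [extd_swap, F.extd_flat_e, bracketComp_zero_two, ← map_neg]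
    congr 1
    simp [frameCurl]
    ring
  · refine h2.trans ?_
    rw [F.extd_flat_e, bracketComp_zero_one]
    congr 1
    simp [frameCurl]
    ring

end AdaptedFrame

section Curl

variable [IsContMDiffRiemannianBundle (𝓡 3) ∞ E3 (fun x : M ↦ TangentSpace (𝓡 3) x)]

lemma AdaptedFrame.curl_eq_field {S : SasakianStructure M} {U : Set M} (F : AdaptedFrame S U)
    {X : Field M} (hX : SmoothField X) (x : U) :
    curl S.vol X x =
      F.field (frameCurl F.D F.a F.b F.c (F.comp X (hX.smoothFieldOn U))) x := by
  rw [← F.curl_field]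
  exact curl_congr_on S.vol F.isOpen
    (fun y hy ↦ (F.field_comp X (hX.smoothFieldOn U) hy).symm) x.2

variable [T2Space M]

lemma SasakianStructure.smoothField_of_forall_frame (S : SasakianStructure M) {X : Field M}
    (h : ∀ (U : Set M) (F : AdaptedFrame S U), ∃ f, ∀ x ∈ U, X x = F.field f x) :
    SmoothField X := by
  intro x
  obtain ⟨U, hxU, ⟨F⟩⟩ := S.exists_adaptedFrame x
  obtain ⟨f, hf⟩ := h U F
  exact ((F.smoothFieldOn_field f).congr hf).contMDiffAt F.isOpen hxU

lemma SasakianStructure.smoothField_curl (S : SasakianStructure M) {X : Field M}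
    (hX : SmoothField X) : SmoothField (curl S.vol X) :=
  S.smoothField_of_forall_frame fun _ F ↦ ⟨_, fun x hx ↦ F.curl_eq_field hX ⟨x, hx⟩⟩

lemma SasakianStructure.smoothField_sharp (S : SasakianStructure M) {α : DiffForm M 1}
    (hα : α.Smooth) : SmoothField (sharp α) :=
  S.smoothField_of_forall_frame fun U F ↦
    ⟨fun i ↦ smoothRing.mk _ (hα.smoothFnOn_apply F.isOpen ((F.smooth_e i).smoothFieldOn U)),
      fun x hx ↦ F.ext_inner hx fun i ↦ by
        rw [inner_sharp, F.inner_field_e _ ⟨x, hx⟩]; rfl⟩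

lemma SasakianStructure.curl_reeb (S : SasakianStructure M) : curl S.vol S.ξ = (2 : ℝ) • S.ξ := by
  funext x
  obtain ⟨U, hxU, ⟨F⟩⟩ := S.exists_adaptedFrame x
  have h : F.comp S.ξ (S.smooth_ξ.smoothFieldOn U) = Pi.single 0 1 :=
    F.field_injective fun y hy ↦ by
      rw [F.field_comp _ _ hy, F.field_single 0 ⟨y, hy⟩]; rfl
  rw [F.curl_eq_field S.smooth_ξ ⟨x, hxU⟩, h, F.field_apply]
  simp [frameCurl]
  rfl

lemma SasakianStructure.hodgeStar_eta (S : SasakianStructure M) :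
    hodgeStar S.vol (show (0 + 1) + 2 = 3 by norm_num) S.η = (1 / 2 : ℝ) • extd S.η := by
  funext x
  ext v
  have hv : v = ![v 0, v 1] := by ext1 i; fin_cases i <;> rfl
  obtain ⟨U, hxU, ⟨F⟩⟩ := S.exists_adaptedFrame x
  have h0 : S.η x ![F.e 0 x] = 1 := F.eta_e 0 x hxU
  have h1 : S.η x ![F.e 1 x] = 0 := F.eta_e 1 x hxU
  have h2 : S.η x ![F.e 2 x] = 0 := F.eta_e 2 x hxU
  have d0 (v : TangentSpace (𝓡 3) x) : extd S.η x ![F.e 0 x, v] = 0 := S.dη_reeb x v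
  rw [hv]
  refine (hodgeStar_one_apply S.vol S.η (F.basis hxU) _ _).trans ?_
  simp only [F.basis_apply, Fin.sum_univ_three, S.vol_apply, h0, h1, h2, d0]
  change _ = (1 / 2 : ℝ) * extd S.η x ![v 0, v 1]
  ring

/-- `δ η` vanishes since `⋆ η = ½ dη` is closed. -/
lemma SasakianStructure.coClosed_eta (S : SasakianStructure M) : CoClosed S.vol S.η := by
  have h : extd (hodgeStar S.vol (show (0 + 1) + 2 = 3 by norm_num) S.η) = 0 := by
    rw [S.hodgeStar_eta, extd_smul, extd_extd S.smooth_η, smul_zero]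
  unfold CoClosed codiff
  rw [h, ← zero_smul ℝ (0 : DiffForm M 3), hodgeStar_smul, zero_smul, smul_zero]

lemma SasakianStructure.hodgeLaplacian_eta (S : SasakianStructure M) :
    hodgeLaplacian S.vol S.η = (4 : ℝ) • S.η := by
  rw [hodgeLaplacian_of_coClosed _ S.coClosed_eta, S.eta_eq_flat, sharp_flat, S.curl_reeb,
    curl_smul, S.curl_reeb, smul_smul, flat_smul]
  norm_num

end Curl

end CurlInFrame

/-! ### The strong maximum principle -/

section MaximumPrinciple

/-- If on a compact set `f ≤ 0`, with `f < 0` wherever `h ≥ 0`, then `f + ε h < 0` for some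
`ε > 0`. -/
lemma exists_pos_add_mul_neg {E : Type*} [TopologicalSpace E] [T2Space E] {K : Set E}
    (hK : IsCompact K) {f h : E → ℝ} (hf : ContinuousOn f K) (hh : ContinuousOn h K)
    (hle : ∀ y ∈ K, f y ≤ 0) (hlt : ∀ y ∈ K, 0 ≤ h y → f y < 0) :
    ∃ ε > 0, ∀ y ∈ K, f y + ε * h y < 0 := by
  have hK' : IsCompact (K ∩ h ⁻¹' Ici 0) :=
    hK.of_isClosed_subset (hh.preimage_isClosed_of_isClosed hK.isClosed isClosed_Ici)
      inter_subset_left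
  have hneg : ∀ ε > 0, ∀ y ∈ K, h y < 0 → f y + ε * h y < 0 := fun ε hε y hy hhy ↦ by
    nlinarith [hle y hy]
  rcases (K ∩ h ⁻¹' Ici 0).eq_empty_or_nonempty with hemp | hne
  · refine ⟨1, one_pos, fun y hy ↦ hneg 1 one_pos y hy ?_⟩
    by_contra! h0
    exact notMem_empty y (hemp ▸ ⟨hy, h0⟩)
  · obtain ⟨a, ha, hamax⟩ := hK'.exists_isMaxOn hne (hf.mono inter_subset_left)
    obtain ⟨b, hb, hbmax⟩ := hK'.exists_isMaxOn hne (hh.mono inter_subset_left)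
    have hfa : f a < 0 := hlt a ha.1 ha.2
    have hhb : 0 ≤ h b := hb.2
    have hε : 0 < -f a / (h b + 1) := div_pos (by linarith) (by linarith)
    refine ⟨_, hε, fun y hy ↦ ?_⟩
    rcases lt_or_ge (h y) 0 with h0 | h0
    · exact hneg _ hε y hy h0
    · have h1 : f y ≤ f a := hamax ⟨hy, h0⟩
      have h2 : h y ≤ h b := hbmax ⟨hy, h0⟩
      have h3 : -f a / (h b + 1) * (h b + 1) = -f a := div_mul_cancel₀ _ (by linarith)
      nlinarith

section FrameLaplacian

variable {R : Type*} [CommRing R] [Algebra ℝ R] (D : Fin 3 → Derivation ℝ R R) (a b : R)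

lemma frameLaplacian_add_smul (u h : R) (r : ℝ) :
    frameLaplacian D a b (u + r • h) = frameLaplacian D a b u + r • frameLaplacian D a b h := by
  have hs (i : Fin 3) (f : R) : D i (r • f) = r • D i f := (D i).map_smul r f
  simp only [frameLaplacian, map_add, hs]
  simp only [Algebra.smul_def]
  ring

lemma frameLaplacian_sq (t : R) :
    frameLaplacian D a b (t ^ 2) =
      2 * (D 0 t ^ 2 + D 1 t ^ 2 + D 2 t ^ 2) + 2 * t * frameLaplacian D a b t := by
  simp only [frameLaplacian, pow_two, Derivation.leibniz, map_add, smul_eq_mul]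
  ring

end FrameLaplacian

section TouchingBall

variable {E : Type*} [NormedAddCommGroup E] [InnerProductSpace ℝ E]

/-- A compact set that does not contain `z` has an exterior touching ball whose closure meets
the set in a single point `w`. It is the ball with diameter from `z` to a nearest point `w`. -/
lemma exists_touching_ball {A : Set E} (hA : IsCompact A) {c z : E} (hc : c ∈ A) (hz : z ∉ A) :
    ∃ w ∈ A, ∃ (z' : E) (R : ℝ), w ≠ z' ∧ dist w z' = R ∧ dist w z ≤ dist c z ∧
      ∀ y, y ≠ w → dist y z' ≤ R → y ∉ A ∧ dist y z ≤ dist c z := by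
  obtain ⟨w, hwA, hw⟩ := hA.exists_infDist_eq_dist ⟨c, hc⟩ z
  have hmin : ∀ y ∈ A, dist w z ≤ dist y z := fun y hy ↦ by
    rw [dist_comm w, dist_comm y, ← hw]
    exact Metric.infDist_le_dist_of_mem hy
  have hwz : w ≠ z := fun h ↦ hz (h ▸ hwA)
  set p : E := (1 / 2 : ℝ) • (w - z) with hp
  have hw' : w - (z + p) = p := by rw [hp]; module
  have hpz : p ≠ 0 := by
    rw [hp]
    exact smul_ne_zero (by norm_num) (sub_ne_zero.2 hwz)
  have hn : dist w z = 2 * ‖p‖ := by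
    rw [dist_eq_norm, hp, norm_smul]
    norm_num
    ring
  refine ⟨w, hwA, z + p, ‖p‖, fun h ↦ hpz (by rw [← hw', ← h, sub_self]),
    by rw [dist_eq_norm, hw'], hmin c hc, fun y hy hyR ↦ ?_⟩
  have hlt : dist y z < dist w z := by
    rw [hn, dist_eq_norm]
    rw [dist_eq_norm] at hyR
    set u : E := y - (z + p) with hu
    have h1 : y - z = u + p := by rw [hu]; abel
    have h2 : u - p ≠ 0 := by
      have : u - p = y - w := by rw [hu, hp]; module
      rw [this]
      exact sub_ne_zero.2 hy
    have h3 : 0 < ‖u - p‖ := norm_pos_iff.2 h2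
    have h4 := parallelogram_law_with_norm ℝ u p
    rw [h1]
    nlinarith [norm_nonneg u, norm_nonneg p, norm_nonneg (u + p)]
  exact ⟨fun h ↦ absurd (hmin y h) (not_le.2 hlt), (hlt.trans_le (hmin c hc)).le⟩

end TouchingBall

section Chart

variable {M : Type*} [TopologicalSpace M] [ChartedSpace E3 M] [IsManifold (𝓡 3) ∞ M]

/-- The function `r - |φ - z|²` for a preferred chart `φ`. -/
def chartBarrier (q : M) (z : E3) (r : ℝ) (x : M) : ℝ := r - ‖extChartAt (𝓡 3) q x - z‖ ^ 2

lemma smoothFnOn_chartBarrier (q : M) (z : E3) (r : ℝ) :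
    SmoothFnOn (extChartAt (𝓡 3) q).source (chartBarrier q z r) := by
  have h : ContMDiffOn (𝓡 3) 𝓘(ℝ, E3) ∞ (extChartAt (𝓡 3) q) (extChartAt (𝓡 3) q).source := by
    rw [extChartAt_source]
    exact contMDiffOn_extChartAt
  have h2 : ContDiff ℝ ∞ (fun y : E3 ↦ r - ‖y - z‖ ^ 2) :=
    contDiff_const.sub ((contDiff_id.sub contDiff_const).norm_sq ℝ)
  exact h2.contMDiff.comp_contMDiffOn h

lemma mvfderiv_chartBarrier (q : M) (z : E3) (r : ℝ) {w : E3}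
    (hw : w ∈ (extChartAt (𝓡 3) q).target) (u : E3) :
    mvfderiv (𝓡 3) (chartBarrier q z r) ((extChartAt (𝓡 3) q).symm w) (chartSymmDeriv q w u) =
      - (2 * inner ℝ (w - z) u) := by
  have hG : HasFDerivAt (fun y : E3 ↦ r - ‖y - z‖ ^ 2)
      (-(2 • (innerSL ℝ (w - z)).comp (ContinuousLinearMap.id ℝ E3))) w :=
    (((hasFDerivAt_id w).sub_const z).norm_sq).const_sub r
  have hw' : extChartAt (𝓡 3) q ((extChartAt (𝓡 3) q).symm w) = w :=
    (extChartAt (𝓡 3) q).right_inv hw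
  have hG' : HasFDerivAt (fun y : E3 ↦ r - ‖y - z‖ ^ 2)
      (-(2 • (innerSL ℝ (w - z)).comp (ContinuousLinearMap.id ℝ E3)))
      (extChartAt (𝓡 3) q ((extChartAt (𝓡 3) q).symm w)) := by
    rw [hw']; exact hG
  have hs : (extChartAt (𝓡 3) q).symm w ∈ (chartAt E3 q).source := by
    rw [← extChartAt_source (𝓡 3) q]
    exact (extChartAt (𝓡 3) q).map_target hw
  have h := mvfderiv_comp_apply ((extChartAt (𝓡 3) q).symm w)
    hG'.differentiableAt.mdifferentiableAt (mdifferentiableAt_extChartAt (I := 𝓡 3) hs)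
    (chartSymmDeriv q w u)
  refine h.trans ?_
  change mfderiv 𝓘(ℝ, E3) 𝓘(ℝ, ℝ) (fun y : E3 ↦ r - ‖y - z‖ ^ 2) _
    (chartDeriv q ((extChartAt (𝓡 3) q).symm w) (chartSymmDeriv q w u)) = _
  rw [mfderiv_eq_fderiv, hG'.fderiv, chartDeriv_chartSymmDeriv hw]
  change -(2 • (inner ℝ (w - z) u : ℝ)) = _
  rw [nsmul_eq_mul, Nat.cast_ofNat]

end Chart

namespace AdaptedFrame

variable {M : Type*} [TopologicalSpace M] [ChartedSpace E3 M] [IsManifold (𝓡 3) ∞ M]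
  [RiemannianBundle (fun x : M ↦ TangentSpace (𝓡 3) x)]
  {S : SasakianStructure M} {U : Set M} (F : AdaptedFrame S U)

/-- The restriction of an adapted frame to a smaller open set. -/
def restrict {V : Set M} (hV : IsOpen V) (h : V ⊆ U) : AdaptedFrame S V where
  e₁ := F.e₁
  isOpen := hV
  smooth := F.smooth
  unit x hx := F.unit x (h hx)
  horizontal x hx := F.horizontal x (h hx)

lemma eval_D_mk (i : Fin 3) {G : M → ℝ} (hG : SmoothFnOn U G) (x : U) :
    smoothRing.eval x (F.D i (smoothRing.mk G hG)) = dirDeriv (F.e i) G x := by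
  unfold D
  rw [fieldDerivation_mk]
  rfl

lemma eval_D_eq_zero_of_isLocalMax (u : smoothRing U) (x : U)
    (h : IsLocalMax (smoothRing.ext u) (x : M)) (i : Fin 3) :
    smoothRing.eval x (F.D i u) = 0 ∧ smoothRing.eval x (F.D i (F.D i u)) ≤ 0 := by
  obtain ⟨h1, h2⟩ := dirDeriv_dirDeriv_nonpos_of_isLocalMax F.isOpen
    ((F.smooth_e i).smoothFieldOn U) (smoothRing.smoothFnOn_ext u) x.2 h
  refine ⟨h1, le_of_eq_of_le ?_ h2⟩
  rw [eval_D]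
  exact dirDeriv_congr_on F.isOpen (fun _ _ ↦ rfl) (fun y hy ↦ smoothRing.ext_eq_eval _ hy) x.2

lemma eval_frameLaplacian_nonpos_of_isLocalMax [IsContMDiffRiemannianBundle (𝓡 3) ∞ E3
      (fun x : M ↦ TangentSpace (𝓡 3) x)] (u : smoothRing U) (x : U)
    (h : IsLocalMax (smoothRing.ext u) (x : M)) :
    smoothRing.eval x (frameLaplacian F.D F.a F.b u) ≤ 0 := by
  have h0 := F.eval_D_eq_zero_of_isLocalMax u x h 0
  have h1 := F.eval_D_eq_zero_of_isLocalMax u x h 1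
  have h2 := F.eval_D_eq_zero_of_isLocalMax u x h 2
  simp only [frameLaplacian, map_add, map_sub, map_mul, h1.1, h2.1]
  linarith [h0.2, h1.2, h2.2]

/-- The differential of a function that is annihilated by the frame fields vanishes. -/
lemma mvfderiv_eq_zero {G : M → ℝ} {x : M} (hx : x ∈ U) (h : ∀ i, dirDeriv (F.e i) G x = 0)
    (v : TangentSpace (𝓡 3) x) : mvfderiv (𝓡 3) G x v = 0 := by
  rw [← (F.basis hx).sum_repr' v, map_sum]
  refine Finset.sum_eq_zero fun i _ ↦ ?_
  rw [map_smul, F.basis_apply]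
  have := h i
  unfold dirDeriv at this
  rw [this, smul_zero]

end AdaptedFrame

variable {M : Type*} [TopologicalSpace M] [ChartedSpace E3 M] [IsManifold (𝓡 3) ∞ M]
  [RiemannianBundle (fun x : M ↦ TangentSpace (𝓡 3) x)]
  [IsContMDiffRiemannianBundle (𝓡 3) ∞ E3 (fun x : M ↦ TangentSpace (𝓡 3) x)]

/-- The barrier `t + k t²` of the touching ball, where `t = R² - |φ - z|²` and `k` is so large that
the Laplacian of the barrier is positive at the touching point. -/
lemma AdaptedFrame.exists_barrier {S : SasakianStructure M} {q : M} {U : Set M}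
    (F : AdaptedFrame S U) {w z : E3} {R : ℝ}
    (hwU : w ∈ (extChartAt (𝓡 3) q).target) (hwU' : (extChartAt (𝓡 3) q).symm w ∈ U)
    (hwz : w ≠ z) (htU : SmoothFnOn U (chartBarrier q z (R ^ 2)))
    (ht₀ : smoothRing.eval ⟨_, hwU'⟩ (smoothRing.mk _ htU) = 0) :
    ∃ k : ℝ, 0 < k ∧ 0 < smoothRing.eval ⟨_, hwU'⟩
      (frameLaplacian F.D F.a F.b (smoothRing.mk _ htU + k • smoothRing.mk _ htU ^ 2)) := by
  set x₀ : U := ⟨(extChartAt (𝓡 3) q).symm w, hwU'⟩ with hx₀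
  set t : smoothRing U := smoothRing.mk _ htU with ht
  -- the gradient of `t` does not vanish at `x₀`
  obtain ⟨i, hi⟩ : ∃ i, smoothRing.eval x₀ (F.D i t) ≠ 0 := by
    by_contra! h0
    have h := F.mvfderiv_eq_zero x₀.2 (fun i ↦ (F.eval_D_mk i htU x₀).symm.trans (h0 i))
      (chartSymmDeriv q w (w - z))
    have h2 := mvfderiv_chartBarrier q z (R ^ 2) hwU (w - z)
    have h3 := h2.symm.trans h
    have h4 : (0 : ℝ) < inner ℝ (w - z) (w - z) := real_inner_self_pos.2 (sub_ne_zero.2 hwz)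
    linarith
  set G : smoothRing U := F.D 0 t ^ 2 + F.D 1 t ^ 2 + F.D 2 t ^ 2 with hG
  have hGpos : 0 < smoothRing.eval x₀ G := by
    simp only [hG, map_add, map_pow]
    have h := pow_pos (abs_pos.2 hi) 2
    rw [sq_abs] at h
    fin_cases i <;>
    · simp only [Fin.zero_eta, Fin.mk_one, Fin.reduceFinMk] at h
      nlinarith [sq_nonneg (smoothRing.eval x₀ (F.D 0 t)),
        sq_nonneg (smoothRing.eval x₀ (F.D 1 t)), sq_nonneg (smoothRing.eval x₀ (F.D 2 t))]
  set l : ℝ := smoothRing.eval x₀ (frameLaplacian F.D F.a F.b t) with hl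
  refine ⟨(1 + |l|) / smoothRing.eval x₀ G, by positivity, ?_⟩
  have h : smoothRing.eval x₀ (frameLaplacian F.D F.a F.b (t ^ 2)) = 2 * smoothRing.eval x₀ G := by
    rw [frameLaplacian_sq, map_add, map_mul, map_mul, map_mul, ht₀, map_ofNat]
    ring
  rw [frameLaplacian_add_smul, map_add, map_smul, h, smul_eq_mul, mul_left_comm,
    div_mul_cancel₀ _ hGpos.ne', ← hl]
  linarith [neg_abs_le l, abs_nonneg l]

/-- The boundary argument in the strong maximum principle. Let `Δ u ≥ 0`, and let `u` attain its
maximum `m` at a point `w` (in the chart) of the boundary of a ball in whose closure `u < m` except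
at `w`. The barrier `h` is positive in the ball, vanishes at `w`, is nonpositive outside, and has
`Δ h > 0` near `w`. For small `ε > 0` the function `u + ε h` is less than `m` on a small sphere
around `w` and equal to `m` at `w`, so it has a local maximum inside, where `Δ (u + ε h) > 0`. -/
lemma AdaptedFrame.hopf_contradiction {S : SasakianStructure M} {q : M} {U : Set M}
    (F : AdaptedFrame S U) (hUq : U ⊆ (extChartAt (𝓡 3) q).source) (u : smoothRing U)
    (hL : ∀ x, 0 ≤ smoothRing.eval x (frameLaplacian F.D F.a F.b u)) {m : ℝ}
    (hm : ∀ x, smoothRing.eval x u ≤ m) {w z : E3} {R : ℝ}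
    (hwU : w ∈ (extChartAt (𝓡 3) q).target) (hwU' : (extChartAt (𝓡 3) q).symm w ∈ U)
    (hwm : smoothRing.eval ⟨_, hwU'⟩ u = m) (hwz : w ≠ z) (hR : dist w z = R)
    (hball : ∀ x : U, extChartAt (𝓡 3) q x ≠ w → dist (extChartAt (𝓡 3) q x) z ≤ R →
      smoothRing.eval x u < m) : False := by
  set φ := extChartAt (𝓡 3) q with hφ
  set x₀ : U := ⟨φ.symm w, hwU'⟩ with hx₀
  have hφx₀ : φ x₀ = w := φ.right_inv hwU
  have htU : SmoothFnOn U (chartBarrier q z (R ^ 2)) :=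
    ContMDiffOn.mono (smoothFnOn_chartBarrier q z (R ^ 2)) hUq
  set t : smoothRing U := smoothRing.mk _ htU with ht
  have ht_apply (x : U) : smoothRing.eval x t = R ^ 2 - dist (φ x) z ^ 2 := by
    rw [dist_eq_norm]; rfl
  have ht₀ : smoothRing.eval x₀ t = 0 := by rw [ht_apply, hφx₀, hR, sub_self]
  obtain ⟨k, hk0, hLh₀⟩ := F.exists_barrier hwU hwU' hwz htU ht₀
  set h : smoothRing U := t + k • t ^ 2 with hh
  have hcont (v : smoothRing U) {x : M} (hx : x ∈ U) : ContinuousAt (smoothRing.ext v) x :=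
    (SmoothFnOn.contMDiffAt F.isOpen (smoothRing.smoothFnOn_ext v) hx).continuousAt
  -- a neighbourhood of `x₀` on which the barrier has positive Laplacian and the sign of `t`
  have hev : ∀ᶠ y in 𝓝 w, y ∈ φ.target ∧ φ.symm y ∈ U ∧
      0 < smoothRing.ext (frameLaplacian F.D F.a F.b h) (φ.symm y) ∧
      0 < 1 + k * smoothRing.ext t (φ.symm y) := by
    have hc : ContinuousAt φ.symm w := continuousAt_extChartAt_symm'' hwU
    have h1 : φ.target ∈ 𝓝 w := (isOpen_extChartAt_target q).mem_nhds hwU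
    have h2 := hc.eventually (F.isOpen.mem_nhds hwU')
    have h3 := hc.eventually ((hcont (frameLaplacian F.D F.a F.b h) hwU').eventually
      (lt_mem_nhds (a := 0) (by rw [smoothRing.ext_eq_eval _ hwU']; exact hLh₀)))
    have h4 := hc.eventually ((((hcont t hwU').const_mul k).const_add 1).eventually
      (lt_mem_nhds (a := 0) (by
        change 0 < 1 + k * smoothRing.ext t (φ.symm w)
        rw [smoothRing.ext_eq_eval _ hwU']
        change 0 < 1 + k * smoothRing.eval x₀ t
        rw [ht₀]; norm_num)))
    filter_upwards [h1, h2, h3, h4] with y a b c d using ⟨a, b, c, d⟩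
  obtain ⟨s, hs, hsball⟩ := Metric.nhds_basis_closedBall.eventually_iff.1 hev
  have hcontE (v : smoothRing U) :
      ContinuousOn (fun y ↦ smoothRing.ext v (φ.symm y)) (Metric.closedBall w s) := fun y hy ↦ by
    have h1 : ContinuousAt φ.symm y := continuousAt_extChartAt_symm'' (hsball hy).1
    exact (ContinuousAt.comp (f := φ.symm) (hcont v (hsball hy).2.1) h1).continuousWithinAt
  have hext (v : smoothRing U) {y : E3} (hy : y ∈ Metric.closedBall w s) :
      smoothRing.ext v (φ.symm y) = smoothRing.eval ⟨φ.symm y, (hsball hy).2.1⟩ v :=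
    smoothRing.ext_eq_eval _ _
  have hh_apply (x : U) : smoothRing.eval x h =
      smoothRing.eval x t * (1 + k * smoothRing.eval x t) := by
    rw [hh, map_add, map_smul, map_pow, smul_eq_mul]; ring
  have hsub : Metric.sphere w s ⊆ Metric.closedBall w s := Metric.sphere_subset_closedBall
  obtain ⟨ε, hε, hneg⟩ := exists_pos_add_mul_neg (isCompact_sphere w s)
    (f := fun y ↦ smoothRing.ext u (φ.symm y) - m) (h := fun y ↦ smoothRing.ext h (φ.symm y))
    (((hcontE u).mono hsub).sub continuousOn_const) ((hcontE h).mono hsub)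
    (fun y hy ↦ by
      rw [hext u (hsub hy)]
      exact sub_nonpos.2 (hm _))
    (fun y hy h0 ↦ by
      have hyB := hsball (hsub hy)
      have hφy : φ (φ.symm y) = y := φ.right_inv hyB.1
      have h1 := hyB.2.2.2
      rw [hext t (hsub hy)] at h1
      rw [hext h (hsub hy), hh_apply] at h0
      have h2 := nonneg_of_mul_nonneg_left h0 h1
      rw [ht_apply, hφy] at h2
      have hR0 : 0 ≤ R := hR ▸ dist_nonneg
      rw [hext u (hsub hy)]
      refine sub_neg.2 (hball _ ?_ ?_)
      · rw [hφy]
        exact Metric.ne_of_mem_sphere hy hs.ne'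
      · rw [hφy]
        nlinarith [dist_nonneg (x := y) (y := z)])
  -- the maximum of `u + ε h` over a small ball is attained in the interior
  obtain ⟨y, hy, hymax⟩ := (isCompact_closedBall w s).exists_isMaxOn
    ⟨w, Metric.mem_closedBall_self hs.le⟩ (hcontE (u + ε • h))
  have hadd (x : U) : smoothRing.eval x (u + ε • h) =
      smoothRing.eval x u + ε * smoothRing.eval x h := by
    rw [map_add, map_smul, smul_eq_mul]
  have hym : m ≤ smoothRing.ext (u + ε • h) (φ.symm y) := by
    have h1 := hymax (Metric.mem_closedBall_self hs.le)
    refine le_trans (le_of_eq ?_) h1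
    change m = smoothRing.ext (u + ε • h) (φ.symm w)
    rw [hext _ (Metric.mem_closedBall_self hs.le), hadd, hwm, hh_apply]
    change m = m + ε * (smoothRing.eval x₀ t * _)
    rw [ht₀, zero_mul, mul_zero, add_zero]
  have hyball : y ∈ Metric.ball w s := by
    rcases lt_or_eq_of_le (Metric.mem_closedBall.1 hy) with h1 | h1
    · exact h1
    · have h2 := hneg y h1
      rw [hext _ hy, hadd] at hym
      rw [hext u hy, hext h hy] at h2
      linarith
  have hφy : φ (φ.symm y) = y := φ.right_inv (hsball hy).1
  have hloc : IsLocalMax (smoothRing.ext (u + ε • h)) (φ.symm y) := by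
    have hsrc : φ.source ∈ 𝓝 (φ.symm y) :=
      (isOpen_extChartAt_source q).mem_nhds (φ.map_target (hsball hy).1)
    have hc : ContinuousAt φ (φ.symm y) :=
      continuousAt_extChartAt' (by exact φ.map_target (hsball hy).1)
    have hB : Metric.ball w s ∈ 𝓝 (φ (φ.symm y)) := by
      rw [hφy]
      exact Metric.isOpen_ball.mem_nhds hyball
    filter_upwards [hsrc, hc.eventually hB] with x hx hxB
    have h1 := hymax (Metric.ball_subset_closedBall hxB)
    change smoothRing.ext (u + ε • h) (φ.symm (φ x)) ≤ _ at h1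
    rwa [φ.left_inv hx] at h1
  have hyU : φ.symm y ∈ U := (hsball hy).2.1
  have h1 := F.eval_frameLaplacian_nonpos_of_isLocalMax (u + ε • h) ⟨_, hyU⟩ hloc
  rw [frameLaplacian_add_smul, map_add, map_smul, smul_eq_mul] at h1
  have h3 := (hsball hy).2.2.1
  rw [hext _ hy] at h3
  have h4 := mul_pos hε h3
  linarith [hL ⟨_, hyU⟩]

/-- The strong maximum principle: the set where `N` is maximal is open. Otherwise a nearby point
outside the set yields, in a chart, a ball that touches the set in exactly one point. -/
theorem SasakianStructure.eq_of_laplacian_nonneg [T2Space M] [ConnectedSpace M]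
    (S : SasakianStructure M) {N : M → ℝ} (hN : SmoothFnOn univ N)
    (hL : ∀ (U : Set M) (F : AdaptedFrame S U) (x : U), 0 ≤ smoothRing.eval x
      (frameLaplacian F.D F.a F.b (smoothRing.mk N (ContMDiffOn.mono hN (subset_univ U)))))
    {p : M} (hp : ∀ y, N y ≤ N p) (y : M) : N y = N p := by
  have hNc : Continuous N := (contMDiffOn_univ.1 hN).continuous
  suffices h : IsClopen {y | N y = N p} by
    exact (h.eq_univ ⟨p, rfl⟩).ge (mem_univ y)
  refine ⟨isClosed_eq hNc continuous_const, isOpen_iff_mem_nhds.2 fun q hq ↦ ?_⟩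
  by_contra hqn
  obtain ⟨U, hqU, ⟨F⟩⟩ := S.exists_adaptedFrame q
  set φ := extChartAt (𝓡 3) q with hφ
  have hq' : φ.symm (φ q) = q := extChartAt_to_inv q
  have hO : ∀ᶠ y in 𝓝 (φ q), y ∈ φ.target ∧ φ.symm y ∈ U := by
    have hc : ContinuousAt φ.symm (φ q) := continuousAt_extChartAt_symm q
    filter_upwards [extChartAt_target_mem_nhds (I := 𝓡 3) q,
      hc.eventually (F.isOpen.mem_nhds (by rw [hq']; exact hqU))] with y a b using ⟨a, b⟩
  obtain ⟨r, hr, hrball⟩ := Metric.nhds_basis_closedBall.eventually_iff.1 hO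
  have hcontN : ContinuousOn (fun y ↦ N (φ.symm y)) (Metric.closedBall (φ q) r) := fun y hy ↦
    (hNc.continuousAt.comp (continuousAt_extChartAt_symm'' (hrball hy).1)).continuousWithinAt
  have hA : IsCompact (Metric.closedBall (φ q) r ∩ (fun y ↦ N (φ.symm y)) ⁻¹' {N p}) :=
    (isCompact_closedBall (φ q) r).of_isClosed_subset
      (hcontN.preimage_isClosed_of_isClosed Metric.isClosed_closedBall isClosed_singleton)
      inter_subset_left
  -- a point near `q` at which `N` is not maximal
  obtain ⟨y₁, ⟨hy₁s, hy₁r⟩, hy₁⟩ : ∃ y₁, (y₁ ∈ φ.source ∧ φ y₁ ∈ Metric.ball (φ q) (r / 2)) ∧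
      N y₁ ≠ N p := by
    by_contra! hcon
    refine hqn ?_
    filter_upwards [extChartAt_source_mem_nhds (I := 𝓡 3) q,
      (continuousAt_extChartAt (I := 𝓡 3) q).eventually
        (Metric.ball_mem_nhds (φ q) (half_pos hr))] with y a b
    exact hcon y ⟨a, b⟩
  obtain ⟨w, ⟨hwr, hwN⟩, z, R, hwz, hR, hwy, hball⟩ := exists_touching_ball hA (c := φ q)
    (z := φ y₁) ⟨Metric.mem_closedBall_self hr.le, by
      change N (φ.symm (φ q)) = N p
      rw [hq']; exact hq⟩
    (fun h ↦ hy₁ (by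
      have := h.2
      change N (φ.symm (φ y₁)) = N p at this
      rwa [φ.left_inv hy₁s] at this))
  have hVo : IsOpen (U ∩ φ.source) := F.isOpen.inter (isOpen_extChartAt_source q)
  refine (F.restrict hVo inter_subset_left).hopf_contradiction (q := q) inter_subset_right
    (smoothRing.mk N (ContMDiffOn.mono hN (subset_univ _))) (hL _ _) (m := N p)
    (fun x ↦ hp x) (hrball hwr).1 ⟨(hrball hwr).2, φ.map_target (hrball hwr).1⟩ hwN hwz hR
    fun x hx hxR ↦ lt_of_le_of_ne (hp x) fun hxN ↦ ?_
  obtain ⟨h1, h2⟩ := hball (φ x) hx hxR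
  refine h1 ⟨?_, ?_⟩
  · have h3 : dist (φ y₁) (φ q) < r / 2 := hy₁r
    have h4 := dist_triangle (φ x) (φ y₁) (φ q)
    rw [dist_comm (φ q)] at h2
    exact Metric.mem_closedBall.2 (by linarith)
  · change N (φ.symm (φ x)) = N p
    rw [φ.left_inv x.2.2]
    exact hxN

end MaximumPrinciple

/-! ### Curl eigenfields -/

section EigenfieldAlgebra

variable {R : Type*} [CommRing R] [Algebra ℝ R] {D : Fin 3 → Derivation ℝ R R} {a b c : R}

lemma frameCurl_smul (r : ℝ) (f : Fin 3 → R) :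
    frameCurl D a b c (r • f) = r • frameCurl D a b c f := by
  have hs (i : Fin 3) (f : R) : D i (r • f) = r • D i f := (D i).map_smul r f
  funext k
  fin_cases k <;>
  · simp only [frameCurl, Pi.smul_apply, hs, Matrix.cons_val, Fin.zero_eta, Fin.mk_one,
      Fin.reduceFinMk]
    simp only [Algebra.smul_def]
    ring

lemma frameDiv_smul (r : ℝ) (f : Fin 3 → R) : frameDiv D a b (r • f) = r • frameDiv D a b f := by
  have hs (i : Fin 3) (f : R) : D i (r • f) = r • D i f := (D i).map_smul r f
  simp only [frameDiv, Pi.smul_apply, hs]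
  simp only [Algebra.smul_def]
  ring

/-- A field whose double curl is a nonzero multiple of itself is divergence-free. -/
lemma StructureEquations.div_eq_zero (h : StructureEquations D a b c) {f g : Fin 3 → R} {l : ℝ}
    (hl : l ≠ 0) (hf : frameCurl D a b c g = l • f) : frameDiv D a b f = 0 := by
  have h1 := h.div_curl g
  rw [hf, frameDiv_smul] at h1
  rw [← inv_smul_smul₀ hl (frameDiv D a b f), h1, smul_zero]

/-- The Bochner formula for a horizontal curl eigenfield: the part of the covariant derivative that
involves `ξ` is determined by the field. -/
lemma StructureEquations.bochner_horizontal (h : StructureEquations D a b c) {f : Fin 3 → R} {l : ℝ}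
    (hl : l ≠ 0) (hf : frameCurl D a b c f = l • f) (hf0 : f 0 = 0) :
    frameLaplacian D a b (f 0 ^ 2 + f 1 ^ 2 + f 2 ^ 2) =
      2 * ((D 1 (f 1) + a * f 2) ^ 2 + (D 1 (f 2) - a * f 1) ^ 2 + (D 2 (f 1) + b * f 2) ^ 2
        + (D 2 (f 2) - b * f 1) ^ 2
        + (contactCurvature D a b c + 3 - 2 * algebraMap ℝ R l)
          * (f 0 ^ 2 + f 1 ^ 2 + f 2 ^ 2)) := by
  rw [h.bochner f (h.div_eq_zero hl hf), hf, frameCurl_smul, hf]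
  have h1 := congrFun hf 1
  have h2 := congrFun hf 2
  simp only [frameCurl, Matrix.cons_val, Pi.smul_apply, hf0, map_zero, Algebra.smul_def] at h1 h2
  have e01 : D 0 (f 1) = algebraMap ℝ R l * f 2 + c * f 2 := by linear_combination h2
  have e02 : D 0 (f 2) = - (algebraMap ℝ R l * f 1) - c * f 1 := by linear_combination -h1
  simp only [covMatrix, Fin.sum_univ_three, Matrix.of_apply, Matrix.cons_val, Pi.smul_apply, hf0,
    map_zero, e01, e02]
  simp only [Algebra.smul_def]
  ring

/-- The antisymmetric part of the covariant derivative is the curl. -/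
lemma covMatrix_sub (f : Fin 3 → R) :
    covMatrix D a b c f 1 2 - covMatrix D a b c f 2 1 = frameCurl D a b c f 0 ∧
    covMatrix D a b c f 2 0 - covMatrix D a b c f 0 2 = frameCurl D a b c f 1 ∧
    covMatrix D a b c f 0 1 - covMatrix D a b c f 1 0 = frameCurl D a b c f 2 := by
  simp only [covMatrix, frameCurl, Matrix.of_apply, Matrix.cons_val]
  refine ⟨?_, ?_, ?_⟩ <;> ring

end EigenfieldAlgebra

section Eigenfields

variable {M : Type*} [TopologicalSpace M] [ChartedSpace E3 M]
  [RiemannianBundle (fun x : M ↦ TangentSpace (𝓡 3) x)]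

lemma metric_self_nonneg (X : Field M) (x : M) : 0 ≤ metric X X x := real_inner_self_nonneg

lemma exists_metric_self_pos {X : Field M} (hX : X ≠ 0) : ∃ x, 0 < metric X X x := by
  obtain ⟨x, hx⟩ := Function.ne_iff.1 hX
  exact ⟨x, real_inner_self_pos.2 hx⟩

variable [IsManifold (𝓡 3) ∞ M]
  [IsContMDiffRiemannianBundle (𝓡 3) ∞ E3 (fun x : M ↦ TangentSpace (𝓡 3) x)]
  {S : SasakianStructure M}

lemma SmoothField.smoothFnOn_metric {X : Field M} (hX : SmoothField X) (U : Set M) :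
    SmoothFnOn U (metric X X) :=
  (hX.smoothFieldOn U).metric (hX.smoothFieldOn U)

namespace AdaptedFrame

variable {U : Set M} (F : AdaptedFrame S U)

lemma mk_metric_self {X : Field M} (hX : SmoothField X) :
    smoothRing.mk (metric X X) (hX.smoothFnOn_metric U) =
      F.comp X (hX.smoothFieldOn U) 0 ^ 2 + F.comp X (hX.smoothFieldOn U) 1 ^ 2
        + F.comp X (hX.smoothFieldOn U) 2 ^ 2 := by
  refine smoothRing.eval_injective fun x ↦ ?_
  have h := F.inner_field_field (F.comp X (hX.smoothFieldOn U)) (F.comp X (hX.smoothFieldOn U)) x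
  rw [F.field_comp _ _ x.2] at h
  simp only [pow_two]
  exact h

lemma frameCurl_comp {X Y : Field M} (hX : SmoothField X) (hY : SmoothField Y) {l : ℝ}
    (h : curl S.vol X = l • Y) :
    frameCurl F.D F.a F.b F.c (F.comp X (hX.smoothFieldOn U))
      = l • F.comp Y (hY.smoothFieldOn U) :=
  F.field_injective fun x hx ↦ by
    rw [← F.curl_eq_field hX ⟨x, hx⟩, h]
    refine F.ext_inner hx fun i ↦ ?_
    rw [F.inner_field_e _ ⟨x, hx⟩]
    exact (real_inner_smul_left _ _ _).trans (map_smul (smoothRing.eval ⟨x, hx⟩) l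
      (F.comp Y (hY.smoothFieldOn U) i)).symm

/-- The Bochner formula for `|X|²`, at a point of `U`, where `X` is a horizontal curl eigenfield.
The horizontal part of `∇ X` is symmetric and trace-free, since `⟨curl X, ξ⟩ = 0` and `div X = 0`,
hence of the form `!![p, q; q, -p]`. It is invertible unless it vanishes, and it maps `X` to the
horizontal part of `½ grad |X|²`. -/
lemma exists_bochner_horizontal {X : Field M} {l : ℝ} (hl : l ≠ 0)
    (hX : IsCurlEigenfield S.vol l X) (hT : S.TangentToContact X) (x : U) :
    ∃ p q : ℝ, smoothRing.eval x (frameLaplacian F.D F.a F.b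
        (smoothRing.mk (metric X X) (hX.smooth.smoothFnOn_metric U))) =
      2 * (2 * (p ^ 2 + q ^ 2)
        + (smoothRing.eval x (contactCurvature F.D F.a F.b F.c) + 3 - 2 * l) * metric X X x) ∧
      ((∀ i, smoothRing.eval x (F.D i
        (smoothRing.mk (metric X X) (hX.smooth.smoothFnOn_metric U))) = 0) →
          metric X X x * (p ^ 2 + q ^ 2) = 0) := by
  set f := F.comp X (hX.smooth.smoothFieldOn U) with hf
  have hcurl : frameCurl F.D F.a F.b F.c f = l • f := F.frameCurl_comp hX.smooth hX.smooth hX.eigen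
  have hf0 : f 0 = 0 := smoothRing.eval_injective fun y ↦ by
    rw [map_zero, hf, eval_comp]
    have h := hT y
    rw [S.eta_apply] at h
    exact h
  have hN := F.mk_metric_self hX.smooth
  rw [← hf] at hN
  have hNx : metric X X x = smoothRing.eval x (f 1) ^ 2 + smoothRing.eval x (f 2) ^ 2 := by
    have h : metric X X x = smoothRing.eval x (smoothRing.mk (metric X X)
      (hX.smooth.smoothFnOn_metric U)) := rfl
    rw [h, hN, hf0]
    simp
  have hdiv := F.structureEquations.div_eq_zero hl hcurl
  have hc0 := congrFun hcurl 0
  simp only [frameCurl, frameDiv, Matrix.cons_val, Pi.smul_apply, hf0, map_zero, smul_zero]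
    at hc0 hdiv
  have hs : F.D 2 (f 2) - F.b * f 1 = - (F.D 1 (f 1) + F.a * f 2) := by linear_combination hdiv
  have hr : F.D 2 (f 1) + F.b * f 2 = F.D 1 (f 2) - F.a * f 1 := by linear_combination -hc0
  refine ⟨smoothRing.eval x (F.D 1 (f 1) + F.a * f 2), smoothRing.eval x (F.D 1 (f 2) - F.a * f 1),
    ?_, fun h0 ↦ ?_⟩
  · rw [hN, F.structureEquations.bochner_horizontal hl hcurl hf0, hs, hr, hNx, hf0]
    have halg : smoothRing.eval x (algebraMap ℝ (smoothRing U) l) = l := by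
      rw [AlgHom.commutes]; rfl
    simp only [map_add, map_sub, map_mul, map_pow, map_neg, map_ofNat, map_zero, halg]
    ring
  · have h1 := h0 1
    have h2 := h0 2
    have hD (i : Fin 3) : F.D i (f 0 ^ 2 + f 1 ^ 2 + f 2 ^ 2) =
        2 * (f 1 * F.D i (f 1) + f 2 * F.D i (f 2)) := by
      rw [hf0]
      simp only [pow_two, map_add, Derivation.leibniz, smul_eq_mul, map_zero]
      ring
    rw [hN, hD] at h1 h2
    have e1 : F.D 2 (f 1) = F.D 1 (f 2) - F.a * f 1 - F.b * f 2 := by linear_combination hr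
    have e2 : F.D 2 (f 2) = F.b * f 1 - (F.D 1 (f 1) + F.a * f 2) := by linear_combination hs
    rw [e1, e2] at h2
    rw [hNx]
    simp only [map_add, map_sub, map_mul, map_ofNat] at h1 h2 ⊢
    linear_combination (smoothRing.eval x (f 1) * smoothRing.eval x (F.D 1 (f 1))
        + smoothRing.eval x (f 2) * smoothRing.eval x (F.D 1 (f 2))) * h1 / 2
      + (smoothRing.eval x (f 1) * (smoothRing.eval x (F.D 1 (f 2))
          - smoothRing.eval x F.a * smoothRing.eval x (f 1))
        - smoothRing.eval x (f 2) * (smoothRing.eval x (F.D 1 (f 1))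
          + smoothRing.eval x F.a * smoothRing.eval x (f 2))) * h2 / 2

end AdaptedFrame

variable [T2Space M]

/-- If the length of a horizontal curl eigenfield is a positive constant, then the horizontal part
of its covariant derivative vanishes, and the Bochner formula gives the scalar curvature. -/
lemma IsCurlEigenfield.scalarCurvature_eq {X : Field M} {l : ℝ} (hl : l ≠ 0)
    (hX : IsCurlEigenfield S.vol l X) (hT : S.TangentToContact X) {n : ℝ} (hn : 0 < n)
    (hc : ∀ x, metric X X x = n) (x : M) : scalarCurvature x = 4 * l - 2 := by
  obtain ⟨U, hxU, ⟨F⟩⟩ := S.exists_adaptedFrame x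
  obtain ⟨p, q, h1, h2⟩ := F.exists_bochner_horizontal hl hX hT ⟨x, hxU⟩
  have hD (i : Fin 3) :
      F.D i (smoothRing.mk (metric X X) (hX.smooth.smoothFnOn_metric U)) = 0 := by
    have h : smoothRing.mk (metric X X) (hX.smooth.smoothFnOn_metric U)
        = algebraMap ℝ (smoothRing U) n := smoothRing.eval_injective fun y ↦ hc y
    rw [h, Derivation.map_algebraMap]
  have h3 := h2 fun i ↦ by rw [hD, map_zero]
  simp only [frameLaplacian, hD, map_zero, mul_zero, add_zero, sub_zero] at h1
  rw [hc] at h1 h3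
  have h4 : p ^ 2 + q ^ 2 = 0 := (mul_eq_zero.1 h3).resolve_left hn.ne'
  rw [h4, mul_zero, zero_add] at h1
  have h5 : (smoothRing.eval ⟨x, hxU⟩ (contactCurvature F.D F.a F.b F.c) + 3 - 2 * l) * n = 0 := by
    linarith
  have h6 := (mul_eq_zero.1 h5).resolve_right hn.ne'
  rw [F.scalarCurvature_eq ⟨x, hxU⟩]
  linarith

/-- At a maximum of `|X|²` the Laplacian is nonpositive, so the curvature term of the Bochner
formula is nonpositive. -/
lemma IsCurlEigenfield.scalarCurvature_le {X : Field M} {l : ℝ} (hl : l ≠ 0)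
    (hX : IsCurlEigenfield S.vol l X) (hT : S.TangentToContact X) {x : M}
    (hx : 0 < metric X X x) (hmax : ∀ y, metric X X y ≤ metric X X x) :
    scalarCurvature x ≤ 4 * l - 2 := by
  obtain ⟨U, hxU, ⟨F⟩⟩ := S.exists_adaptedFrame x
  obtain ⟨p, q, h1, -⟩ := F.exists_bochner_horizontal hl hX hT ⟨x, hxU⟩
  have h2 := F.eval_frameLaplacian_nonpos_of_isLocalMax
    (smoothRing.mk (metric X X) (hX.smooth.smoothFnOn_metric U)) ⟨x, hxU⟩ (by
      filter_upwards [F.isOpen.mem_nhds hxU] with y hy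
      rw [smoothRing.ext_apply_of_mem _ hy, smoothRing.ext_apply_of_mem _ hxU]
      exact hmax y)
  rw [h1] at h2
  rw [F.scalarCurvature_eq ⟨x, hxU⟩]
  by_contra! h
  have h3 : 0 < smoothRing.eval ⟨x, hxU⟩ (contactCurvature F.D F.a F.b F.c) + 3 - 2 * l := by
    linarith
  have h4 := mul_pos h3 hx
  nlinarith [sq_nonneg p, sq_nonneg q]

/-- If the scalar curvature is at least `4 μ - 2` everywhere, then `|X|²` is subharmonic and
the strong maximum principle applies. -/
lemma IsCurlEigenfield.metric_self_eq [ConnectedSpace M] {X : Field M} {l : ℝ} (hl : l ≠ 0)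
    (hX : IsCurlEigenfield S.vol l X) (hT : S.TangentToContact X) {x : M}
    (hmax : ∀ y, metric X X y ≤ metric X X x) (hS : ∀ y : M, 4 * l - 2 ≤ scalarCurvature y)
    (y : M) : metric X X y = metric X X x := by
  refine S.eq_of_laplacian_nonneg (hX.smooth.smoothFnOn_metric univ) (fun U F y ↦ ?_) hmax y
  obtain ⟨p, q, h1, -⟩ := F.exists_bochner_horizontal hl hX hT y
  rw [h1]
  have h2 := hS y
  rw [F.scalarCurvature_eq y] at h2
  have h3 : 0 ≤ smoothRing.eval y (contactCurvature F.D F.a F.b F.c) + 3 - 2 * l := by linarith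
  have h4 := mul_nonneg h3 (metric_self_nonneg X y)
  nlinarith [sq_nonneg p, sq_nonneg q]

namespace AdaptedFrame

variable {U : Set M} (F : AdaptedFrame S U)

/-- The Bochner inequality for `|X|²` when the Ricci curvature is at least `2`; the covariant
derivative is bounded below by its antisymmetric part, the curl `Y` of `X`. -/
lemma bochner_le {X Y : Field M} (hX : SmoothField X) (hY : SmoothField Y) {r s : ℝ} (hs : s ≠ 0)
    (hXY : curl S.vol X = r • Y) (hYX : curl S.vol Y = s • X) (x : U)
    (hS : 6 ≤ scalarCurvature (x : M)) :
    r ^ 2 * metric Y Y x + 2 * (2 - r * s) * metric X X x ≤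
      smoothRing.eval x (frameLaplacian F.D F.a F.b
        (smoothRing.mk (metric X X) (hX.smoothFnOn_metric U))) := by
  set f := F.comp X (hX.smoothFieldOn U) with hf
  set g := F.comp Y (hY.smoothFieldOn U) with hg
  have hfg : frameCurl F.D F.a F.b F.c f = r • g := F.frameCurl_comp hX hY hXY
  have hgf : frameCurl F.D F.a F.b F.c g = s • f := F.frameCurl_comp hY hX hYX
  have hK : 1 ≤ smoothRing.eval x (contactCurvature F.D F.a F.b F.c) := by
    rw [F.scalarCurvature_eq x] at hS
    linarith
  have hXx : metric X X x = smoothRing.eval x (f 0) ^ 2 + smoothRing.eval x (f 1) ^ 2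
      + smoothRing.eval x (f 2) ^ 2 := by
    have h := congrArg (smoothRing.eval x) (F.mk_metric_self hX)
    simp only [map_add, map_pow] at h
    exact h
  have hYx : metric Y Y x = smoothRing.eval x (g 0) ^ 2 + smoothRing.eval x (g 1) ^ 2
      + smoothRing.eval x (g 2) ^ 2 := by
    have h := congrArg (smoothRing.eval x) (F.mk_metric_self hY)
    simp only [map_add, map_pow] at h
    exact h
  obtain ⟨c0, c1, c2⟩ := covMatrix_sub (D := F.D) (a := F.a) (b := F.b) (c := F.c) f
  rw [F.mk_metric_self hX, ← hf,
    F.structureEquations.bochner f (F.structureEquations.div_eq_zero hs hgf), hXx, hYx]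
  rw [hfg] at c0 c1 c2 ⊢
  rw [frameCurl_smul, hgf]
  generalize covMatrix F.D F.a F.b F.c f = C at c0 c1 c2 ⊢
  replace c0 := congrArg (smoothRing.eval x) c0
  replace c1 := congrArg (smoothRing.eval x) c1
  replace c2 := congrArg (smoothRing.eval x) c2
  simp only [Fin.sum_univ_three, Pi.smul_apply, map_add, map_sub, map_mul, map_pow, map_smul,
    smul_eq_mul, map_ofNat, map_one] at c0 c1 c2 ⊢
  set k := smoothRing.eval x (contactCurvature F.D F.a F.b F.c) with hk
  have hk1 := mul_nonneg (sub_nonneg.2 hK) (sq_nonneg (smoothRing.eval x (f 1)))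
  have hk2 := mul_nonneg (sub_nonneg.2 hK) (sq_nonneg (smoothRing.eval x (f 2)))
  -- `(u - v)² ≤ 2 (u² + v²)` for the off-diagonal entries
  have q0 : (r * smoothRing.eval x (g 0)) ^ 2 ≤
      2 * (smoothRing.eval x (C 1 2) ^ 2 + smoothRing.eval x (C 2 1) ^ 2) := by
    rw [← c0]; nlinarith [sq_nonneg (smoothRing.eval x (C 1 2) + smoothRing.eval x (C 2 1))]
  have q1 : (r * smoothRing.eval x (g 1)) ^ 2 ≤
      2 * (smoothRing.eval x (C 2 0) ^ 2 + smoothRing.eval x (C 0 2) ^ 2) := by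
    rw [← c1]; nlinarith [sq_nonneg (smoothRing.eval x (C 2 0) + smoothRing.eval x (C 0 2))]
  have q2 : (r * smoothRing.eval x (g 2)) ^ 2 ≤
      2 * (smoothRing.eval x (C 0 1) ^ 2 + smoothRing.eval x (C 1 0) ^ 2) := by
    rw [← c2]; nlinarith [sq_nonneg (smoothRing.eval x (C 0 1) + smoothRing.eval x (C 1 0))]
  have p0 := sq_nonneg (smoothRing.eval x (C 0 0))
  have p1 := sq_nonneg (smoothRing.eval x (C 1 1))
  have p2 := sq_nonneg (smoothRing.eval x (C 2 2))
  linarith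

end AdaptedFrame

/-- If `Scal ≥ 6`, a nonzero eigenvalue `l` of `curl ∘ curl` is at least `4`: apply the second
derivative test at a maximum of `|X|² + |curl X|² / |l|`. -/
lemma SasakianStructure.four_le_of_curl_curl [CompactSpace M] (S : SasakianStructure M)
    (hS : ∀ x : M, 6 ≤ scalarCurvature x) {X : Field M} (hX : SmoothField X) (hX0 : X ≠ 0) {l : ℝ}
    (hl : l ≠ 0) (h : curl S.vol (curl S.vol X) = l • X) : 4 ≤ l := by
  set Y := curl S.vol X with hY
  have hYs : SmoothField Y := S.smoothField_curl hX
  have hl' : 0 < |l| := abs_pos.2 hl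
  set N : M → ℝ := fun x ↦ metric X X x + |l|⁻¹ * metric Y Y x with hN
  have hNs (U : Set M) : SmoothFnOn U N :=
    (hX.smoothFnOn_metric U).add (contMDiffOn_const.mul (hYs.smoothFnOn_metric U))
  have hNc : Continuous N := (contMDiffOn_univ.1 (hNs univ)).continuous
  obtain ⟨y, hy⟩ := exists_metric_self_pos hX0
  obtain ⟨x, -, hx⟩ := isCompact_univ.exists_isMaxOn ⟨y, mem_univ y⟩ hNc.continuousOn
  have hNx : 0 < N x := by
    have h1 : N y ≤ N x := hx (mem_univ y)
    have h2 : 0 ≤ |l|⁻¹ * metric Y Y y :=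
      mul_nonneg (inv_nonneg.2 hl'.le) (metric_self_nonneg Y y)
    have h3 : N y = metric X X y + |l|⁻¹ * metric Y Y y := rfl
    linarith
  obtain ⟨U, hxU, ⟨F⟩⟩ := S.exists_adaptedFrame x
  have hL := F.eval_frameLaplacian_nonpos_of_isLocalMax (smoothRing.mk N (hNs U)) ⟨x, hxU⟩ (by
    filter_upwards [F.isOpen.mem_nhds hxU] with z hz
    rw [smoothRing.ext_apply_of_mem _ hz, smoothRing.ext_apply_of_mem _ hxU]
    exact hx (mem_univ z))
  have hsum : smoothRing.mk N (hNs U) = smoothRing.mk (metric X X) (hX.smoothFnOn_metric U)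
      + |l|⁻¹ • smoothRing.mk (metric Y Y) (hYs.smoothFnOn_metric U) :=
    smoothRing.eval_injective fun _ ↦ rfl
  rw [hsum, frameLaplacian_add_smul, map_add, map_smul, smul_eq_mul] at hL
  have h1 := F.bochner_le hX hYs (r := 1) hl (by rw [one_smul]) h ⟨x, hxU⟩ (hS x)
  have h2 := F.bochner_le hYs hX (s := 1) one_ne_zero h (by rw [one_smul]) ⟨x, hxU⟩ (hS x)
  have h3 := mul_le_mul_of_nonneg_left h2 (inv_nonneg.2 hl'.le)
  have h4 : |l|⁻¹ * l ^ 2 = |l| := by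
    rw [← sq_abs, pow_two, inv_mul_cancel_left₀ hl'.ne']
  have h5 : |l|⁻¹ * |l| = 1 := inv_mul_cancel₀ hl'.ne'
  -- the two Bochner inequalities, added with weights `1` and `1 / |l|`
  have h6 : (|l| / 2 + 2 - l) * N x ≤ 0 := by
    have e : N x = metric X X x + |l|⁻¹ * metric Y Y x := rfl
    rw [e]
    have e1 : |l|⁻¹ * (l ^ 2 * metric X X x) = |l| * metric X X x := by rw [← mul_assoc, h4]
    have e2 : |l| * (|l|⁻¹ * metric Y Y x) = metric Y Y x := by
      rw [← mul_assoc, mul_comm |l|, h5, one_mul]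
    nlinarith
  have h7 : |l| / 2 + 2 - l ≤ 0 := by
    by_contra! h8
    exact absurd (mul_pos h8 hNx) (not_lt.2 h6)
  have h8 := abs_nonneg l
  -- `l ≥ |l| / 2 + 2 > 0`, so that `|l| = l`
  rw [abs_of_pos (by linarith)] at h7
  linarith

end Eigenfields

end SasakianThree

end

theorem mainTheorem8 {M : Type*} [TopologicalSpace M] [ChartedSpace E3 M]
    [IsManifold (𝓡 3) ∞ M] [T2Space M] [CompactSpace M] [ConnectedSpace M]
    [RiemannianBundle (fun x : M ↦ TangentSpace (𝓡 3) x)]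
    [IsContMDiffRiemannianBundle (𝓡 3) ∞ E3 (fun x : M ↦ TangentSpace (𝓡 3) x)]
    (S : SasakianThree.SasakianStructure M) :
    ((∀ x : M, -2 < SasakianThree.scalarCurvature x) →
      ∃ m : ℝ, IsLeast (Set.range (SasakianThree.scalarCurvature (M := M))) m ∧
        ∀ (μ : ℝ) (X : SasakianThree.Field M), 0 < μ →
          SasakianThree.IsCurlEigenfield S.vol μ X → S.TangentToContact X →
            m / 4 + 1 / 2 ≤ μ ∧
            (μ = m / 4 + 1 / 2 ↔
              (∃ c : ℝ, ∀ x, ‖X x‖ = c) ∧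
              (∃ c : ℝ, ∀ x : M, SasakianThree.scalarCurvature x = c))) ∧
    ((∀ x : M, 6 ≤ SasakianThree.scalarCurvature x) →
      IsLeast {μ : ℝ | 0 < μ ∧ ∃ X : SasakianThree.Field M,
        SasakianThree.IsCurlEigenfield S.vol μ X} 2 ∧
      IsLeast {l : ℝ | l ≠ 0 ∧ SasakianThree.IsCoClosedEigenvalue S.vol l} 4) := by
  obtain ⟨x₀⟩ : Nonempty M := inferInstance
  refine ⟨fun _ ↦ ?_, fun hS ↦ ⟨⟨⟨two_pos, S.ξ, ?_⟩, ?_⟩, ⟨⟨four_ne_zero, S.η, ?_⟩, ?_⟩⟩⟩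
  · obtain ⟨q, -, hq⟩ := isCompact_univ.exists_isMinOn ⟨x₀, mem_univ x₀⟩
      S.continuous_scalarCurvature.continuousOn
    have hmin : ∀ y, SasakianThree.scalarCurvature q ≤ SasakianThree.scalarCurvature y :=
      fun y ↦ hq (mem_univ y)
    refine ⟨_, ⟨⟨q, rfl⟩, by rintro _ ⟨y, rfl⟩; exact hmin y⟩, fun μ X hμ hX hT ↦ ?_⟩
    have hNc : Continuous (SasakianThree.metric X X) :=
      (contMDiffOn_univ.1 (hX.smooth.smoothFnOn_metric univ)).continuous
    obtain ⟨p, -, hp⟩ := isCompact_univ.exists_isMaxOn ⟨x₀, mem_univ x₀⟩ hNc.continuousOn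
    have hmax : ∀ y, SasakianThree.metric X X y ≤ SasakianThree.metric X X p :=
      fun y ↦ hp (mem_univ y)
    have hpos : 0 < SasakianThree.metric X X p := by
      obtain ⟨y, hy⟩ := SasakianThree.exists_metric_self_pos hX.ne_zero
      exact hy.trans_le (hmax y)
    have hle := hX.scalarCurvature_le hμ.ne' hT hpos hmax
    refine ⟨by linarith [hmin p], fun h ↦ ?_, ?_⟩
    · have hconst := hX.metric_self_eq hμ.ne' hT hmax fun y ↦ by linarith [hmin y]
      refine ⟨⟨Real.sqrt (SasakianThree.metric X X p), fun x ↦ ?_⟩,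
        ⟨_, hX.scalarCurvature_eq hμ.ne' hT hpos hconst⟩⟩
      rw [← hconst x]
      exact norm_eq_sqrt_real_inner _
    · rintro ⟨⟨c, hc⟩, -⟩
      have hconst : ∀ x, SasakianThree.metric X X x = SasakianThree.metric X X p := fun x ↦ by
        unfold SasakianThree.metric
        rw [real_inner_self_eq_norm_sq, real_inner_self_eq_norm_sq, hc, hc]
      have h := hX.scalarCurvature_eq hμ.ne' hT hpos hconst q
      linarith
  · refine ⟨S.smooth_ξ, fun h ↦ ?_, S.curl_reeb⟩
    have h1 := S.norm_reeb x₀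
    rw [h, Pi.zero_apply, norm_zero] at h1
    exact zero_ne_one h1
  · rintro μ ⟨hμ, X, hX⟩
    have h : SasakianThree.curl S.vol (SasakianThree.curl S.vol X) = (μ ^ 2) • X := by
      rw [hX.eigen, SasakianThree.curl_smul, hX.eigen, smul_smul, pow_two]
    have h4 := S.four_le_of_curl_curl hS hX.smooth hX.ne_zero (pow_ne_zero 2 hμ.ne') h
    nlinarith
  · refine ⟨S.smooth_η, fun h ↦ ?_, S.coClosed_eta, S.hodgeLaplacian_eta⟩
    have h1 := S.η_reeb x₀
    rw [h] at h1
    exact zero_ne_one h1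
  · rintro l ⟨hl, α, hα, hα0, hcc, hΔ⟩
    rw [SasakianThree.hodgeLaplacian_of_coClosed _ hcc] at hΔ
    refine S.four_le_of_curl_curl hS (X := SasakianThree.sharp α) (S.smoothField_sharp hα) ?_ hl ?_
    · intro h
      refine hα0 ?_
      have h2 := SasakianThree.flat_smul 0 (SasakianThree.sharp α)
      rwa [zero_smul, zero_smul, ← h, SasakianThree.flat_sharp] at h2
    · rw [← SasakianThree.sharp_smul, ← hΔ, SasakianThree.sharp_flat]
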